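/- Let $m\ge 0$ and $\theta\in(-\frac{\pi}{2},\frac{\pi}{2})$. In the Hilbert space $L^2(\mathbb{R})^4$ consider the rotated Dirac oscillator $$H_\theta=-i\alpha_1e^{-i\theta/2}\partial_x-\alpha_2e^{i\theta/2}x+m\alpha_3,\qquad \mathsf{D}(H_\theta)=\big(H^1(\mathbb{R})\cap L^2(\mathbb{R},x^2\,\mathrm{d}x)\big)^4,$$ where $\alpha_k=\begin{pmatrix}0&\sigma_k\\ \sigma_k&0\end{pmatrix}$, $k=1,2,3$, are the Dirac matrices built from the Pauli matrices $\sigma_k$. For every $n\in\mathbb{N}=\{0,1,2,\dots\}$ and each choice of sign, $\pm\sqrt{2n+m^2}$ is an eigenvalue of $H_\theta$ and there is a (necessarily unique) spectral projector $P_n^\pm$ at this eigenvalue, that is, a bounded projection of $L^2(\mathbb{R})^4$ onto the eigenspace $\ker(H_\theta\mp\sqrt{2n+m^2})$ along $\operatorname{ran}(H_\theta\mp\sqrt{2n+m^2})$. For both signs, the operator norms satisfy $$\lim_{n\to\infty}\frac{\log\|P_n^\pm\|}{n}=\log\sqrt{\frac{1+|\sin\theta|}{1-|\sin\theta|}}.$$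 In particular, if $\theta\ne0$, then no sequence of eigenfunctions of $H_\theta$ (chosen and ordered in any way) is a Riesz basis or a Schauder basis of $L^2(\mathbb{R})^4$. Here a Riesz basis is the image of an orthonormal basis under a bounded operator with bounded inverse. -/

import Mathlib

open MeasureTheory Filter Topology
open scoped ContDiff ENNReal

namespace RotatedDirac

/-- The Hilbert space `L²(ℝ)` of complex-valued square-integrable functions. -/
abbrev L2 : Type := Lp ℂ 2 (volume : Measure ℝ)

/-- The Hilbert space `L²(ℝ)⁴` with norm `‖Ψ‖² = ∑ j, ‖Ψ j‖²`. -/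
abbrev Spinor : Type := PiLp 2 (fun _ : Fin 4 => L2)

/-- `v ∈ L²(ℝ)` is the weak derivative of `u ∈ L²(ℝ)`. -/
def IsWeakDeriv (u v : L2) : Prop :=
  ∀ g : ℝ → ℝ, ContDiff ℝ ∞ g → HasCompactSupport g →
    ∫ x, deriv g x • u x = -∫ x, g x • v x

theorem integrable_test_smul (u : L2) {g : ℝ → ℝ} (hg : Continuous g)
    (hc : HasCompactSupport g) : Integrable (fun x => g x • u x) :=
  ((Lp.memLp u).locallyIntegrable one_le_two).integrable_smul_left_of_hasCompactSupport hg hc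

theorem IsWeakDeriv.unique {u v w : L2} (hv : IsWeakDeriv u v) (hw : IsWeakDeriv u w) :
    v = w := by
  apply Lp.ext
  apply ae_eq_of_integral_contDiff_smul_eq ((Lp.memLp v).locallyIntegrable one_le_two)
    ((Lp.memLp w).locallyIntegrable one_le_two)
  intro g hg hc
  have h := (hv g hg hc).symm.trans (hw g hg hc)
  exact neg_injective h

theorem IsWeakDeriv.add {u v u' v' : L2} (h : IsWeakDeriv u v) (h' : IsWeakDeriv u' v') :
    IsWeakDeriv (u + u') (v + v') := by
  intro g hg hc
  have hd : Continuous (deriv g) := hg.continuous_deriv (by norm_num)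
  have e1 : ∫ x, deriv g x • (u + u' : L2) x
      = ∫ x, (deriv g x • u x + deriv g x • u' x) := by
    apply integral_congr_ae
    filter_upwards [Lp.coeFn_add u u'] with x hx
    rw [hx, Pi.add_apply, smul_add]
  have e2 : ∫ x, g x • (v + v' : L2) x = ∫ x, (g x • v x + g x • v' x) := by
    apply integral_congr_ae
    filter_upwards [Lp.coeFn_add v v'] with x hx
    rw [hx, Pi.add_apply, smul_add]
  rw [e1, e2, integral_add (integrable_test_smul u hd hc.deriv)
    (integrable_test_smul u' hd hc.deriv), integral_add
    (integrable_test_smul v hg.continuous hc) (integrable_test_smul v' hg.continuous hc),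
    h g hg hc, h' g hg hc, neg_add]

theorem IsWeakDeriv.smul {u v : L2} (c : ℂ) (h : IsWeakDeriv u v) :
    IsWeakDeriv (c • u) (c • v) := by
  intro g hg hc
  have e1 : ∫ x, deriv g x • (c • u : L2) x = ∫ x, c • (deriv g x • u x) := by
    apply integral_congr_ae
    filter_upwards [Lp.coeFn_smul c u] with x hx
    rw [hx, Pi.smul_apply, smul_comm]
  have e2 : ∫ x, g x • (c • v : L2) x = ∫ x, c • (g x • v x) := by
    apply integral_congr_ae
    filter_upwards [Lp.coeFn_smul c v] with x hx
    rw [hx, Pi.smul_apply, smul_comm]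
  rw [e1, e2, integral_smul, integral_smul, h g hg hc, smul_neg]

theorem isWeakDeriv_zero : IsWeakDeriv 0 0 := by
  simpa using IsWeakDeriv.smul (0 : ℂ) (u := 0) (v := 0) (fun g _ _ => by
    have e : ∀ f : ℝ → ℝ, ∫ x, f x • (0 : L2) x = 0 := fun f => by
      rw [← integral_zero ℝ ℂ]
      apply integral_congr_ae
      filter_upwards [Lp.coeFn_zero ℂ 2 (volume : Measure ℝ)] with x hx
      rw [hx]; simp
    rw [e, e, neg_zero])

/-- The derivative `u ↦ u'` in `L²(ℝ)` with domain the Sobolev space `H¹(ℝ)`. -/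
noncomputable def derivOp : L2 →ₗ.[ℂ] L2 where
  domain :=
    { carrier := {u | ∃ v, IsWeakDeriv u v}
      add_mem' := by
        rintro u u' ⟨v, h⟩ ⟨v', h'⟩
        exact ⟨v + v', h.add h'⟩
      zero_mem' := ⟨0, isWeakDeriv_zero⟩
      smul_mem' := by
        rintro c u ⟨v, h⟩
        exact ⟨c • v, h.smul c⟩ }
  toFun :=
    { toFun := fun u => u.2.choose
      map_add' := fun u u' =>
        (u + u').2.choose_spec.unique (u.2.choose_spec.add u'.2.choose_spec)
      map_smul' := fun c u => (c • u).2.choose_spec.unique (u.2.choose_spec.smul c) }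

/-- Multiplication by the coordinate, `u ↦ x u`, with domain `L²(ℝ) ∩ L²(ℝ, x² dx)`. -/
noncomputable def posOp : L2 →ₗ.[ℂ] L2 where
  domain :=
    { carrier := {u | MemLp (fun x : ℝ => (x : ℂ) * u x) 2 volume}
      add_mem' := by
        intro u u' h h'
        refine (memLp_congr_ae ?_).mp (MemLp.add h h')
        filter_upwards [Lp.coeFn_add u u'] with x hx
        simp only [Pi.add_apply, hx, mul_add]
      zero_mem' := by
        refine (memLp_congr_ae ?_).mp (MemLp.zero (p := 2) (μ := (volume : Measure ℝ)) (ε := ℂ))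
        filter_upwards [Lp.coeFn_zero ℂ 2 (volume : Measure ℝ)] with x hx
        simp
      smul_mem' := by
        intro c u h
        refine (memLp_congr_ae ?_).mp (MemLp.const_smul h c)
        filter_upwards [Lp.coeFn_smul c u] with x hx
        simp only [Pi.smul_apply, hx, smul_eq_mul]
        ring }
  toFun :=
    { toFun := fun u => MemLp.toLp (fun x : ℝ => (x : ℂ) * (u : L2) x) u.2
      map_add' := fun u u' => by
        rw [← MemLp.toLp_add]
        apply MemLp.toLp_congr
        filter_upwards [Lp.coeFn_add (u : L2) u'] with x hx
        simp only [Submodule.coe_add, Pi.add_apply, hx, mul_add]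
      map_smul' := fun c u => by
        rw [RingHom.id_apply, ← MemLp.toLp_const_smul]
        apply MemLp.toLp_congr
        filter_upwards [Lp.coeFn_smul c (u : L2)] with x hx
        simp only [Submodule.coe_smul, Pi.smul_apply, hx, smul_eq_mul]
        ring }

/-- The space `𝒟 = H¹(ℝ) ∩ L²(ℝ, x² dx)`. -/
noncomputable def formDomain : Submodule ℂ L2 := derivOp.domain ⊓ posOp.domain

/-- The Dirac matrix `α₁` (standard representation). -/
def alpha1 : Matrix (Fin 4) (Fin 4) ℂ :=
  !![0, 0, 0, 1; 0, 0, 1, 0; 0, 1, 0, 0; 1, 0, 0, 0]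

/-- The Dirac matrix `α₂` (standard representation). -/
def alpha2 : Matrix (Fin 4) (Fin 4) ℂ :=
  !![0, 0, 0, -Complex.I; 0, 0, Complex.I, 0; 0, -Complex.I, 0, 0; Complex.I, 0, 0, 0]

/-- The Dirac matrix `α₃` (standard representation). -/
def alpha3 : Matrix (Fin 4) (Fin 4) ℂ :=
  !![0, 0, 1, 0; 0, 0, 0, -1; 1, 0, 0, 0; 0, -1, 0, 0]

/-- The rotated Dirac oscillator
`H_θ = -i α₁ e^{-iθ/2} ∂ₓ - α₂ e^{iθ/2} x + m α₃` in `L²(ℝ)⁴` with domain `𝒟⁴`. -/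
noncomputable def diracOp (θ m : ℝ) : Spinor →ₗ.[ℂ] Spinor where
  domain :=
    { carrier := {Ψ | ∀ j, Ψ j ∈ formDomain}
      add_mem' := fun h h' j => formDomain.add_mem (h j) (h' j)
      zero_mem' := fun _ => formDomain.zero_mem
      smul_mem' := fun c _ h j => formDomain.smul_mem c (h j) }
  toFun :=
    { toFun := fun Ψ => WithLp.toLp 2 fun i => ∑ j : Fin 4,
        ((-Complex.I * alpha1 i j * Complex.exp (-(Complex.I * θ / 2))) •
            derivOp ⟨(Ψ : Spinor) j, (Ψ.2 j).1⟩
          - (alpha2 i j * Complex.exp (Complex.I * θ / 2)) •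
            posOp ⟨(Ψ : Spinor) j, (Ψ.2 j).2⟩
          + ((m : ℂ) * alpha3 i j) • (Ψ : Spinor) j)
      map_add' := fun Ψ Φ => by
        have hd : ∀ j, derivOp ⟨((Ψ + Φ : _) : Spinor) j, ((Ψ + Φ).2 j).1⟩
            = derivOp ⟨(Ψ : Spinor) j, (Ψ.2 j).1⟩ + derivOp ⟨(Φ : Spinor) j, (Φ.2 j).1⟩ :=
          fun j => derivOp.map_add ⟨(Ψ : Spinor) j, (Ψ.2 j).1⟩ ⟨(Φ : Spinor) j, (Φ.2 j).1⟩
        have hx : ∀ j, posOp ⟨((Ψ + Φ : _) : Spinor) j, ((Ψ + Φ).2 j).2⟩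
            = posOp ⟨(Ψ : Spinor) j, (Ψ.2 j).2⟩ + posOp ⟨(Φ : Spinor) j, (Φ.2 j).2⟩ :=
          fun j => posOp.map_add ⟨(Ψ : Spinor) j, (Ψ.2 j).2⟩ ⟨(Φ : Spinor) j, (Φ.2 j).2⟩
        ext1 i
        simp only [PiLp.add_apply, ← Finset.sum_add_distrib]
        refine Finset.sum_congr rfl fun j _ => ?_
        rw [hd, hx, Submodule.coe_add, PiLp.add_apply]
        simp only [smul_add]
        abel
      map_smul' := fun c Ψ => by
        have hd : ∀ j, derivOp ⟨((c • Ψ : _) : Spinor) j, ((c • Ψ).2 j).1⟩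
            = c • derivOp ⟨(Ψ : Spinor) j, (Ψ.2 j).1⟩ :=
          fun j => derivOp.map_smul c ⟨(Ψ : Spinor) j, (Ψ.2 j).1⟩
        have hx : ∀ j, posOp ⟨((c • Ψ : _) : Spinor) j, ((c • Ψ).2 j).2⟩
            = c • posOp ⟨(Ψ : Spinor) j, (Ψ.2 j).2⟩ :=
          fun j => posOp.map_smul c ⟨(Ψ : Spinor) j, (Ψ.2 j).2⟩
        ext1 i
        simp only [PiLp.smul_apply, RingHom.id_apply, Finset.smul_sum]
        refine Finset.sum_congr rfl fun j _ => ?_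
        rw [hd, hx, Submodule.coe_smul, PiLp.smul_apply]
        simp only [smul_add, smul_sub, smul_comm c] }

section General

variable {E : Type*} [NormedAddCommGroup E]

/-- The eigenspace `ker (T - μ)` of an unbounded operator `T`. -/
def eigenspace [NormedSpace ℂ E] (T : E →ₗ.[ℂ] E) (μ : ℂ) : Submodule ℂ E :=
  (LinearMap.ker (T.toFun - μ • T.domain.subtype)).map T.domain.subtype

/-- The range `ran (T - μ)` of an unbounded operator `T` shifted by `μ`. -/
def shiftedRange [NormedSpace ℂ E] (T : E →ₗ.[ℂ] E) (μ : ℂ) : Submodule ℂ E :=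
  LinearMap.range (T.toFun - μ • T.domain.subtype)

/-- `P` is the spectral projector (eigenprojector) of `T` at the semisimple eigenvalue `μ`:
the bounded projection onto `ker (T - μ) ≠ 0` along `ran (T - μ)`. -/
structure IsSpectralProjector [NormedSpace ℂ E] (T : E →ₗ.[ℂ] E) (μ : ℂ) (P : E →L[ℂ] E) :
    Prop where
  eigenvalue : eigenspace T μ ≠ ⊥
  idem : ∀ x, P (P x) = P x
  range_eq : LinearMap.range (P : E →ₗ[ℂ] E) = eigenspace T μ
  ker_eq : LinearMap.ker (P : E →ₗ[ℂ] E) = shiftedRange T μ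

/-- The spectral projector is determined by the operator and the eigenvalue. -/
theorem IsSpectralProjector.unique [NormedSpace ℂ E] {T : E →ₗ.[ℂ] E} {μ : ℂ}
    {P Q : E →L[ℂ] E} (hP : IsSpectralProjector T μ P) (hQ : IsSpectralProjector T μ Q) :
    P = Q := by
  ext x
  have h1 : Q (P x) = P x := by
    have : P x ∈ LinearMap.range (Q : E →ₗ[ℂ] E) := by
      rw [hQ.range_eq, ← hP.range_eq]
      exact ⟨x, rfl⟩
    obtain ⟨y, hy⟩ := this
    rw [← hy]
    exact hQ.idem y
  have h2 : Q (x - P x) = 0 := by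
    have : x - P x ∈ LinearMap.ker (Q : E →ₗ[ℂ] E) := by
      rw [hQ.ker_eq, ← hP.ker_eq, LinearMap.mem_ker]
      simp [hP.idem]
    exact this
  rw [map_sub, h1] at h2
  exact (sub_eq_zero.mp h2).symm

/-- `x` is an eigenvector of the unbounded operator `T`. -/
def IsEigenvector [NormedSpace ℂ E] (T : E →ₗ.[ℂ] E) (x : E) : Prop :=
  x ≠ 0 ∧ ∃ μ : ℂ, x ∈ eigenspace T μ

/-- `e` is a Schauder basis of `E`. -/
def IsSchauderBasis [NormedSpace ℂ E] (e : ℕ → E) : Prop :=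
  ∃ b : SchauderBasis ℂ E, ∀ k, b k = e k

/-- `e` is a Riesz basis of `E`: the image of an orthonormal basis under a bounded operator
with bounded inverse. -/
def IsRieszBasis [InnerProductSpace ℂ E] (e : ℕ → E) : Prop :=
  ∃ (b : HilbertBasis ℕ ℂ E) (A : E ≃L[ℂ] E), ∀ k, e k = A (b k)

end General

end RotatedDirac

/-!
With `z = exp (iθ/2)` and the ladder operators `a = z⁻¹ ∂ₓ + z x`, `b = -z⁻¹ ∂ₓ + z x` on
`H¹(ℝ) ∩ L²(ℝ, x² dx)`, the Dirac operator is block off-diagonal with entries `i b`, `-i a` and `±m`,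
and `a b = b a + 2`. Everything therefore reduces to the rotated oscillator `b a`.

*Solvability of the first-order equations.* `a` and `b` are multiples of `u ↦ u' ± κ x u` with
`κ = z²` and `re κ = cos θ > 0`. Variation of constants solves `u' + κ x u = f` for every `f` in
`L²` if `re κ > 0`, and for `f` orthogonal to a Gaussian if `re κ < 0`; that the solution lies in
the domain is Schur's test for an explicit Gaussian kernel (`exists_solution_of_re_pos`,
`exists_solution_of_re_neg`). By the lemma of du Bois-Reymond weak solutions in `L²` are these, which
gives the kernels, and shows that `a b` and `b a` are defined on the same functions
(`exists_lad_neg_eq`).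

*The eigenprojections.* The rotated Hermite functions `φₙ`, obtained by applying `b` to a complex
Gaussian, and the functionals `f ↦ ∫ f φₙ` (no conjugation), suitably normalized, are
biorthogonal. By induction along the ladder `b a - 2n` has kernel `ℂ φₙ` and is onto the kernel of
the `n`-th functional. Hence the square of the Dirac operator has at `2n + m²` a spectral projection
of rank at most four, on whose range the Dirac operator acts by `diracMatrix`
(`isSquareReducing_diracOp`), and `(1 + H / μ) / 2` times it is the spectral projector of `H` at
`μ = ±√(2n + m²) ≠ 0` (`IsSquareReducing.isSpectralProjector`). At `μ = 0` the operator vanishes on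
the block, and the projection itself serves.

*The norms.* Up to constants `‖Pₙ‖` lies between `‖φₙ‖²` and `‖φₙ‖² + ‖φₙ₋₁‖²`, because `f ↦ ∫ f φₙ`
has the same norm as `φₙ`. Position is symmetric and the derivative antisymmetric; written in terms
of `a` and `b` this couples `‖φₙ‖²` with the inner products of `φₙ₋₁` and `φₙ₊₁` in a real two-term
recursion (`hermSq_hermCross_recursion`), whose solution grows like `((1 + |sin θ|) / cos θ) ^ n` up
to a factor linear in `n` (`growth_of_recursion`). No asymptotics of special functions is needed.

*Bases.* In a Schauder basis of eigenvectors the spectral projector at an eigenvalue is the sum of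
the at most four rank-one basis projections belonging to it, and these are uniformly bounded
(`exists_forall_norm_spectralProjector_le`). For `θ ≠ 0` the norms grow exponentially, so there is
no such basis; a Riesz basis is a Schauder basis.
-/

namespace RotatedDirac

open scoped SchwartzMap

/-! ### Weak derivatives of locally integrable functions -/

/-- `v` is the weak derivative of the function `u` on the line, tested against complex-valued
smooth functions of compact support. Unlike `IsWeakDeriv`, neither function has to be in `L²`. -/
def WeakDeriv (u v : ℝ → ℂ) : Prop :=
  ∀ g : ℝ → ℂ, ContDiff ℝ ∞ g → HasCompactSupport g →
    ∫ x, deriv g x * u x = -∫ x, g x * v x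

theorem integrable_test_mul {u : ℝ → ℂ} (hu : LocallyIntegrable u) {g : ℝ → ℂ}
    (hg : Continuous g) (hc : HasCompactSupport g) : Integrable (fun x => g x * u x) := by
  simpa only [smul_eq_mul] using hu.integrable_smul_left_of_hasCompactSupport hg hc

theorem locallyIntegrable_coe (u : L2) : LocallyIntegrable (u : ℝ → ℂ) :=
  (Lp.memLp u).locallyIntegrable one_le_two

theorem locallyIntegrable_mul {u E : ℝ → ℂ} (hu : LocallyIntegrable u) (hE : Continuous E) :
    LocallyIntegrable (fun x => E x * u x) := by
  rw [← locallyIntegrableOn_univ] at hu ⊢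
  exact hu.continuousOn_mul hE.continuousOn isClosed_univ.isLocallyClosed

theorem contDiff_re {g : ℝ → ℂ} (hg : ContDiff ℝ ∞ g) : ContDiff ℝ ∞ (fun x => (g x).re) :=
  Complex.reCLM.contDiff.comp hg

theorem contDiff_im {g : ℝ → ℂ} (hg : ContDiff ℝ ∞ g) : ContDiff ℝ ∞ (fun x => (g x).im) :=
  Complex.imCLM.contDiff.comp hg

theorem IsWeakDeriv.weakDeriv {u v : L2} (h : IsWeakDeriv u v) : WeakDeriv u v := by
  intro g hg hc
  have hdiff : Differentiable ℝ g := hg.differentiable (by norm_num)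
  have hre := h _ (contDiff_re hg) (hc.comp_left (g := Complex.re) rfl)
  have him := h _ (contDiff_im hg) (hc.comp_left (g := Complex.im) rfl)
  have dre : ∀ x, deriv (fun x => (g x).re) x = (deriv g x).re := fun x =>
    (Complex.reCLM.hasFDerivAt.comp_hasDerivAt x (hdiff x).hasDerivAt).deriv
  have dim : ∀ x, deriv (fun x => (g x).im) x = (deriv g x).im := fun x =>
    (Complex.imCLM.hasFDerivAt.comp_hasDerivAt x (hdiff x).hasDerivAt).deriv
  have hd : Continuous (deriv g) := hg.continuous_deriv (by norm_num)
  have key : ∀ (w : L2) (k : ℝ → ℂ), Continuous k → HasCompactSupport k →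
      ∫ x, k x * w x = (∫ x, (k x).re • w x) + Complex.I * ∫ x, (k x).im • w x := by
    intro w k hk hkc
    have j1 : Integrable fun x => (k x).re • w x :=
      integrable_test_smul w (Complex.continuous_re.comp hk) (hkc.comp_left (g := Complex.re) rfl)
    have j2 : Integrable fun x => (k x).im • w x :=
      integrable_test_smul w (Complex.continuous_im.comp hk) (hkc.comp_left (g := Complex.im) rfl)
    rw [← integral_const_mul, ← integral_add j1 (j2.const_mul _)]
    refine integral_congr_ae (.of_forall fun x => ?_)
    simp only [Complex.real_smul]
    conv_lhs => rw [← Complex.re_add_im (k x)]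
    ring
  simp only [dre, dim] at hre him
  rw [key u _ hd hc.deriv, key v _ hg.continuous hc, hre, him]
  ring

theorem WeakDeriv.isWeakDeriv {u v : L2} (h : WeakDeriv u v) : IsWeakDeriv u v := by
  intro g hg hc
  have hdiff : Differentiable ℝ g := hg.differentiable (by norm_num)
  have := h (fun x => (g x : ℂ)) (Complex.ofRealCLM.contDiff.comp hg)
    (hc.comp_left (g := Complex.ofReal) rfl)
  have d : ∀ x, deriv (fun x => (g x : ℂ)) x = ((deriv g x : ℝ) : ℂ) := fun x =>
    ((hdiff x).hasDerivAt.ofReal_comp).deriv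
  simpa only [d, Complex.real_smul] using this

theorem WeakDeriv.congr {u v u' v' : ℝ → ℂ} (h : WeakDeriv u v) (hu : u =ᵐ[volume] u')
    (hv : v =ᵐ[volume] v') : WeakDeriv u' v' := by
  intro g hg hc
  have e1 : ∫ x, deriv g x * u' x = ∫ x, deriv g x * u x :=
    integral_congr_ae (by filter_upwards [hu] with x hx; rw [hx])
  have e2 : ∫ x, g x * v' x = ∫ x, g x * v x :=
    integral_congr_ae (by filter_upwards [hv] with x hx; rw [hx])
  rw [e1, e2, h g hg hc]

theorem WeakDeriv.sub {u v u' v' : ℝ → ℂ} (h : WeakDeriv u v) (h' : WeakDeriv u' v')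
    (hu : LocallyIntegrable u) (hv : LocallyIntegrable v) (hu' : LocallyIntegrable u')
    (hv' : LocallyIntegrable v') :
    WeakDeriv (fun x => u x - u' x) (fun x => v x - v' x) := by
  intro g hg hc
  have hd : Continuous (deriv g) := hg.continuous_deriv (by norm_num)
  simp only [mul_sub]
  rw [integral_sub (integrable_test_mul hu hd hc.deriv) (integrable_test_mul hu' hd hc.deriv),
    integral_sub (integrable_test_mul hv hg.continuous hc)
      (integrable_test_mul hv' hg.continuous hc), h g hg hc, h' g hg hc]
  ring

/-- Product rule for a weakly differentiable and a smooth function. -/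
theorem WeakDeriv.smooth_mul {u v E E' : ℝ → ℂ} (h : WeakDeriv u v) (hu : LocallyIntegrable u)
    (hv : LocallyIntegrable v) (hE : ContDiff ℝ ∞ E) (hE' : ∀ x, HasDerivAt E (E' x) x) :
    WeakDeriv (fun x => E x * u x) (fun x => E x * v x + E' x * u x) := by
  intro g hg hc
  have hd : Continuous (deriv g) := hg.continuous_deriv (by norm_num)
  have hE'c : Continuous E' := by
    have : E' = deriv E := funext fun x => (hE' x).deriv.symm
    rw [this]; exact hE.continuous_deriv (by norm_num)
  have hgE := h (fun x => g x * E x) (hg.mul hE) hc.mul_right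
  have dd : ∀ x, deriv (fun x => g x * E x) x = deriv g x * E x + g x * E' x := fun x =>
    (((hg.differentiable (by norm_num)) x).hasDerivAt.mul (hE' x)).deriv
  have i1 : Integrable (fun x => deriv g x * (E x * u x)) :=
    integrable_test_mul (locallyIntegrable_mul hu hE.continuous) hd hc.deriv
  have i2 : Integrable (fun x => g x * (E' x * u x)) :=
    integrable_test_mul (locallyIntegrable_mul hu hE'c) hg.continuous hc
  have i3 : Integrable (fun x => g x * (E x * v x)) :=
    integrable_test_mul (locallyIntegrable_mul hv hE.continuous) hg.continuous hc
  simp only [dd, mul_add, add_mul, mul_assoc] at hgE ⊢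
  rw [integral_add i1 i2] at hgE
  rw [integral_add i3 i2]
  linear_combination hgE

/-- An indefinite integral has its integrand as weak derivative. -/
theorem weakDeriv_primitive {h : ℝ → ℂ} (hh : LocallyIntegrable h) :
    WeakDeriv (fun x => ∫ y in (0 : ℝ)..x, h y) h := by
  intro g hg hc
  have hd : Continuous (deriv g) := hg.continuous_deriv (by norm_num)
  have hdiff : Differentiable ℝ g := hg.differentiable (by norm_num)
  have hii : ∀ a b, IntervalIntegrable h volume a b := fun a b =>
    (hh.integrableOn_isCompact isCompact_uIcc).intervalIntegrable
  obtain ⟨R, hR⟩ := hc.isCompact.isBounded.subset_closedBall (0 : ℝ)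
  have hgz : ∀ x, x ∉ Set.Icc (-R) R → g x = 0 := fun x hx =>
    image_eq_zero_of_notMem_tsupport fun hx' => hx (by
      have := hR hx'; rwa [Real.closedBall_eq_Icc, zero_sub, zero_add] at this)
  have hdz : ∀ x, x ∉ Set.Icc (-R) R → deriv g x = 0 := fun x hx =>
    image_eq_zero_of_notMem_tsupport fun hx' => hx (by
      have := hR (tsupport_deriv_subset hx')
      rwa [Real.closedBall_eq_Icc, zero_sub, zero_add] at this)
  set H : ℝ → ℂ := (Set.Icc (-R) R).indicator h with hH
  have hHi : Integrable H :=
    (integrable_indicator_iff measurableSet_Icc).2 (hh.integrableOn_isCompact isCompact_Icc)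
  have hgd : Integrable (deriv g) := hd.integrable_of_hasCompactSupport hc.deriv
  have hF : Continuous (fun x => ∫ y in (0 : ℝ)..x, h y) :=
    intervalIntegral.continuous_primitive hii 0
  have z0 : ∫ x, deriv g x = 0 :=
    integral_eq_zero_of_hasDerivAt_of_integrable (fun x => (hdiff x).hasDerivAt) hgd
      (hg.continuous.integrable_of_hasCompactSupport hc)
  have tail : ∀ y, ∫ x in Set.Ioi y, deriv g x = -g y := fun y =>
    hc.integral_Ioi_deriv_eq (hg.of_le (by norm_num)) y
  set S : Set (ℝ × ℝ) := {p | p.2 < p.1} with hS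
  have hSm : MeasurableSet S := measurableSet_lt measurable_snd measurable_fst
  have hint : Integrable (S.indicator fun p : ℝ × ℝ => deriv g p.1 * H p.2)
      (volume.prod volume) := (hgd.mul_prod hHi).indicator hSm
  have inner1 : ∀ x, ∫ y, S.indicator (fun p : ℝ × ℝ => deriv g p.1 * H p.2) (x, y)
      = deriv g x * ((∫ y in (0 : ℝ)..x, h y) - ∫ y in (0 : ℝ)..(-R), h y) := by
    intro x
    by_cases hx : x ∈ Set.Icc (-R) R
    · rw [intervalIntegral.integral_interval_sub_left (hii _ _) (hii _ _),
        intervalIntegral.integral_of_le hx.1, integral_Ioc_eq_integral_Ioo, ← integral_const_mul,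
        ← integral_indicator measurableSet_Ioo]
      rw [← integral_congr_ae]
      have : ∀ᵐ y : ℝ, y ≠ -R := by simp [ae_iff]
      filter_upwards [this] with y hy
      by_cases h1 : y < x
      · by_cases h2 : -R < y
        · have h3 : y ∈ Set.Icc (-R) R := ⟨h2.le, h1.le.trans hx.2⟩
          have h4 : y ∈ Set.Ioo (-R) x := ⟨h2, h1⟩
          simp [hS, hH, h1, h3, h4]
        · have h3 : y ∉ Set.Icc (-R) R := fun h3 => h2 (lt_of_le_of_ne h3.1 hy.symm)
          have h4 : y ∉ Set.Ioo (-R) x := fun h4 => h2 h4.1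
          simp [hS, hH, h1, h3, h4]
      · have h4 : y ∉ Set.Ioo (-R) x := fun h4 => h1 h4.2
        simp [hS, h1, h4]
    · simp [Set.indicator, hdz x hx]
  have inner2 : ∀ y, ∫ x, S.indicator (fun p : ℝ × ℝ => deriv g p.1 * H p.2) (x, y)
      = -(g y * h y) := by
    intro y
    have : ∀ x, S.indicator (fun p : ℝ × ℝ => deriv g p.1 * H p.2) (x, y)
        = (Set.Ioi y).indicator (fun x => deriv g x) x * H y := by
      intro x
      by_cases h1 : y < x <;> simp [hS, h1]
    simp only [this]
    rw [integral_mul_const, integral_indicator measurableSet_Ioi, tail]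
    by_cases hy : y ∈ Set.Icc (-R) R
    · simp [hH, hy]
    · simp [hgz y hy]
  have i1 := integrable_test_mul hF.locallyIntegrable hd hc.deriv
  calc ∫ x, deriv g x * ∫ y in (0 : ℝ)..x, h y
      = ∫ x, deriv g x * ((∫ y in (0 : ℝ)..x, h y) - ∫ y in (0 : ℝ)..(-R), h y) := by
        simp only [mul_sub]
        rw [integral_sub i1 (hgd.mul_const _), integral_mul_const, z0]
        ring
    _ = ∫ x, ∫ y, S.indicator (fun p : ℝ × ℝ => deriv g p.1 * H p.2) (x, y) := by
        simp only [inner1]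
    _ = ∫ y, ∫ x, S.indicator (fun p : ℝ × ℝ => deriv g p.1 * H p.2) (x, y) :=
        integral_integral_swap (f := fun x y =>
          S.indicator (fun p : ℝ × ℝ => deriv g p.1 * H p.2) (x, y)) hint
    _ = -∫ x, g x * h x := by simp only [inner2, integral_neg]

theorem weakDeriv_const (C : ℂ) : WeakDeriv (fun _ => C) (fun _ => 0) := by
  intro g hg hc
  rw [integral_mul_const, integral_eq_zero_of_hasDerivAt_of_integrable
    (fun x => (hg.differentiable (by norm_num) x).hasDerivAt)
    ((hg.continuous_deriv (by norm_num)).integrable_of_hasCompactSupport hc.deriv)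
    (hg.continuous.integrable_of_hasCompactSupport hc)]
  simp

/-- A smooth function of compact support and vanishing integral is the derivative of one. -/
theorem exists_compactSupport_primitive {h : ℝ → ℝ} (hh : ContDiff ℝ ∞ h)
    (hc : HasCompactSupport h) (h0 : ∫ x, h x = 0) :
    ∃ z : ℝ → ℝ, ContDiff ℝ ∞ z ∧ HasCompactSupport z ∧ deriv z = h := by
  obtain ⟨R, hR⟩ := hc.isCompact.isBounded.subset_closedBall (0 : ℝ)
  have hz : ∀ x, x ∉ Set.Icc (-R) R → h x = 0 := fun x hx =>
    image_eq_zero_of_notMem_tsupport fun hx' => hx (by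
      have := hR hx'; rwa [Real.closedBall_eq_Icc, zero_sub, zero_add] at this)
  have hder : ∀ x, HasDerivAt (fun x => ∫ y in (-R)..x, h y) (h x) x := fun x =>
    intervalIntegral.integral_hasDerivAt_right (hh.continuous.intervalIntegrable _ _)
      (hh.continuous.stronglyMeasurableAtFilter _ _) hh.continuous.continuousAt
  have hd : deriv (fun x => ∫ y in (-R)..x, h y) = h := funext fun x => (hder x).deriv
  refine ⟨_, ?_, ?_, hd⟩
  · rw [contDiff_infty_iff_deriv, hd]
    exact ⟨fun x => (hder x).differentiableAt, hh⟩
  · refine HasCompactSupport.intro (isCompact_Icc (a := -R) (b := R)) fun x hx => ?_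
    have hi : ∀ a b, IntervalIntegrable h volume a b := fun a b =>
      hh.continuous.intervalIntegrable a b
    rcases lt_or_ge x (-R) with h1 | h1
    · rw [intervalIntegral.integral_symm, intervalIntegral.integral_of_le h1.le,
        integral_Ioc_eq_integral_Ioo, setIntegral_eq_zero_of_forall_eq_zero, neg_zero]
      exact fun y hy => hz y fun hy' => absurd hy'.1 (not_le.2 hy.2)
    · rw [intervalIntegral.integral_of_le h1, setIntegral_eq_integral_of_ae_compl_eq_zero, h0]
      have : ∀ᵐ y : ℝ, y ≠ -R := by simp [ae_iff]
      filter_upwards [this] with y hy hy'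
      refine hz y fun hy2 => hy' ⟨lt_of_le_of_ne hy2.1 hy.symm, ?_⟩
      by_contra hlt
      exact hx ⟨h1, (not_le.1 hlt).le.trans hy2.2⟩

/-- The lemma of du Bois-Reymond: a function whose weak derivative vanishes is constant. -/
theorem WeakDeriv.ae_const {u : ℝ → ℂ} (hu : LocallyIntegrable u)
    (h : WeakDeriv u fun _ => 0) : ∃ C : ℂ, u =ᵐ[volume] fun _ => C := by
  let χ : ContDiffBump (0 : ℝ) := ⟨1, 2, one_pos, one_lt_two⟩
  set k : ℝ → ℝ := χ.normed volume with hk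
  have hk1 : ContDiff ℝ ∞ k := χ.contDiff_normed
  have hkc : HasCompactSupport k := χ.hasCompactSupport_normed
  have hki : ∫ x, k x = 1 := χ.integral_normed
  have hui : ∀ {g : ℝ → ℝ}, Continuous g → HasCompactSupport g →
      Integrable fun x => g x • u x := fun hg hc =>
    hu.integrable_smul_left_of_hasCompactSupport hg hc
  refine ⟨∫ x, k x • u x, ae_eq_of_integral_contDiff_smul_eq hu
    (locallyIntegrable_const _) fun g hg hc => ?_⟩
  have hgi : Integrable g := hg.continuous.integrable_of_hasCompactSupport hc
  have hki' : Integrable k := hk1.continuous.integrable_of_hasCompactSupport hkc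
  -- Subtracting the right multiple of the bump function makes the integral of `g` vanish.
  obtain ⟨z, hz, hzc, hzd⟩ := exists_compactSupport_primitive
    (h := fun x => g x - (∫ y, g y) * k x) (hg.sub (contDiff_const.mul hk1))
    (hc.sub hkc.mul_left) (by
      rw [integral_sub hgi (hki'.const_mul _), integral_const_mul, hki]; ring)
  have hz' := h (fun x => (z x : ℂ)) (Complex.ofRealCLM.contDiff.comp hz)
    (hzc.comp_left (g := Complex.ofReal) rfl)
  have d : ∀ x, deriv (fun x => (z x : ℂ)) x = ((g x - (∫ y, g y) * k x : ℝ) : ℂ) := fun x => by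
    have := ((hz.differentiable (by norm_num) x).hasDerivAt.ofReal_comp).deriv
    rw [hzd] at this; exact this
  have e : ∀ x, deriv (fun x => (z x : ℂ)) x * u x
      = g x • u x - (∫ y, g y) • (k x • u x) := fun x => by
    rw [d]; simp only [Complex.real_smul]; push_cast; ring
  simp only [e, mul_zero, integral_zero, neg_zero] at hz'
  have j : Integrable fun x => (∫ y, g y) • (k x • u x) := by
    simpa only [Pi.smul_def] using (hui hk1.continuous hkc).smul (∫ y, g y)
  rw [integral_sub (hui hg.continuous hc) j, integral_smul, sub_eq_zero] at hz'
  rw [hz', integral_smul_const]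

/-- Integration by parts against a smooth function without compact support, by cutting off. -/
theorem WeakDeriv.integral_eq {u v w w' : ℝ → ℂ} (h : WeakDeriv u v) (hw : ContDiff ℝ ∞ w)
    (hw' : ∀ x, HasDerivAt w (w' x) x) (i1 : Integrable fun x => w x * u x)
    (i2 : Integrable fun x => w' x * u x) (i3 : Integrable fun x => w x * v x) :
    ∫ x, w' x * u x = -∫ x, w x * v x := by
  let χ : ContDiffBump (0 : ℝ) := ⟨1, 2, one_pos, one_lt_two⟩
  have hχ : ContDiff ℝ ∞ (χ : ℝ → ℝ) := χ.contDiff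
  have hχd : Continuous (deriv (χ : ℝ → ℝ)) := hχ.continuous_deriv (by norm_num)
  obtain ⟨M, hM⟩ := (χ.hasCompactSupport.deriv).exists_bound_of_continuous hχd
  let e : ℕ → ℝ := fun n => 1 / ((n : ℝ) + 1)
  have he : Tendsto e atTop (𝓝 0) := tendsto_one_div_add_atTop_nhds_zero_nat
  have he0 : ∀ n, 0 < e n := fun n => by positivity
  have he1 : ∀ n, e n ≤ 1 := fun n => by
    simp only [e]; rw [div_le_one (by positivity)]; linarith [(Nat.cast_nonneg n : (0 : ℝ) ≤ n)]
  have hχ1 : ∀ x, Tendsto (fun n => χ (e n * x)) atTop (𝓝 1) := fun x => by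
    have h1 : Tendsto (fun n => χ (e n * x)) atTop (𝓝 (χ (0 * x))) :=
      (hχ.continuous.tendsto _).comp (he.mul_const x)
    rwa [zero_mul, χ.one_of_mem_closedBall (by simp [χ])] at h1
  have hχb : ∀ y, ‖((χ y : ℝ) : ℂ)‖ ≤ 1 := fun y => by
    rw [Complex.norm_real, Real.norm_of_nonneg χ.nonneg]; exact χ.le_one
  have dd : ∀ n x, HasDerivAt (fun x => ((χ (e n * x) : ℝ) : ℂ) * w x)
      (((deriv χ (e n * x) * e n : ℝ) : ℂ) * w x + ((χ (e n * x) : ℝ) : ℂ) * w' x) x := by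
    intro n x
    have h1 : HasDerivAt (fun x => χ (e n * x)) (deriv χ (e n * x) * e n) x := by
      have := ((hχ.differentiable (by norm_num)) (e n * x)).hasDerivAt.comp x
        ((hasDerivAt_id x).const_mul (e n))
      simpa [Function.comp_def] using this
    exact h1.ofReal_comp.mul (hw' x)
  have cs : ∀ n, HasCompactSupport (fun x => ((χ (e n * x) : ℝ) : ℂ) * w x) := fun n => by
    have h1 : HasCompactSupport (fun x => χ (e n * x)) :=
      χ.hasCompactSupport.comp_homeomorph (Homeomorph.mulLeft₀ (e n) (he0 n).ne')
    exact (h1.comp_left (g := Complex.ofReal) rfl).mul_right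
  have sm : ∀ n, ContDiff ℝ ∞ (fun x => ((χ (e n * x) : ℝ) : ℂ)) := fun n =>
    Complex.ofRealCLM.contDiff.comp (hχ.comp (contDiff_const.mul contDiff_id))
  have key : ∀ n, ∫ x, (((deriv χ (e n * x) * e n : ℝ) : ℂ) * (w x * u x)
      + ((χ (e n * x) : ℝ) : ℂ) * (w' x * u x)) = -∫ x, ((χ (e n * x) : ℝ) : ℂ) * (w x * v x) := by
    intro n
    have := h _ ((sm n).mul hw) (cs n)
    simp only [fun x => (dd n x).deriv, add_mul, mul_assoc] at this
    exact this
  have t1 : Tendsto (fun n => ∫ x, (((deriv χ (e n * x) * e n : ℝ) : ℂ) * (w x * u x)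
      + ((χ (e n * x) : ℝ) : ℂ) * (w' x * u x))) atTop (𝓝 (∫ x, w' x * u x)) := by
    refine tendsto_integral_of_dominated_convergence
      (fun x => M * ‖w x * u x‖ + ‖w' x * u x‖) (fun n => ?_)
      ((i1.norm.const_mul M).add i2.norm) (fun n => .of_forall fun x => ?_)
      (.of_forall fun x => ?_)
    · refine (Continuous.aestronglyMeasurable ?_).mul i1.aestronglyMeasurable |>.add
        ((sm n).continuous.aestronglyMeasurable.mul i2.aestronglyMeasurable)
      fun_prop
    · refine (norm_add_le _ _).trans (add_le_add ?_ ?_)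
      · rw [norm_mul, Complex.norm_real, norm_mul, Real.norm_of_nonneg (he0 n).le]
        gcongr
        exact mul_le_of_le_one_right (norm_nonneg _) (he1 n) |>.trans (hM _)
      · rw [norm_mul]; exact mul_le_of_le_one_left (norm_nonneg _) (hχb _)
    · have a1 : Tendsto (fun n => deriv χ (e n * x) * e n) atTop (𝓝 (deriv χ (0 * x) * 0)) :=
        ((hχd.tendsto _).comp (he.mul_const x)).mul he
      have a2 := (Complex.continuous_ofReal.tendsto _).comp a1
      have a3 := (Complex.continuous_ofReal.tendsto _).comp (hχ1 x)
      have := (a2.mul_const (w x * u x)).add (a3.mul_const (w' x * u x))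
      simpa using this
  have t2 : Tendsto (fun n => -∫ x, ((χ (e n * x) : ℝ) : ℂ) * (w x * v x)) atTop
      (𝓝 (-∫ x, w x * v x)) := by
    refine (tendsto_integral_of_dominated_convergence (fun x => ‖w x * v x‖) (fun n => ?_)
      i3.norm (fun n => .of_forall fun x => ?_) (.of_forall fun x => ?_)).neg
    · exact (sm n).continuous.aestronglyMeasurable.mul i3.aestronglyMeasurable
    · rw [norm_mul]; exact mul_le_of_le_one_left (norm_nonneg _) (hχb _)
    · have a3 := (Complex.continuous_ofReal.tendsto _).comp (hχ1 x)
      simpa using a3.mul_const (w x * v x)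
  simp only [key] at t1
  exact tendsto_nhds_unique t1 t2

/-! ### The Schur test and a Gaussian kernel -/

/-- Schur's test: an integral operator whose nonnegative kernel has row and column integrals at
most `C` is bounded by `C` on `L²`. -/
theorem lintegral_sq_lintegral_kernel_le {K : ℝ → ℝ → ℝ≥0∞} (hK : Measurable (Function.uncurry K))
    {C : ℝ≥0∞} (h1 : ∀ x, ∫⁻ y, K x y ≤ C) (h2 : ∀ y, ∫⁻ x, K x y ≤ C) {F : ℝ → ℝ≥0∞}
    (hF : Measurable F) :
    ∫⁻ x, (∫⁻ y, K x y * F y) ^ (2 : ℝ) ≤ C * (C * ∫⁻ y, F y ^ (2 : ℝ)) := by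
  have hKx : ∀ x, Measurable (K x) := fun x => hK.of_uncurry_left
  have cs : ∀ x, (∫⁻ y, K x y * F y) ^ (2 : ℝ) ≤ C * ∫⁻ y, K x y * F y ^ (2 : ℝ) := by
    intro x
    have hh := ENNReal.lintegral_mul_le_Lp_mul_Lq volume Real.HolderConjugate.two_two
      (f := fun y => K x y ^ (1 / 2 : ℝ)) (g := fun y => K x y ^ (1 / 2 : ℝ) * F y)
      ((hKx x).pow_const _).aemeasurable (((hKx x).pow_const _).mul hF).aemeasurable
    have e1 : ∀ y, K x y ^ (1 / 2 : ℝ) * (K x y ^ (1 / 2 : ℝ) * F y) = K x y * F y := fun y => by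
      rw [← mul_assoc, ← ENNReal.rpow_add_of_nonneg _ _ (by norm_num) (by norm_num)]
      norm_num
    have e2 : ∀ y, (K x y ^ (1 / 2 : ℝ)) ^ (2 : ℝ) = K x y := fun y => by
      rw [← ENNReal.rpow_mul]; norm_num
    simp only [Pi.mul_apply, e1, ENNReal.mul_rpow_of_nonneg _ _ zero_le_two, e2] at hh
    calc (∫⁻ y, K x y * F y) ^ (2 : ℝ)
        ≤ ((∫⁻ y, K x y) ^ (1 / 2 : ℝ) * (∫⁻ y, K x y * F y ^ (2 : ℝ)) ^ (1 / 2 : ℝ)) ^ (2 : ℝ) :=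
          ENNReal.rpow_le_rpow hh zero_le_two
      _ = (∫⁻ y, K x y) * ∫⁻ y, K x y * F y ^ (2 : ℝ) := by
          rw [ENNReal.mul_rpow_of_nonneg _ _ zero_le_two, ← ENNReal.rpow_mul, ← ENNReal.rpow_mul]
          norm_num
      _ ≤ _ := by gcongr; exact h1 x
  have hm : Measurable (Function.uncurry fun x y => K x y * F y ^ (2 : ℝ)) :=
    hK.mul ((hF.comp measurable_snd).pow_const _)
  calc ∫⁻ x, (∫⁻ y, K x y * F y) ^ (2 : ℝ)
      ≤ ∫⁻ x, C * ∫⁻ y, K x y * F y ^ (2 : ℝ) := lintegral_mono cs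
    _ = C * ∫⁻ x, ∫⁻ y, K x y * F y ^ (2 : ℝ) := lintegral_const_mul _ hm.lintegral_prod_right'
    _ = C * ∫⁻ y, ∫⁻ x, K x y * F y ^ (2 : ℝ) := by rw [lintegral_lintegral_swap hm.aemeasurable]
    _ ≤ C * ∫⁻ y, C * F y ^ (2 : ℝ) := by
        gcongr with y
        rw [lintegral_mul_const _ hK.of_uncurry_right]
        gcongr; exact h2 y
    _ = _ := by rw [lintegral_const_mul _ (hF.pow_const _)]

theorem memLp_of_kernel_bound {K : ℝ → ℝ → ℝ≥0∞} (hK : Measurable (Function.uncurry K))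
    {C : ℝ≥0∞} (hC : C ≠ ⊤) (h1 : ∀ x, ∫⁻ y, K x y ≤ C) (h2 : ∀ y, ∫⁻ x, K x y ≤ C) (f : L2)
    {U : ℝ → ℂ} (hU : AEStronglyMeasurable U) (hb : ∀ x, ‖U x‖ₑ ≤ ∫⁻ y, K x y * ‖f y‖ₑ) :
    MemLp U 2 := by
  refine ⟨hU, ?_⟩
  have hf := (Lp.memLp f).2
  rw [eLpNorm_lt_top_iff_lintegral_rpow_enorm_lt_top two_ne_zero ENNReal.ofNat_ne_top] at hf ⊢
  simp only [ENNReal.toReal_ofNat] at hf ⊢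
  refine (lintegral_mono fun x => ENNReal.rpow_le_rpow (hb x) zero_le_two).trans_lt ?_
  refine (lintegral_sq_lintegral_kernel_le hK h1 h2 (Lp.stronglyMeasurable f).measurable.enorm).trans_lt ?_
  exact ENNReal.mul_lt_top hC.lt_top (ENNReal.mul_lt_top hC.lt_top hf)

theorem lintegral_comp_abs_le {f : ℝ → ℝ≥0∞} :
    ∫⁻ x, f |x| ≤ 2 * ∫⁻ x in Set.Ici 0, f x := by
  have e1 : ∫⁻ x in Set.Ici 0, f |x| = ∫⁻ x in Set.Ici 0, f x :=
    setLIntegral_congr_fun measurableSet_Ici fun x hx => by rw [abs_of_nonneg hx]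
  have e2 : ∫⁻ x in Set.Iic 0, f |x| = ∫⁻ x in Set.Ici 0, f |x| := by
    have := (Measure.measurePreserving_neg (volume : Measure ℝ)).setLIntegral_comp_preimage_emb
      (Homeomorph.neg ℝ).measurableEmbedding (fun x => f |x|) (Set.Ici 0)
    simpa using this
  calc ∫⁻ x, f |x| = ∫⁻ x in Set.Iic 0 ∪ Set.Ici 0, f |x| := by
        rw [Set.Iic_union_Ici, setLIntegral_univ]
    _ ≤ (∫⁻ x in Set.Iic 0, f |x|) + ∫⁻ x in Set.Ici 0, f |x| := lintegral_union_le _ _ _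
    _ = _ := by rw [e2, e1, two_mul]

/-- The kernel `|x| exp (-c (x² - y²) / 2)` restricted to `|y| ≤ |x|`. -/
noncomputable def gaussKernel (c x y : ℝ) : ℝ≥0∞ :=
  if |y| ≤ |x| then ENNReal.ofReal (|x| * Real.exp (-c * (x ^ 2 - y ^ 2) / 2)) else 0

theorem measurable_gaussKernel (c : ℝ) : Measurable (Function.uncurry (gaussKernel c)) := by
  refine Measurable.ite (measurableSet_le (by fun_prop) (by fun_prop)) ?_ measurable_const
  fun_prop

theorem lintegral_gaussKernel_right {c : ℝ} (hc : 0 < c) (y : ℝ) :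
    ∫⁻ x, gaussKernel c x y ≤ ENNReal.ofReal (4 / c) := by
  set t := |y| with ht
  have ht0 : 0 ≤ t := abs_nonneg y
  have e : ∀ x, gaussKernel c x y = (fun s => if t ≤ s then
      ENNReal.ofReal (s * Real.exp (-c * (s ^ 2 - t ^ 2) / 2)) else 0) |x| := fun x => by
    simp only [gaussKernel, sq_abs, ht]
  simp only [e]
  refine (lintegral_comp_abs_le (f := fun s => if t ≤ s then
    ENNReal.ofReal (s * Real.exp (-c * (s ^ 2 - t ^ 2) / 2)) else 0)).trans ?_
  have hd : ∀ x ∈ Set.Ici t, HasDerivAt (fun x => -(1 / c) * Real.exp (-c * (x ^ 2 - t ^ 2) / 2))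
      (x * Real.exp (-c * (x ^ 2 - t ^ 2) / 2)) x := fun x _ => by
    have h := ((((hasDerivAt_pow 2 x).sub_const (t ^ 2)).const_mul (-c)).div_const 2).exp.const_mul
      (-(1 / c))
    refine h.congr_deriv ?_
    simp only [Nat.cast_ofNat, Nat.add_one_sub_one, pow_one]
    field_simp
  have hpos : ∀ x ∈ Set.Ioi t, 0 ≤ x * Real.exp (-c * (x ^ 2 - t ^ 2) / 2) := fun x hx =>
    mul_nonneg (ht0.trans (le_of_lt hx)) (Real.exp_pos _).le
  have hl : Tendsto (fun x => -(1 / c) * Real.exp (-c * (x ^ 2 - t ^ 2) / 2)) atTop (𝓝 0) := by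
    rw [← mul_zero (-(1 / c))]
    refine (Real.tendsto_exp_atBot.comp ?_).const_mul _
    have h1 : Tendsto (fun x : ℝ => x ^ 2 - t ^ 2) atTop atTop :=
      tendsto_atTop_add_const_right _ _ (tendsto_pow_atTop two_ne_zero)
    have h2 := h1.const_mul_atTop_of_neg (r := -(c / 2)) (by linarith)
    refine h2.congr fun x => by ring
  have i1 := integrableOn_Ioi_deriv_of_nonneg' hd hpos hl
  have i2 := integral_Ioi_of_hasDerivAt_of_nonneg' hd hpos hl
  have : ∫⁻ x in Set.Ici 0, (if t ≤ x then
      ENNReal.ofReal (x * Real.exp (-c * (x ^ 2 - t ^ 2) / 2)) else 0)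
      ≤ ∫⁻ x in Set.Ioi t, ENNReal.ofReal (x * Real.exp (-c * (x ^ 2 - t ^ 2) / 2)) := by
    rw [setLIntegral_congr Ioi_ae_eq_Ici, ← lintegral_indicator measurableSet_Ici,
      ← lintegral_indicator measurableSet_Ici]
    refine lintegral_mono fun x => ?_
    by_cases h1 : t ≤ x
    · simp [h1, ht0.trans h1]
    · simp [Set.indicator, h1]
  refine (mul_le_mul_right this 2).trans ?_
  rw [← ofReal_integral_eq_lintegral_ofReal i1 (ae_restrict_of_forall_mem measurableSet_Ioi hpos), i2,
    ← ENNReal.ofReal_ofNat 2, ← ENNReal.ofReal_mul zero_le_two]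
  apply ENNReal.ofReal_le_ofReal
  simp
  field_simp
  norm_num

theorem lintegral_gaussKernel_left {c : ℝ} (hc : 0 < c) (x : ℝ) :
    ∫⁻ y, gaussKernel c x y ≤ ENNReal.ofReal (4 / c) := by
  set t := |x| with ht
  have ht0 : 0 ≤ t := abs_nonneg x
  have e : ∀ y, gaussKernel c x y = (fun s => if s ≤ t then
      ENNReal.ofReal (t * Real.exp (-c * (t ^ 2 - s ^ 2) / 2)) else 0) |y| := fun y => by
    simp only [gaussKernel, sq_abs, ht]
  simp only [e]
  refine (lintegral_comp_abs_le (f := fun s => if s ≤ t then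
    ENNReal.ofReal (t * Real.exp (-c * (t ^ 2 - s ^ 2) / 2)) else 0)).trans ?_
  have hd : ∀ y, HasDerivAt (fun y => 2 / c * Real.exp (-c * t * (t - y) / 2))
      (t * Real.exp (-c * t * (t - y) / 2)) y := fun y => by
    have h := ((((hasDerivAt_id y).const_sub t).const_mul (-c * t)).div_const 2).exp.const_mul
      (2 / c)
    refine h.congr_deriv ?_
    field_simp
    simp
  have hcont : Continuous fun y => t * Real.exp (-c * t * (t - y) / 2) := by fun_prop
  have i1 : IntegrableOn (fun y => t * Real.exp (-c * t * (t - y) / 2)) (Set.Ioc 0 t) :=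
    (hcont.integrableOn_Icc).mono_set Set.Ioc_subset_Icc_self
  have i2 := intervalIntegral.integral_eq_sub_of_hasDerivAt (a := 0) (b := t)
    (fun y _ => hd y) (hcont.intervalIntegrable _ _)
  rw [intervalIntegral.integral_of_le ht0] at i2
  have : ∫⁻ y in Set.Ici 0, (if y ≤ t then
      ENNReal.ofReal (t * Real.exp (-c * (t ^ 2 - y ^ 2) / 2)) else 0)
      ≤ ∫⁻ y in Set.Ioc 0 t, ENNReal.ofReal (t * Real.exp (-c * t * (t - y) / 2)) := by
    rw [setLIntegral_congr Ioc_ae_eq_Icc, ← lintegral_indicator measurableSet_Ici,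
      ← lintegral_indicator measurableSet_Icc]
    refine lintegral_mono fun y => ?_
    by_cases h0 : 0 ≤ y
    · by_cases h1 : y ≤ t
      · simp only [Set.indicator, Set.mem_Ici, h0, h1, if_true, Set.mem_Icc, and_self]
        apply ENNReal.ofReal_le_ofReal
        refine mul_le_mul_of_nonneg_left (Real.exp_le_exp.2 ?_) ht0
        -- `t ^ 2 - y ^ 2 = (t - y) * (t + y) ≥ t * (t - y)`
        nlinarith [mul_nonneg hc.le (mul_nonneg h0 (sub_nonneg.2 h1))]
      · simp [Set.indicator, h1]
    · simp [Set.indicator, h0]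
  refine (mul_le_mul_right this 2).trans ?_
  rw [← ofReal_integral_eq_lintegral_ofReal i1
    (.of_forall fun y => mul_nonneg ht0 (Real.exp_pos _).le), i2,
    ← ENNReal.ofReal_ofNat 2, ← ENNReal.ofReal_mul zero_le_two]
  apply ENNReal.ofReal_le_ofReal
  have : 0 ≤ 2 / c * Real.exp (-c * t * (t - 0) / 2) := by positivity
  have h4 : 4 / c = 2 * (2 / c) := by ring
  rw [h4]
  gcongr
  simp only [sub_self, mul_zero, zero_div, Real.exp_zero, mul_one]
  linarith

/-! ### The first-order equation `u' + κ x u = f` -/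

/-- The complex Gaussian `exp (-κ x² / 2)`, which solves `u' + κ x u = 0`. -/
noncomputable def cgauss (κ : ℂ) (x : ℝ) : ℂ := Complex.exp (-κ * x ^ 2 / 2)

theorem cgauss_mul_neg (κ : ℂ) (x : ℝ) : cgauss κ x * cgauss (-κ) x = 1 := by
  rw [cgauss, cgauss, ← Complex.exp_add]
  simp only [neg_neg]
  rw [← add_div, neg_mul, neg_add_cancel, zero_div, Complex.exp_zero]

theorem norm_cgauss (κ : ℂ) (x : ℝ) : ‖cgauss κ x‖ = Real.exp (-κ.re * x ^ 2 / 2) := by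
  have h : -κ * (x : ℂ) ^ 2 / 2 = -κ * ((x ^ 2 / 2 : ℝ) : ℂ) := by push_cast; ring
  rw [cgauss, Complex.norm_exp, h, Complex.re_mul_ofReal, Complex.neg_re]
  ring_nf

theorem hasDerivAt_cgauss (κ : ℂ) (x : ℝ) : HasDerivAt (cgauss κ) (-(κ * x) * cgauss κ x) x := by
  have h : HasDerivAt (fun x : ℝ => -κ * (x : ℂ) ^ 2 / 2) (-(κ * x)) x := by
    have h1 : HasDerivAt (fun x : ℝ => (x : ℂ)) 1 x := (hasDerivAt_id x).ofReal_comp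
    refine (((h1.pow 2).const_mul (-κ)).div_const 2).congr_deriv ?_
    simp only [Nat.cast_ofNat, Nat.add_one_sub_one, pow_one]
    ring
  refine h.cexp.congr_deriv ?_
  rw [cgauss]; ring

theorem contDiff_cgauss (κ : ℂ) : ContDiff ℝ ∞ (cgauss κ) := by
  have : ContDiff ℝ ∞ fun x : ℝ => (x : ℂ) := Complex.ofRealCLM.contDiff
  exact ((contDiff_const.mul (this.pow 2)).div_const 2).cexp

theorem continuous_cgauss (κ : ℂ) : Continuous (cgauss κ) := (contDiff_cgauss κ).continuous

theorem memLp_cgauss {κ : ℂ} (hκ : 0 < κ.re) : MemLp (cgauss κ) 2 := by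
  rw [memLp_two_iff_integrable_sq_norm (continuous_cgauss κ).aestronglyMeasurable]
  refine (integrable_exp_neg_mul_sq hκ).congr (.of_forall fun x => ?_)
  simp only
  rw [norm_cgauss, ← Real.exp_nat_mul]
  congr 1
  push_cast; ring

theorem not_memLp_cgauss {κ : ℂ} (hκ : κ.re < 0) {c : ℂ} (h : MemLp (fun x => c * cgauss κ x) 2) :
    c = 0 := by
  by_contra hc
  have h1 : MemLp (fun _ : ℝ => c) 2 := by
    refine h.of_le aestronglyMeasurable_const (.of_forall fun x => ?_)
    rw [norm_mul, norm_cgauss]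
    refine le_mul_of_one_le_right (norm_nonneg _) (Real.one_le_exp ?_)
    have := mul_nonneg (neg_pos.2 hκ).le (sq_nonneg x)
    linarith
  rw [memLp_const_iff two_ne_zero ENNReal.ofNat_ne_top] at h1
  simp [hc] at h1

theorem memLp_of_memLp_mul_self {u : ℝ → ℂ} (hu : Continuous u)
    (hx : MemLp (fun x : ℝ => (x : ℂ) * u x) 2) : MemLp u 2 := by
  obtain ⟨M, hM⟩ := isCompact_Icc.exists_bound_of_continuousOn (s := Set.Icc (-1 : ℝ) 1)
    hu.continuousOn
  have h1 : MemLp ((Set.Icc (-1 : ℝ) 1).indicator fun _ => M) 2 :=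
    memLp_indicator_const 2 measurableSet_Icc M (Or.inr measure_Icc_lt_top.ne)
  refine (h1.norm.add hx.norm).of_le hu.aestronglyMeasurable (.of_forall fun x => ?_)
  simp only [Pi.add_apply]
  rw [Real.norm_of_nonneg (add_nonneg (norm_nonneg _) (norm_nonneg _))]
  by_cases h : x ∈ Set.Icc (-1 : ℝ) 1
  · rw [Set.indicator_of_mem h]
    exact ((hM x h).trans (le_abs_self _)).trans (le_add_of_nonneg_right (norm_nonneg _))
  · refine le_add_of_nonneg_of_le (norm_nonneg _) ?_
    rw [norm_mul, Complex.norm_real]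
    refine le_mul_of_one_le_left (norm_nonneg _) ?_
    rw [Real.norm_eq_abs]
    by_contra hlt
    exact h (abs_le.1 (not_le.1 hlt).le)

theorem locallyIntegrable_cgauss_mul (κ : ℂ) (f : L2) :
    LocallyIntegrable fun x => cgauss κ x * f x :=
  locallyIntegrable_mul (locallyIntegrable_coe f) (continuous_cgauss κ)

/-- Variation of constants for the equation `u' + κ x u = f`. -/
theorem weakDeriv_variation_of_constants (κ : ℂ) (f : L2) {G : ℝ → ℂ} (C : ℂ)
    (hG : ∀ x, G x = C + ∫ y in (0 : ℝ)..x, cgauss (-κ) y * f y) :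
    WeakDeriv (fun x => cgauss κ x * G x) (fun x => f x - κ * x * (cgauss κ x * G x)) := by
  have hl := locallyIntegrable_cgauss_mul (-κ) f
  have hp := weakDeriv_primitive hl
  have hcont : Continuous fun x => ∫ y in (0 : ℝ)..x, cgauss (-κ) y * f y :=
    intervalIntegral.continuous_primitive
      (fun a b => (hl.integrableOn_isCompact isCompact_uIcc).intervalIntegrable) 0
  have h := (hp.sub (weakDeriv_const (-C)) hcont.locallyIntegrable hl
    (locallyIntegrable_const _) (locallyIntegrable_const _)).smooth_mul
    ((hcont.sub continuous_const).locallyIntegrable) (hl.sub (locallyIntegrable_const _))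
    (contDiff_cgauss κ) (hasDerivAt_cgauss κ)
  refine h.congr (.of_forall fun x => ?_) (.of_forall fun x => ?_)
  · simp only [hG]; ring
  · simp only [hG, sub_zero]
    rw [← mul_assoc, cgauss_mul_neg]; ring

theorem continuous_variation_of_constants (κ : ℂ) (f : L2) {G : ℝ → ℂ} (C : ℂ)
    (hG : ∀ x, G x = C + ∫ y in (0 : ℝ)..x, cgauss (-κ) y * f y) :
    Continuous fun x => cgauss κ x * G x := by
  have hl := locallyIntegrable_cgauss_mul (-κ) f
  have hcont : Continuous fun x => ∫ y in (0 : ℝ)..x, cgauss (-κ) y * f y :=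
    intervalIntegral.continuous_primitive
      (fun a b => (hl.integrableOn_isCompact isCompact_uIcc).intervalIntegrable) 0
  have : G = fun x => C + ∫ y in (0 : ℝ)..x, cgauss (-κ) y * f y := funext hG
  rw [this]
  exact (continuous_cgauss κ).mul (continuous_const.add hcont)

theorem enorm_mul_cgauss_mul (κ : ℂ) (x y : ℝ) :
    ‖(x : ℂ)‖ₑ * (‖cgauss κ x‖ₑ * ‖cgauss (-κ) y‖ₑ)
      = ENNReal.ofReal (|x| * Real.exp (-κ.re * (x ^ 2 - y ^ 2) / 2)) := by
  rw [← enorm_mul, ← enorm_mul, ← ofReal_norm, norm_mul, norm_mul, norm_cgauss,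
    norm_cgauss, Complex.norm_real, Real.norm_eq_abs, ← Real.exp_add, Complex.neg_re]
  congr 3
  ring

theorem enorm_setIntegral_kernel_le (κ : ℂ) (f : L2) (x : ℝ) {s : Set ℝ} (hs : MeasurableSet s) :
    ‖(x : ℂ) * (cgauss κ x * ∫ y in s, cgauss (-κ) y * f y)‖ₑ
      ≤ ∫⁻ y, s.indicator (fun y =>
        ENNReal.ofReal (|x| * Real.exp (-κ.re * (x ^ 2 - y ^ 2) / 2))) y * ‖f y‖ₑ := by
  have hm : AEMeasurable (fun y => ‖cgauss (-κ) y * f y‖ₑ) (volume.restrict s) :=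
    ((continuous_cgauss (-κ)).measurable.mul (Lp.stronglyMeasurable f).measurable).enorm.aemeasurable
  calc ‖(x : ℂ) * (cgauss κ x * ∫ y in s, cgauss (-κ) y * f y)‖ₑ
      = (‖(x : ℂ)‖ₑ * ‖cgauss κ x‖ₑ) * ‖∫ y in s, cgauss (-κ) y * f y‖ₑ := by
        rw [enorm_mul, enorm_mul, mul_assoc]
    _ ≤ (‖(x : ℂ)‖ₑ * ‖cgauss κ x‖ₑ) * ∫⁻ y in s, ‖cgauss (-κ) y * f y‖ₑ := by
        gcongr; exact enorm_integral_le_lintegral_enorm _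
    _ = ∫⁻ y in s, (‖(x : ℂ)‖ₑ * ‖cgauss κ x‖ₑ) * ‖cgauss (-κ) y * f y‖ₑ :=
        (lintegral_const_mul'' _ hm).symm
    _ = ∫⁻ y in s, ENNReal.ofReal (|x| * Real.exp (-κ.re * (x ^ 2 - y ^ 2) / 2)) * ‖f y‖ₑ := by
        refine lintegral_congr fun y => ?_
        rw [← enorm_mul_cgauss_mul, enorm_mul]; ring
    _ = _ := by
        rw [← lintegral_indicator hs]
        refine lintegral_congr fun y => ?_
        by_cases h : y ∈ s <;> simp [h]

/-- For `0 < re κ` the equation `u' + κ x u = f` has a solution vanishing at the origin, and it is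
as regular as the domain of the Dirac operator demands. -/
theorem exists_solution_of_re_pos {κ : ℂ} (hκ : 0 < κ.re) (f : L2) :
    ∃ u : ℝ → ℂ, Continuous u ∧ MemLp (fun x : ℝ => (x : ℂ) * u x) 2 ∧
      WeakDeriv u fun x => f x - κ * x * u x := by
  set G : ℝ → ℂ := fun x => ∫ y in (0 : ℝ)..x, cgauss (-κ) y * f y with hG
  have hG' : ∀ x, G x = 0 + ∫ y in (0 : ℝ)..x, cgauss (-κ) y * f y := fun x => by rw [zero_add]
  have hc := continuous_variation_of_constants κ f 0 hG'
  refine ⟨_, hc, ?_, weakDeriv_variation_of_constants κ f 0 hG'⟩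
  refine memLp_of_kernel_bound (measurable_gaussKernel κ.re) ENNReal.ofReal_ne_top
    (lintegral_gaussKernel_left hκ) (lintegral_gaussKernel_right hκ) f
    (Complex.continuous_ofReal.mul hc).aestronglyMeasurable fun x => ?_
  have h1 : ‖(x : ℂ) * (cgauss κ x * G x)‖ₑ
      = ‖(x : ℂ) * (cgauss κ x * ∫ y in Set.uIoc 0 x, cgauss (-κ) y * f y)‖ₑ := by
    have : ‖G x‖ₑ = ‖∫ y in Set.uIoc 0 x, cgauss (-κ) y * f y‖ₑ := by
      rw [← ofReal_norm, ← ofReal_norm, hG,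
        intervalIntegral.norm_intervalIntegral_eq]
    simp only [enorm_mul, this]
  rw [h1]
  refine (enorm_setIntegral_kernel_le κ f x measurableSet_uIoc).trans (lintegral_mono fun y => ?_)
  by_cases hy : y ∈ Set.uIoc 0 x
  · have : |y| ≤ |x| := by
      have := Set.abs_sub_left_of_mem_uIcc (Set.uIoc_subset_uIcc hy)
      simpa using this
    simp [gaussKernel, hy, this]
  · simp [hy]

/-- For `re κ < 0` the equation `u' + κ x u = f` is solvable if `f` is orthogonal to the Gaussian
annihilated by the transposed operator. -/
theorem exists_solution_of_re_neg {κ : ℂ} (hκ : κ.re < 0) (f : L2)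
    (h0 : ∫ x, cgauss (-κ) x * f x = 0) :
    ∃ u : ℝ → ℂ, Continuous u ∧ MemLp (fun x : ℝ => (x : ℂ) * u x) 2 ∧
      WeakDeriv u fun x => f x - κ * x * u x := by
  have hκ' : 0 < (-κ).re := by simpa using hκ
  have hi : Integrable fun x => cgauss (-κ) x * f x :=
    (memLp_cgauss hκ').integrable_mul (Lp.memLp f)
  set G : ℝ → ℂ := fun x => ∫ y in Set.Iic x, cgauss (-κ) y * f y with hG
  have hG' : ∀ x, G x = (∫ y in Set.Iic 0, cgauss (-κ) y * f y)
      + ∫ y in (0 : ℝ)..x, cgauss (-κ) y * f y := fun x => by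
    rw [← intervalIntegral.integral_Iic_sub_Iic hi.integrableOn hi.integrableOn]; ring
  have hc := continuous_variation_of_constants κ f _ hG'
  refine ⟨_, hc, ?_, weakDeriv_variation_of_constants κ f _ hG'⟩
  refine memLp_of_kernel_bound (K := fun x y => gaussKernel (-κ).re y x)
    ((measurable_gaussKernel (-κ).re).comp measurable_swap)
    ENNReal.ofReal_ne_top (lintegral_gaussKernel_right hκ') (lintegral_gaussKernel_left hκ') f
    (Complex.continuous_ofReal.mul hc).aestronglyMeasurable fun x => ?_
  -- The integral over the left half-line is minus the one over the right half-line; whichever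
  -- does not contain the origin gives the bound.
  have hset : ∃ s : Set ℝ, MeasurableSet s ∧ (∀ y ∈ s, |x| ≤ |y|) ∧
      ‖G x‖ₑ = ‖∫ y in s, cgauss (-κ) y * f y‖ₑ := by
    rcases le_total x 0 with hx | hx
    · refine ⟨Set.Iic x, measurableSet_Iic, fun y hy => ?_, rfl⟩
      have hy' : y ≤ x := hy
      rw [abs_of_nonpos hx, abs_of_nonpos (hy'.trans hx)]; linarith
    · refine ⟨Set.Ioi x, measurableSet_Ioi, fun y hy => ?_, ?_⟩
      · have hy' : x < y := hy
        rw [abs_of_nonneg hx, abs_of_nonneg (hx.trans hy'.le)]; exact hy'.le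
      · have := intervalIntegral.integral_Iic_add_Ioi (b := x) hi.integrableOn hi.integrableOn
        rw [h0] at this
        rw [hG]
        simp only
        rw [eq_neg_of_add_eq_zero_left this, enorm_neg]
  obtain ⟨s, hs, hsx, hGs⟩ := hset
  have h1 : ‖(x : ℂ) * (cgauss κ x * G x)‖ₑ
      = ‖(x : ℂ) * (cgauss κ x * ∫ y in s, cgauss (-κ) y * f y)‖ₑ := by
    simp only [enorm_mul, hGs]
  rw [h1]
  refine (enorm_setIntegral_kernel_le κ f x hs).trans (lintegral_mono fun y => ?_)
  by_cases hy : y ∈ s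
  · simp only [hy, Set.indicator_of_mem, gaussKernel, hsx y hy, if_true]
    gcongr ?_ * _
    apply ENNReal.ofReal_le_ofReal
    refine mul_le_mul (hsx y hy) (Real.exp_le_exp.2 (le_of_eq ?_)) (Real.exp_pos _).le (abs_nonneg _)
    rw [Complex.neg_re]; ring
  · simp [hy]

/-- The weak solutions of `u' + κ x u = 0` are the multiples of a Gaussian. -/
theorem ae_eq_cgauss_of_weakDeriv {κ : ℂ} {u : ℝ → ℂ} (hu : LocallyIntegrable u)
    (h : WeakDeriv u fun x => -(κ * x * u x)) :
    ∃ c : ℂ, u =ᵐ[volume] fun x => c * cgauss κ x := by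
  have hv : LocallyIntegrable fun x : ℝ => -(κ * x * u x) := by
    have := locallyIntegrable_mul hu (E := fun x : ℝ => -(κ * x)) (by fun_prop)
    simpa only [neg_mul] using this
  have hp := h.smooth_mul hu hv (contDiff_cgauss (-κ)) (hasDerivAt_cgauss (-κ))
  obtain ⟨c, hc⟩ := WeakDeriv.ae_const (locallyIntegrable_mul hu (continuous_cgauss (-κ)))
    (hp.congr (ae_eq_refl _) (.of_forall fun x => by ring))
  refine ⟨c, ?_⟩
  filter_upwards [hc] with x hx
  rw [← hx, mul_right_comm, mul_comm (cgauss (-κ) x), cgauss_mul_neg, one_mul]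

/-! ### First-order operators on the domain `H¹(ℝ) ∩ L²(ℝ, x² dx)` -/

/-- The derivative, restricted to the common domain of derivative and position. -/
noncomputable def dX : formDomain →ₗ[ℂ] L2 :=
  derivOp.toFun ∘ₗ Submodule.inclusion inf_le_left

/-- Multiplication by the coordinate, restricted to the same domain. -/
noncomputable def xX : formDomain →ₗ[ℂ] L2 :=
  posOp.toFun ∘ₗ Submodule.inclusion inf_le_right

/-- The operator `u ↦ u' + κ x u`. -/
noncomputable def lad (κ : ℂ) : formDomain →ₗ[ℂ] L2 := dX + κ • xX

theorem weakDeriv_dX (u : formDomain) : WeakDeriv (u : L2) (dX u) :=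
  IsWeakDeriv.weakDeriv (Exists.choose_spec (p := fun v => IsWeakDeriv (u : L2) v) u.2.1)

theorem coeFn_xX (u : formDomain) : xX u =ᵐ[volume] fun x : ℝ => (x : ℂ) * (u : L2) x :=
  MemLp.coeFn_toLp (f := fun x : ℝ => (x : ℂ) * (u : L2) x) u.2.2

/-- `u' + κ x u = f` in the weak sense, without any regularity of `u`. -/
def WeakSol (κ : ℂ) (u f : L2) : Prop := WeakDeriv u fun x => f x - κ * x * u x

theorem lad_apply (κ : ℂ) (u : formDomain) : lad κ u = dX u + κ • xX u := rfl

theorem coeFn_lad (κ : ℂ) (u : formDomain) :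
    dX u =ᵐ[volume] fun x : ℝ => lad κ u x - κ * x * (u : L2) x := by
  rw [lad_apply]
  filter_upwards [Lp.coeFn_add (dX u) (κ • xX u), Lp.coeFn_smul κ (xX u), coeFn_xX u]
    with x h1 h2 h3
  simp only [h1, Pi.add_apply, h2, Pi.smul_apply, h3, smul_eq_mul]
  ring

theorem weakSol_lad (κ : ℂ) (u : formDomain) : WeakSol κ u (lad κ u) :=
  (weakDeriv_dX u).congr (ae_eq_refl _) (coeFn_lad κ u)

theorem lad_eq_of_weakSol {κ : ℂ} {u : formDomain} {f : L2} (h : WeakSol κ u f) :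
    lad κ u = f := by
  have h1 : WeakDeriv (u : L2) (f - κ • xX u : L2) := by
    refine h.congr (ae_eq_refl _) ?_
    filter_upwards [Lp.coeFn_sub f (κ • xX u), Lp.coeFn_smul κ (xX u), coeFn_xX u]
      with x h1 h2 h3
    simp only [h1, Pi.sub_apply, h2, Pi.smul_apply, h3, smul_eq_mul]
    ring
  have := h1.isWeakDeriv.unique (weakDeriv_dX u).isWeakDeriv
  rw [lad_apply, ← this]
  abel

/-- A classical description of elements of the domain. -/
theorem exists_lad_eq {κ : ℂ} {u : ℝ → ℂ} {f : L2} (hu : MemLp u 2)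
    (hx : MemLp (fun x : ℝ => (x : ℂ) * u x) 2) (h : WeakDeriv u fun x => f x - κ * x * u x) :
    ∃ w : formDomain, (w : L2) =ᵐ[volume] u ∧ lad κ w = f := by
  have hae : hu.toLp =ᵐ[volume] u := hu.coeFn_toLp
  have hx' : MemLp (fun x : ℝ => (x : ℂ) * (hu.toLp : L2) x) 2 :=
    (memLp_congr_ae (by filter_upwards [hae] with x h; rw [h])).2 hx
  have hv : MemLp (fun x => f x - κ * x * u x) 2 := by
    have := (Lp.memLp f).sub (hx.const_mul κ)
    refine this.ae_eq (.of_forall fun x => ?_)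
    simp only [Pi.sub_apply]; ring
  have hw : WeakDeriv (hu.toLp : L2) (hv.toLp : L2) := h.congr hae.symm hv.coeFn_toLp.symm
  refine ⟨⟨hu.toLp, ⟨hv.toLp, hw.isWeakDeriv⟩, hx'⟩, hae, lad_eq_of_weakSol ?_⟩
  exact h.congr hae.symm (by filter_upwards [hae] with x h; rw [h])

/-! ### Schwartz functions in the domain -/

/-- The coordinate times a Schwartz function. -/
noncomputable def posS : 𝓢(ℝ, ℂ) →L[ℂ] 𝓢(ℝ, ℂ) := SchwartzMap.smulLeftCLM ℂ Complex.ofReal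

theorem posS_apply (w : 𝓢(ℝ, ℂ)) (x : ℝ) : posS w x = x * w x :=
  SchwartzMap.smulLeftCLM_apply_apply Complex.ofRealCLM.hasTemperateGrowth w x

/-- The operator `w ↦ w' + κ x w` on Schwartz functions. -/
noncomputable def ladS (κ : ℂ) : 𝓢(ℝ, ℂ) →L[ℂ] 𝓢(ℝ, ℂ) :=
  SchwartzMap.derivCLM ℂ ℂ + κ • posS

theorem ladS_apply (κ : ℂ) (w : 𝓢(ℝ, ℂ)) (x : ℝ) : ladS κ w x = deriv w x + κ * (x * w x) := by
  simp [ladS, posS_apply]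

theorem integrable_schwartz_mul (w : 𝓢(ℝ, ℂ)) (u : L2) : Integrable fun x => w x * u x :=
  (w.memLp 2).integrable_mul (Lp.memLp u)

/-- Integration by parts of a weak solution against a Schwartz function. -/
theorem WeakSol.integral_ladS {κ : ℂ} {u f : L2} (h : WeakSol κ u f) (w : 𝓢(ℝ, ℂ)) :
    ∫ x, ladS (-κ) w x * u x = -∫ x, w x * f x := by
  have i1 := integrable_schwartz_mul w u
  have i2 := integrable_schwartz_mul (SchwartzMap.derivCLM ℂ ℂ w) u
  have i3 := integrable_schwartz_mul w f
  have i4 := (integrable_schwartz_mul (posS w) u).const_mul κ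
  simp only [SchwartzMap.derivCLM_apply, posS_apply] at i2 i4
  have e : ∀ x : ℝ, w x * (f x - κ * x * u x) = w x * f x - κ * (x * w x * u x) := fun x => by ring
  have hh := WeakDeriv.integral_eq h (w.smooth ⊤) w.hasDerivAt i1 i2
    (by simp only [e]; exact i3.sub i4)
  simp only [e] at hh
  rw [integral_sub i3 i4] at hh
  have e2 : ∀ x : ℝ, ladS (-κ) w x * u x = deriv w x * u x - κ * (x * w x * u x) := fun x => by
    rw [ladS_apply]; ring
  simp only [e2]
  rw [integral_sub i2 i4, hh]
  ring

/-- Schwartz functions belong to the domain. -/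
theorem exists_coe_eq_toLp (w : 𝓢(ℝ, ℂ)) (κ : ℂ) :
    ∃ u : formDomain, (u : L2) = w.toLp 2 ∧ lad κ u = (ladS κ w).toLp 2 := by
  have hd : WeakDeriv w fun x => ((ladS κ w).toLp 2 : L2) x - κ * x * w x := by
    have h : WeakDeriv w (deriv w) := by
      intro g hg hc
      have := integral_mul_deriv_eq_deriv_mul_of_integrable
        (u := g) (v := w) (u' := deriv g) (v' := deriv w)
        (fun x _ => (hg.differentiable (by norm_num) x).hasDerivAt) (fun x _ => w.hasDerivAt x)
        (integrable_test_mul ((SchwartzMap.derivCLM ℂ ℂ w).continuous.locallyIntegrable)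
          hg.continuous hc)
        (integrable_test_mul w.continuous.locallyIntegrable
          (hg.continuous_deriv (by norm_num)) hc.deriv)
        (integrable_test_mul w.continuous.locallyIntegrable hg.continuous hc)
      rw [this]; ring
    refine h.congr (ae_eq_refl _) ?_
    filter_upwards [(ladS κ w).coeFn_toLp 2 volume] with x hx
    rw [hx, ladS_apply]; ring
  obtain ⟨u, hu, hl⟩ := exists_lad_eq (w.memLp 2)
    (((posS w).memLp 2).ae_eq (.of_forall fun x => posS_apply w x)) hd
  exact ⟨u, Lp.ext (hu.trans (w.coeFn_toLp 2 volume).symm), hl⟩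

theorem coe_toLp_mem (w : 𝓢(ℝ, ℂ)) : (w.toLp 2 : L2) ∈ formDomain := by
  obtain ⟨u, hu, -⟩ := exists_coe_eq_toLp w 0
  rw [← hu]; exact u.2

/-- A Schwartz function as an element of the domain. -/
noncomputable def toDomain (w : 𝓢(ℝ, ℂ)) : formDomain := ⟨(w.toLp 2 : L2), coe_toLp_mem w⟩

theorem lad_toDomain (κ : ℂ) (w : 𝓢(ℝ, ℂ)) : lad κ (toDomain w) = (ladS κ w).toLp 2 := by
  obtain ⟨u, hu, hl⟩ := exists_coe_eq_toLp w κ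
  rw [← hl]
  congr 1
  exact Subtype.ext hu.symm

theorem abs_pow_mul_exp_le {c : ℝ} (hc : 0 < c) (j : ℕ) :
    ∃ C, ∀ x : ℝ, |x| ^ j * Real.exp (-c * x ^ 2 / 2) ≤ C := by
  refine ⟨1 + (2 / c) ^ j * j.factorial, fun x => ?_⟩
  have h1 : |x| ^ j ≤ 1 + (x ^ 2) ^ j := by
    rw [← sq_abs, ← pow_mul, mul_comm, pow_mul]
    nlinarith [sq_nonneg (|x| ^ j - 1), sq_nonneg (|x| ^ j)]
  have h2 := Real.pow_div_factorial_le_exp (c * x ^ 2 / 2) (by positivity) j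
  rw [div_le_iff₀ (by positivity)] at h2
  have h3 : (x ^ 2) ^ j = (2 / c) ^ j * (c * x ^ 2 / 2) ^ j := by
    rw [← mul_pow]; congr 1; field_simp
  have h4 : Real.exp (-c * x ^ 2 / 2) * Real.exp (c * x ^ 2 / 2) = 1 := by
    rw [← Real.exp_add, ← Real.exp_zero]; congr 1; ring
  have h5 : Real.exp (-c * x ^ 2 / 2) ≤ 1 := by
    rw [Real.exp_le_one_iff]
    have : 0 ≤ c * x ^ 2 := by positivity
    linarith
  calc |x| ^ j * Real.exp (-c * x ^ 2 / 2)
      ≤ (1 + (x ^ 2) ^ j) * Real.exp (-c * x ^ 2 / 2) := by gcongr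
    _ = Real.exp (-c * x ^ 2 / 2)
        + (2 / c) ^ j * (c * x ^ 2 / 2) ^ j * Real.exp (-c * x ^ 2 / 2) := by rw [h3]; ring
    _ ≤ 1 + (2 / c) ^ j * (Real.exp (c * x ^ 2 / 2) * j.factorial)
        * Real.exp (-c * x ^ 2 / 2) := by gcongr
    _ = 1 + (2 / c) ^ j * j.factorial
        * (Real.exp (-c * x ^ 2 / 2) * Real.exp (c * x ^ 2 / 2)) := by ring
    _ = _ := by rw [h4, mul_one]

theorem norm_polynomial_mul_cgauss_le {κ : ℂ} (hκ : 0 < κ.re) (p : Polynomial ℂ) :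
    ∃ C, ∀ x : ℝ, ‖p.eval (x : ℂ) * cgauss κ x‖ ≤ C := by
  induction p using Polynomial.induction_on' with
  | add p q hp hq =>
    obtain ⟨C, hC⟩ := hp
    obtain ⟨C', hC'⟩ := hq
    refine ⟨C + C', fun x => ?_⟩
    rw [Polynomial.eval_add, add_mul]
    exact (norm_add_le _ _).trans (add_le_add (hC x) (hC' x))
  | monomial j a =>
    obtain ⟨C, hC⟩ := abs_pow_mul_exp_le hκ j
    refine ⟨‖a‖ * C, fun x => ?_⟩
    rw [Polynomial.eval_monomial, norm_mul, norm_mul, norm_pow, Complex.norm_real, norm_cgauss,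
      Real.norm_eq_abs, mul_assoc]
    gcongr
    exact hC x

theorem exists_iteratedDeriv_cgauss (κ : ℂ) (n : ℕ) : ∃ p : Polynomial ℂ,
    ∀ x : ℝ, iteratedDeriv n (cgauss κ) x = p.eval (x : ℂ) * cgauss κ x := by
  induction n with
  | zero => exact ⟨1, fun x => by simp⟩
  | succ n ih =>
    obtain ⟨p, hp⟩ := ih
    refine ⟨p.derivative - Polynomial.C κ * Polynomial.X * p, fun x => ?_⟩
    have hd : HasDerivAt (fun x : ℝ => p.eval (x : ℂ) * cgauss κ x) _ x :=
      ((p.hasDerivAt (x : ℂ)).comp_ofReal).mul (hasDerivAt_cgauss κ x)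
    rw [iteratedDeriv_succ, funext hp, hd.deriv]
    simp only [Polynomial.eval_sub, Polynomial.eval_mul, Polynomial.eval_C, Polynomial.eval_X]
    ring

/-- The complex Gaussian as a Schwartz function. -/
noncomputable def cgaussS {κ : ℂ} (hκ : 0 < κ.re) : 𝓢(ℝ, ℂ) where
  toFun := cgauss κ
  smooth' := contDiff_cgauss κ
  decay' k n := by
    obtain ⟨p, hp⟩ := exists_iteratedDeriv_cgauss κ n
    obtain ⟨C, hC⟩ := norm_polynomial_mul_cgauss_le hκ (Polynomial.X ^ k * p)
    refine ⟨C, fun x => ?_⟩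
    rw [norm_iteratedFDeriv_eq_norm_iteratedDeriv, hp]
    refine le_of_eq_of_le ?_ (hC x)
    simp only [Polynomial.eval_mul, Polynomial.eval_pow, Polynomial.eval_X, norm_mul, norm_pow,
      Complex.norm_real]
    ring

theorem cgaussS_apply {κ : ℂ} (hκ : 0 < κ.re) (x : ℝ) : cgaussS hκ x = cgauss κ x := rfl

theorem ladS_cgaussS {κ : ℂ} (hκ : 0 < κ.re) : ladS κ (cgaussS hκ) = 0 := by
  ext x
  have : deriv (cgaussS hκ) x = -(κ * x) * cgauss κ x := (hasDerivAt_cgauss κ x).deriv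
  rw [ladS_apply, this, cgaussS_apply, zero_apply]
  ring

/-! ### Solvability, kernels and regularity -/

theorem exists_lad_eq_of_re_pos {κ : ℂ} (hκ : 0 < κ.re) (f : L2) :
    ∃ u : formDomain, lad κ u = f := by
  obtain ⟨u, hc, hx, h⟩ := exists_solution_of_re_pos hκ f
  obtain ⟨w, -, hw⟩ := exists_lad_eq (memLp_of_memLp_mul_self hc hx) hx h
  exact ⟨w, hw⟩

theorem exists_lad_eq_of_re_neg {κ : ℂ} (hκ : κ.re < 0) (f : L2)
    (h0 : ∫ x, cgauss (-κ) x * f x = 0) : ∃ u : formDomain, lad κ u = f := by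
  obtain ⟨u, hc, hx, h⟩ := exists_solution_of_re_neg hκ f h0
  obtain ⟨w, -, hw⟩ := exists_lad_eq (memLp_of_memLp_mul_self hc hx) hx h
  exact ⟨w, hw⟩

theorem WeakSol.exists_ae_eq_cgauss {κ : ℂ} {u f : L2} (h : WeakSol κ u f) {w : formDomain}
    (hw : lad κ w = f) : ∃ c : ℂ, (u - (w : L2) : L2) =ᵐ[volume] fun x => c * cgauss κ x := by
  have hl : ∀ v : L2, LocallyIntegrable fun x : ℝ => f x - κ * x * v x := fun v =>
    (locallyIntegrable_coe f).sub
      (locallyIntegrable_mul (locallyIntegrable_coe v) (E := fun x : ℝ => κ * x) (by fun_prop))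
  have hs := WeakDeriv.sub h (hw ▸ weakSol_lad κ w : WeakSol κ w f) (locallyIntegrable_coe _)
    (hl _) (locallyIntegrable_coe _) (hl _)
  have hae := Lp.coeFn_sub u (w : L2)
  refine ae_eq_cgauss_of_weakDeriv (locallyIntegrable_coe _) (hs.congr hae.symm ?_)
  filter_upwards [hae] with x hx
  rw [hx, Pi.sub_apply]; ring

/-- Regularity: a square-integrable weak solution of `u' + κ x u = f` with `0 < re κ` and `f` in
`L²` lies in the domain; and `u` differs from any given solution by a multiple of the Gaussian. -/
theorem WeakSol.eq_add_smul_cgaussS {κ : ℂ} (hκ : 0 < κ.re) {u f : L2} (h : WeakSol κ u f)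
    {w : formDomain} (hw : lad κ w = f) :
    ∃ c : ℂ, u = ((w + c • toDomain (cgaussS hκ) : formDomain) : L2) := by
  obtain ⟨c, hc⟩ := h.exists_ae_eq_cgauss hw
  refine ⟨c, ?_⟩
  have : u - (w : L2) = c • ((cgaussS hκ).toLp 2 : L2) := by
    apply Lp.ext
    filter_upwards [hc, Lp.coeFn_smul c ((cgaussS hκ).toLp 2 : L2),
      (cgaussS hκ).coeFn_toLp 2 volume] with x h1 h2 h3
    rw [h1, h2, Pi.smul_apply, h3, cgaussS_apply, smul_eq_mul]
  rw [Submodule.coe_add, Submodule.coe_smul, toDomain, ← this]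
  abel

theorem WeakSol.eq_of_re_neg {κ : ℂ} (hκ : κ.re < 0) {u f : L2} (h : WeakSol κ u f)
    {w : formDomain} (hw : lad κ w = f) : u = w := by
  obtain ⟨c, hc⟩ := h.exists_ae_eq_cgauss hw
  have := not_memLp_cgauss hκ ((Lp.memLp _).ae_eq hc)
  subst this
  rw [← sub_eq_zero]
  apply Lp.ext
  filter_upwards [hc, Lp.coeFn_zero ℂ 2 (volume : Measure ℝ)] with x h1 h2
  rw [h1, h2, Pi.zero_apply, zero_mul]

theorem ker_lad_of_re_pos {κ : ℂ} (hκ : 0 < κ.re) {u : formDomain} (h : lad κ u = 0) :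
    ∃ c : ℂ, u = c • toDomain (cgaussS hκ) := by
  obtain ⟨c, hc⟩ := (weakSol_lad κ u).eq_add_smul_cgaussS hκ (w := 0) (by rw [map_zero, h])
  exact ⟨c, Subtype.ext (by rw [hc, zero_add])⟩

theorem ker_lad_of_re_neg {κ : ℂ} (hκ : κ.re < 0) {u : formDomain} (h : lad κ u = 0) : u = 0 :=
  Subtype.ext ((weakSol_lad κ u).eq_of_re_neg hκ (w := 0) (by rw [map_zero, h]))

theorem integral_cgauss_mul_of_weakSol {κ : ℂ} (hκ : κ.re < 0) {u f : L2} (h : WeakSol κ u f) :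
    ∫ x, cgauss (-κ) x * f x = 0 := by
  have hκ' : 0 < (-κ).re := by simpa using hκ
  have := h.integral_ladS (cgaussS hκ')
  rw [ladS_cgaussS] at this
  simpa [cgaussS_apply] using this

theorem WeakSol.exists_coe_eq {κ : ℂ} (hκ : κ.re ≠ 0) {u f : L2} (h : WeakSol κ u f) :
    ∃ w : formDomain, (w : L2) = u ∧ lad κ w = f := by
  rcases hκ.lt_or_gt with hκ | hκ
  · obtain ⟨w, hw⟩ := exists_lad_eq_of_re_neg hκ f (integral_cgauss_mul_of_weakSol hκ h)
    exact ⟨w, (h.eq_of_re_neg hκ hw).symm, hw⟩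
  · obtain ⟨w, hw⟩ := exists_lad_eq_of_re_pos hκ f
    obtain ⟨c, hc⟩ := h.eq_add_smul_cgaussS hκ hw
    refine ⟨_, hc.symm, ?_⟩
    rw [map_add, map_smul, lad_toDomain, ladS_cgaussS, hw]
    have : (0 : 𝓢(ℝ, ℂ)).toLp 2 = (0 : L2) := map_zero (SchwartzMap.toLpCLM ℂ ℂ 2 volume)
    rw [this, smul_zero, add_zero]

/-! ### Ladder operators of the rotated oscillator -/

/-- The operators `u ↦ u' ± κ x u` commute up to a multiple of the identity, including domains:
if the one product is defined on `u`, so is the other. -/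
theorem exists_lad_neg_eq {κ : ℂ} (hκ : κ.re ≠ 0) {u w : formDomain} (h : (w : L2) = lad κ u) :
    ∃ y : formDomain, (y : L2) = lad (-κ) u ∧ lad κ y = lad (-κ) w - (2 * κ) • (u : L2) := by
  refine WeakSol.exists_coe_eq hκ ?_
  have hli := fun v : L2 => locallyIntegrable_coe v
  have hE : ∀ x : ℝ, HasDerivAt (fun x : ℝ => 2 * κ * (x : ℂ)) (2 * κ) x := fun x => by
    simpa using ((hasDerivAt_id x).ofReal_comp).const_mul (2 * κ)
  have hEs : ContDiff ℝ ∞ fun x : ℝ => 2 * κ * (x : ℂ) :=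
    contDiff_const.mul Complex.ofRealCLM.contDiff
  have h1 := (weakDeriv_dX u).smooth_mul (hli _) (hli _) hEs hE
  have h2 := (weakDeriv_dX w).sub h1 (hli _) (hli _)
    (locallyIntegrable_mul (hli _) hEs.continuous)
    ((locallyIntegrable_mul (hli _) hEs.continuous).add
      (locallyIntegrable_mul (hli _) continuous_const))
  have hu1 := coeFn_lad κ u
  have hu2 := coeFn_lad (-κ) u
  have hw := coeFn_lad (-κ) w
  rw [← h] at hu1
  refine h2.congr ?_ ?_
  · filter_upwards [hu1, hu2] with x h1 h2
    rw [h1] at h2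
    linear_combination h2
  · filter_upwards [hu1, hu2, hw, Lp.coeFn_sub (lad (-κ) w) ((2 * κ) • (u : L2)),
      Lp.coeFn_smul (2 * κ) (u : L2)] with x h1 h2 h3 h4 h5
    rw [h4, Pi.sub_apply, h5, Pi.smul_apply, smul_eq_mul]
    linear_combination h3 - κ * x * h1 - κ * x * h2

/-- The factor `exp (iθ/2)` by which the coordinate is rotated. -/
noncomputable def rot (θ : ℝ) : ℂ := Complex.exp (Complex.I * θ / 2)

theorem rot_ne_zero (θ : ℝ) : rot θ ≠ 0 := Complex.exp_ne_zero _

theorem rot_sq (θ : ℝ) : rot θ ^ 2 = Complex.exp (θ * Complex.I) := by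
  rw [rot, ← Complex.exp_nat_mul]
  congr 1
  push_cast; ring

theorem rot_sq_re (θ : ℝ) : (rot θ ^ 2).re = Real.cos θ := by
  rw [rot_sq, Complex.exp_ofReal_mul_I_re]

theorem norm_rot (θ : ℝ) : ‖rot θ‖ = 1 := by
  have : Complex.I * θ / 2 = ((θ / 2 : ℝ) : ℂ) * Complex.I := by push_cast; ring
  rw [rot, this, Complex.norm_exp_ofReal_mul_I]

/-- The annihilation operator `exp (-iθ/2) ∂ + exp (iθ/2) x`. -/
noncomputable def lowerOp (θ : ℝ) : formDomain →ₗ[ℂ] L2 := (rot θ)⁻¹ • lad (rot θ ^ 2)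

/-- The creation operator `-exp (-iθ/2) ∂ + exp (iθ/2) x`. -/
noncomputable def raiseOp (θ : ℝ) : formDomain →ₗ[ℂ] L2 := -((rot θ)⁻¹ • lad (-rot θ ^ 2))

theorem lowerOp_apply (θ : ℝ) (u : formDomain) :
    lowerOp θ u = (rot θ)⁻¹ • dX u + rot θ • xX u := by
  rw [lowerOp, LinearMap.smul_apply, lad_apply, smul_add, smul_smul, sq,
    inv_mul_cancel_left₀ (rot_ne_zero θ)]

theorem raiseOp_apply (θ : ℝ) (u : formDomain) :
    raiseOp θ u = -((rot θ)⁻¹ • dX u) + rot θ • xX u := by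
  rw [raiseOp, LinearMap.neg_apply, LinearMap.smul_apply, lad_apply, smul_add, smul_smul, mul_neg,
    sq, inv_mul_cancel_left₀ (rot_ne_zero θ), neg_smul, neg_add, neg_neg]

/-- The annihilation operator on Schwartz functions. -/
noncomputable def lowerS (θ : ℝ) : 𝓢(ℝ, ℂ) →L[ℂ] 𝓢(ℝ, ℂ) := (rot θ)⁻¹ • ladS (rot θ ^ 2)

/-- The creation operator on Schwartz functions. -/
noncomputable def raiseS (θ : ℝ) : 𝓢(ℝ, ℂ) →L[ℂ] 𝓢(ℝ, ℂ) := -((rot θ)⁻¹ • ladS (-rot θ ^ 2))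

theorem lowerS_apply (θ : ℝ) (w : 𝓢(ℝ, ℂ)) :
    lowerS θ w = (rot θ)⁻¹ • SchwartzMap.derivCLM ℂ ℂ w + rot θ • posS w := by
  have := rot_ne_zero θ
  ext x
  simp [lowerS, ladS]
  field_simp

theorem raiseS_apply (θ : ℝ) (w : 𝓢(ℝ, ℂ)) :
    raiseS θ w = -((rot θ)⁻¹ • SchwartzMap.derivCLM ℂ ℂ w) + rot θ • posS w := by
  have := rot_ne_zero θ
  ext x
  simp [raiseS, ladS]
  field_simp
  ring

theorem toLp_smul (c : ℂ) (w : 𝓢(ℝ, ℂ)) : ((c • w).toLp 2 : L2) = c • (w.toLp 2 : L2) :=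
  map_smul (SchwartzMap.toLpCLM ℂ ℂ 2 volume) c w

theorem toLp_neg (w : 𝓢(ℝ, ℂ)) : ((-w).toLp 2 : L2) = -(w.toLp 2 : L2) :=
  map_neg (SchwartzMap.toLpCLM ℂ ℂ 2 volume) w

theorem toLp_zero : ((0 : 𝓢(ℝ, ℂ)).toLp 2 : L2) = 0 :=
  map_zero (SchwartzMap.toLpCLM ℂ ℂ 2 volume)

theorem lowerOp_toDomain (θ : ℝ) (w : 𝓢(ℝ, ℂ)) :
    lowerOp θ (toDomain w) = (lowerS θ w).toLp 2 := by
  rw [lowerOp, LinearMap.smul_apply, lad_toDomain, ← toLp_smul]; rfl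

theorem raiseOp_toDomain (θ : ℝ) (w : 𝓢(ℝ, ℂ)) :
    raiseOp θ (toDomain w) = (raiseS θ w).toLp 2 := by
  rw [raiseOp, LinearMap.neg_apply, LinearMap.smul_apply, lad_toDomain, ← toLp_smul, ← toLp_neg]
  rfl

theorem derivCLM_posS (w : 𝓢(ℝ, ℂ)) :
    SchwartzMap.derivCLM ℂ ℂ (posS w) = w + posS (SchwartzMap.derivCLM ℂ ℂ w) := by
  ext x
  have h1 : HasDerivAt (fun x : ℝ => (x : ℂ)) 1 x := (hasDerivAt_id x).ofReal_comp
  have h2 : (posS w : ℝ → ℂ) = fun x : ℝ => (x : ℂ) * w x := funext (posS_apply w)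
  have h3 : HasDerivAt (fun x : ℝ => (x : ℂ) * w x) _ x := h1.mul (w.hasDerivAt x)
  rw [SchwartzMap.derivCLM_apply, h2, h3.deriv, add_apply, posS_apply,
    SchwartzMap.derivCLM_apply, one_mul]

theorem lowerS_raiseS (θ : ℝ) (w : 𝓢(ℝ, ℂ)) :
    lowerS θ (raiseS θ w) = raiseS θ (lowerS θ w) + (2 : ℂ) • w := by
  have := rot_ne_zero θ
  simp only [lowerS_apply, raiseS_apply, map_add, map_neg, map_smul, derivCLM_posS, smul_add,
    smul_neg, smul_smul]
  simp only [inv_mul_cancel₀ this, mul_inv_cancel₀ this, two_smul, one_smul]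
  abel

section Ladder

variable {θ : ℝ} (hθ : 0 < Real.cos θ)
include hθ

theorem rot_sq_re_pos : 0 < (rot θ ^ 2).re := by rwa [rot_sq_re]

theorem neg_rot_sq_re_neg : (-rot θ ^ 2).re < 0 := by
  rw [Complex.neg_re, rot_sq_re]; linarith

theorem exists_raiseOp_eq_of_lowerOp {u w : formDomain} (h : (w : L2) = lowerOp θ u) :
    ∃ y : formDomain, (y : L2) = raiseOp θ u ∧
      lowerOp θ y = raiseOp θ w + (2 : ℂ) • (u : L2) := by
  have hz := rot_ne_zero θ
  have h' : ((rot θ • w : formDomain) : L2) = lad (rot θ ^ 2) u := by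
    rw [Submodule.coe_smul, h, lowerOp, LinearMap.smul_apply, smul_smul, mul_inv_cancel₀ hz,
      one_smul]
  obtain ⟨y, hy, hy2⟩ := exists_lad_neg_eq (rot_sq_re_pos hθ).ne' h'
  refine ⟨-((rot θ)⁻¹ • y), ?_, ?_⟩
  · rw [Submodule.coe_neg, Submodule.coe_smul, hy]; rfl
  · rw [lowerOp, LinearMap.smul_apply, map_neg, map_smul, hy2, raiseOp, LinearMap.neg_apply,
      LinearMap.smul_apply, map_smul]
    simp only [smul_sub, smul_smul, smul_neg]
    have e1 : (rot θ)⁻¹ * ((rot θ)⁻¹ * rot θ) = (rot θ)⁻¹ := by field_simp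
    have e2 : (rot θ)⁻¹ * ((rot θ)⁻¹ * (2 * rot θ ^ 2)) = 2 := by field_simp
    rw [e1, e2]
    abel

theorem exists_lowerOp_eq_of_raiseOp {u w : formDomain} (h : (w : L2) = raiseOp θ u) :
    ∃ y : formDomain, (y : L2) = lowerOp θ u ∧
      raiseOp θ y = lowerOp θ w - (2 : ℂ) • (u : L2) := by
  have hz := rot_ne_zero θ
  have h' : ((-(rot θ • w) : formDomain) : L2) = lad (-rot θ ^ 2) u := by
    rw [Submodule.coe_neg, Submodule.coe_smul, h, raiseOp, LinearMap.neg_apply,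
      LinearMap.smul_apply, smul_neg, smul_smul, mul_inv_cancel₀ hz, one_smul, neg_neg]
  obtain ⟨y, hy, hy2⟩ := exists_lad_neg_eq (neg_rot_sq_re_neg hθ).ne h'
  rw [neg_neg] at hy hy2
  refine ⟨(rot θ)⁻¹ • y, ?_, ?_⟩
  · rw [Submodule.coe_smul, hy]; rfl
  · rw [raiseOp, LinearMap.neg_apply, LinearMap.smul_apply, map_smul, hy2, lowerOp,
      LinearMap.smul_apply, map_neg, map_smul]
    simp only [smul_sub, smul_smul, smul_neg]
    have e1 : (rot θ)⁻¹ * ((rot θ)⁻¹ * rot θ) = (rot θ)⁻¹ := by field_simp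
    have e2 : (rot θ)⁻¹ * ((rot θ)⁻¹ * (2 * -rot θ ^ 2)) = -2 := by field_simp
    rw [e1, e2, neg_smul]
    abel

theorem exists_lowerOp_eq (f : L2) : ∃ u : formDomain, lowerOp θ u = f := by
  obtain ⟨u, hu⟩ := exists_lad_eq_of_re_pos (rot_sq_re_pos hθ) (rot θ • f)
  refine ⟨u, ?_⟩
  rw [lowerOp, LinearMap.smul_apply, hu, smul_smul, inv_mul_cancel₀ (rot_ne_zero θ), one_smul]

theorem exists_raiseOp_eq {f : L2} (h0 : ∫ x, cgauss (rot θ ^ 2) x * f x = 0) :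
    ∃ u : formDomain, raiseOp θ u = f := by
  obtain ⟨u, hu⟩ := exists_lad_eq_of_re_neg (neg_rot_sq_re_neg hθ) f (by rwa [neg_neg])
  refine ⟨-(rot θ • u), ?_⟩
  rw [raiseOp, LinearMap.neg_apply, LinearMap.smul_apply, map_neg, map_smul, hu, smul_neg,
    smul_smul, inv_mul_cancel₀ (rot_ne_zero θ), one_smul, neg_neg]

theorem eq_zero_of_raiseOp_eq_zero {u : formDomain} (h : raiseOp θ u = 0) : u = 0 := by
  refine ker_lad_of_re_neg (neg_rot_sq_re_neg hθ) ?_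
  rw [raiseOp, LinearMap.neg_apply, LinearMap.smul_apply, neg_eq_zero] at h
  exact (smul_eq_zero.1 h).resolve_left (inv_ne_zero (rot_ne_zero θ))

/-- The rotated Hermite functions, `hₙ(exp (iθ/2) x)` up to a constant factor. -/
noncomputable def rotHermite : ℕ → 𝓢(ℝ, ℂ)
  | 0 => cgaussS (rot_sq_re_pos hθ)
  | n + 1 => ((√(2 * (n + 1)) : ℝ) : ℂ)⁻¹ • raiseS θ (rotHermite n)

/-- The rotated Hermite functions with index lowered by one, `0` at index `0`. -/
noncomputable def rotHermitePred : ℕ → 𝓢(ℝ, ℂ)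
  | 0 => 0
  | n + 1 => rotHermite hθ n

omit hθ in
/-- The ladder coefficient `√(2n)`. -/
noncomputable def ladderCoeff (n : ℕ) : ℂ := ((√(2 * n) : ℝ) : ℂ)

omit hθ in
theorem ladderCoeff_sq (n : ℕ) : ladderCoeff n * ladderCoeff n = 2 * n := by
  rw [ladderCoeff, ← Complex.ofReal_mul, Real.mul_self_sqrt (by positivity)]
  push_cast; ring

omit hθ in
theorem ladderCoeff_zero : ladderCoeff 0 = 0 := by simp [ladderCoeff]

omit hθ in
theorem ladderCoeff_succ_ne_zero (n : ℕ) : ladderCoeff (n + 1) ≠ 0 := by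
  rw [ladderCoeff, Complex.ofReal_ne_zero]
  positivity

theorem raiseS_rotHermite (n : ℕ) :
    raiseS θ (rotHermite hθ n) = ladderCoeff (n + 1) • rotHermite hθ (n + 1) := by
  have h := ladderCoeff_succ_ne_zero n
  have : rotHermite hθ (n + 1) = (ladderCoeff (n + 1))⁻¹ • raiseS θ (rotHermite hθ n) := by
    rw [rotHermite, ladderCoeff]; push_cast; rfl
  rw [this, smul_smul, mul_inv_cancel₀ h, one_smul]

theorem raiseS_rotHermitePred (n : ℕ) :
    raiseS θ (rotHermitePred hθ n) = ladderCoeff n • rotHermite hθ n := by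
  cases n with
  | zero => rw [ladderCoeff_zero, zero_smul, rotHermitePred, map_zero]
  | succ n => exact raiseS_rotHermite hθ n

theorem lowerS_rotHermite (n : ℕ) :
    lowerS θ (rotHermite hθ n) = ladderCoeff n • rotHermitePred hθ n := by
  induction n with
  | zero =>
    have h : ladS (rot θ ^ 2) (rotHermite hθ 0) = 0 := ladS_cgaussS (rot_sq_re_pos hθ)
    rw [ladderCoeff_zero, zero_smul, lowerS]
    simp [h]
  | succ n ih =>
    have h := ladderCoeff_succ_ne_zero n
    have e := raiseS_rotHermite hθ n
    have e2 := lowerS_raiseS θ (rotHermite hθ n)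
    rw [e, ih, map_smul, map_smul, raiseS_rotHermitePred, smul_smul, ladderCoeff_sq, ← add_smul]
      at e2
    have e3 : (2 * (n : ℂ) + 2) = ladderCoeff (n + 1) * ladderCoeff (n + 1) := by
      rw [ladderCoeff_sq]; push_cast; ring
    rw [e3, ← smul_smul] at e2
    exact smul_right_injective _ h e2

end Ladder

/-! ### Coefficient functionals and the spectral problem for the number operator -/

/-- The complex conjugate of a Schwartz function. -/
noncomputable def conjS (w : 𝓢(ℝ, ℂ)) : 𝓢(ℝ, ℂ) :=
  w.postcompCLM (Complex.conjCLE : ℂ →L[ℝ] ℂ)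

theorem conjS_apply (w : 𝓢(ℝ, ℂ)) (x : ℝ) : conjS w x = starRingEnd ℂ (w x) := rfl

/-- The bilinear pairing `f ↦ ∫ w f` with a Schwartz function. -/
noncomputable def pairS (w : 𝓢(ℝ, ℂ)) : L2 →L[ℂ] ℂ := innerSL ℂ ((conjS w).toLp 2 : L2)

theorem pairS_apply (w : 𝓢(ℝ, ℂ)) (f : L2) : pairS w f = ∫ x, w x * f x := by
  rw [pairS, innerSL_apply_apply, L2.inner_def]
  refine integral_congr_ae ?_
  filter_upwards [(conjS w).coeFn_toLp 2 volume] with x hx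
  rw [hx, RCLike.inner_apply, conjS_apply, RingHomCompTriple.comp_apply]
  simp [mul_comm]

theorem norm_conjS (w : 𝓢(ℝ, ℂ)) : ‖((conjS w).toLp 2 : L2)‖ = ‖(w.toLp 2 : L2)‖ := by
  rw [SchwartzMap.norm_toLp, SchwartzMap.norm_toLp]
  congr 1
  refine eLpNorm_congr_norm_ae (.of_forall fun x => ?_)
  rw [conjS_apply, RCLike.norm_conj]

theorem norm_pairS (w : 𝓢(ℝ, ℂ)) : ‖pairS w‖ = ‖(w.toLp 2 : L2)‖ := by
  rw [pairS, innerSL_apply_norm, norm_conjS]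

theorem pairS_conjS (w : 𝓢(ℝ, ℂ)) :
    pairS w ((conjS w).toLp 2 : L2) = ((‖(w.toLp 2 : L2)‖ ^ 2 : ℝ) : ℂ) := by
  rw [pairS, innerSL_apply_apply, inner_self_eq_norm_sq_to_K, norm_conjS]
  simp

theorem pairS_smul (c : ℂ) (w : 𝓢(ℝ, ℂ)) (f : L2) : pairS (c • w) f = c * pairS w f := by
  rw [pairS_apply, pairS_apply, ← integral_const_mul]
  refine integral_congr_ae (.of_forall fun x => ?_)
  simp [mul_assoc]

theorem pairS_neg (w : 𝓢(ℝ, ℂ)) (f : L2) : pairS (-w) f = -pairS w f := by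
  rw [← neg_one_smul ℂ, pairS_smul, neg_one_mul]

theorem pairS_lad (κ : ℂ) (w : 𝓢(ℝ, ℂ)) (u : formDomain) :
    pairS w (lad κ u) = -pairS (ladS (-κ) w) u := by
  rw [pairS_apply, pairS_apply, (weakSol_lad κ u).integral_ladS w, neg_neg]

/-- Annihilation and creation operator are transposes of each other. -/
theorem pairS_raiseOp (θ : ℝ) (w : 𝓢(ℝ, ℂ)) (u : formDomain) :
    pairS w (raiseOp θ u) = pairS (lowerS θ w) u := by
  have h : lowerS θ w = (rot θ)⁻¹ • ladS (rot θ ^ 2) w := rfl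
  rw [raiseOp, LinearMap.neg_apply, LinearMap.smul_apply, map_neg, map_smul, pairS_lad, neg_neg, h,
    pairS_smul, smul_neg, neg_neg, smul_eq_mul]

theorem pairS_lowerOp (θ : ℝ) (w : 𝓢(ℝ, ℂ)) (u : formDomain) :
    pairS w (lowerOp θ u) = pairS (raiseS θ w) u := by
  have h : raiseS θ w = -((rot θ)⁻¹ • ladS (-rot θ ^ 2) w) := rfl
  rw [lowerOp, LinearMap.smul_apply, map_smul, pairS_lad, h, pairS_neg, pairS_smul, smul_neg,
    smul_eq_mul]

section Ladder

variable {θ : ℝ} (hθ : 0 < Real.cos θ)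
include hθ

theorem pairS_rotHermite_zero_ne_zero :
    pairS (rotHermite hθ 0) ((rotHermite hθ 0).toLp 2 : L2) ≠ 0 := by
  have h1 : pairS (rotHermite hθ 0) ((rotHermite hθ 0).toLp 2 : L2)
      = ∫ x : ℝ, Complex.exp (-(rot θ ^ 2) * x ^ 2) := by
    rw [pairS_apply]
    refine integral_congr_ae ?_
    filter_upwards [(rotHermite hθ 0).coeFn_toLp 2 volume] with x hx
    rw [hx]
    have : rotHermite hθ 0 x = cgauss (rot θ ^ 2) x := rfl
    rw [this, cgauss, ← Complex.exp_add]
    ring_nf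
  rw [h1, integral_gaussian_complex (rot_sq_re_pos hθ), Complex.cpow_ne_zero_iff]
  left
  exact div_ne_zero (Complex.ofReal_ne_zero.2 Real.pi_ne_zero) (pow_ne_zero 2 (rot_ne_zero θ))

/-- The normalisation `∫ h₀(exp (iθ/2) x)² dx` of the coefficient functionals. -/
noncomputable def hermiteNorm : ℂ := pairS (rotHermite hθ 0) ((rotHermite hθ 0).toLp 2 : L2)

theorem hermiteNorm_ne_zero : hermiteNorm hθ ≠ 0 := pairS_rotHermite_zero_ne_zero hθ

/-- The coefficient functional of the `n`-th rotated Hermite function. -/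
noncomputable def coef (n : ℕ) : L2 →L[ℂ] ℂ := (hermiteNorm hθ)⁻¹ • pairS (rotHermite hθ n)

/-- The coefficient functionals with index lowered by one, `0` at index `0`. -/
noncomputable def coefPred (n : ℕ) : L2 →L[ℂ] ℂ :=
  (hermiteNorm hθ)⁻¹ • pairS (rotHermitePred hθ n)

/-- The rotated Hermite functions as elements of the domain. -/
noncomputable def herm (n : ℕ) : formDomain := toDomain (rotHermite hθ n)

/-- The index-lowered rotated Hermite functions as elements of the domain. -/
noncomputable def hermPred (n : ℕ) : formDomain := toDomain (rotHermitePred hθ n)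

theorem hermPred_zero : hermPred hθ 0 = 0 := Subtype.ext toLp_zero

theorem coefPred_zero : coefPred hθ 0 = 0 := by
  ext f
  have : pairS (0 : 𝓢(ℝ, ℂ)) f = 0 := by simp [pairS_apply]
  simp [coefPred, rotHermitePred, this]

theorem lowerOp_herm (n : ℕ) : lowerOp θ (herm hθ n) = ladderCoeff n • (hermPred hθ n : L2) := by
  rw [herm, lowerOp_toDomain, lowerS_rotHermite, toLp_smul]; rfl

theorem raiseOp_hermPred (n : ℕ) :
    raiseOp θ (hermPred hθ n) = ladderCoeff n • (herm hθ n : L2) := by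
  rw [hermPred, raiseOp_toDomain, raiseS_rotHermitePred, toLp_smul]; rfl

theorem raiseOp_herm (n : ℕ) :
    raiseOp θ (herm hθ n) = ladderCoeff (n + 1) • (herm hθ (n + 1) : L2) :=
  raiseOp_hermPred hθ (n + 1)

theorem coef_raiseOp (n : ℕ) (u : formDomain) :
    coef hθ n (raiseOp θ u) = ladderCoeff n * coefPred hθ n u := by
  simp only [coef, coefPred, smul_apply, pairS_raiseOp, lowerS_rotHermite,
    pairS_smul, smul_eq_mul]
  ring

theorem coefPred_lowerOp (n : ℕ) (u : formDomain) :
    coefPred hθ n (lowerOp θ u) = ladderCoeff n * coef hθ n u := by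
  simp only [coef, coefPred, smul_apply, pairS_lowerOp,
    raiseS_rotHermitePred, pairS_smul, smul_eq_mul]
  ring

theorem coef_succ_raiseOp (n : ℕ) (u : formDomain) :
    coef hθ (n + 1) (raiseOp θ u) = ladderCoeff (n + 1) * coef hθ n u :=
  coef_raiseOp hθ (n + 1) u

theorem coef_herm_self (n : ℕ) : coef hθ n (herm hθ n) = 1 := by
  induction n with
  | zero => exact inv_mul_cancel₀ (hermiteNorm_ne_zero hθ)
  | succ n ih =>
    have h := coef_succ_raiseOp hθ n (herm hθ n)
    rw [raiseOp_herm, map_smul, ih, smul_eq_mul] at h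
    exact mul_left_cancel₀ (ladderCoeff_succ_ne_zero n) h

theorem coef_succ_herm_zero (n : ℕ) : coef hθ (n + 1) (herm hθ 0) = 0 := by
  have h := coefPred_lowerOp hθ (n + 1) (herm hθ 0)
  rw [lowerOp_herm, ladderCoeff_zero, zero_smul, map_zero] at h
  exact (mul_eq_zero.1 h.symm).resolve_left (ladderCoeff_succ_ne_zero n)

theorem exists_raiseOp_eq_of_coef {f : L2} (h : coef hθ 0 f = 0) :
    ∃ u : formDomain, raiseOp θ u = f := by
  refine exists_raiseOp_eq hθ ?_
  have : pairS (rotHermite hθ 0) f = 0 :=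
    (smul_eq_zero.1 h).resolve_left (inv_ne_zero (hermiteNorm_ne_zero hθ))
  rw [pairS_apply] at this
  exact this

theorem eq_smul_herm_zero {u : formDomain} (h : lowerOp θ u = 0) : ∃ c : ℂ, u = c • herm hθ 0 := by
  rw [lowerOp, LinearMap.smul_apply] at h
  exact ker_lad_of_re_pos (rot_sq_re_pos hθ)
    ((smul_eq_zero.1 h).resolve_left (inv_ne_zero (rot_ne_zero θ)))

/-- Solvability for the number operator: `(b a - 2n) u = f` is solvable in the domain once the
`n`-th coefficient of `f` vanishes. The induction splits off the ground state, writes the rest as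
`b g` and solves the equation for `g` one level lower. -/
theorem exists_raise_lower_sub_eq (n : ℕ) {f : L2} (h : coef hθ n f = 0) :
    ∃ u w : formDomain, (w : L2) = lowerOp θ u ∧ raiseOp θ w - (2 * n : ℂ) • (u : L2) = f := by
  induction n generalizing f with
  | zero =>
    obtain ⟨w, hw⟩ := exists_raiseOp_eq_of_coef hθ h
    obtain ⟨u, hu⟩ := exists_lowerOp_eq hθ (w : L2)
    exact ⟨u, w, hu.symm, by simp [hw]⟩
  | succ n ih =>
    have h0 : coef hθ 0 (f - coef hθ 0 f • (herm hθ 0 : L2)) = 0 := by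
      rw [map_sub, map_smul, coef_herm_self, smul_eq_mul, mul_one, sub_self]
    obtain ⟨g, hg⟩ := exists_raiseOp_eq_of_coef hθ h0
    have hgn : coef hθ n (g : L2) = 0 := by
      have := coef_succ_raiseOp hθ n g
      rw [hg, map_sub, map_smul, h, coef_succ_herm_zero, smul_zero, sub_zero] at this
      exact (mul_eq_zero.1 this.symm).resolve_left (ladderCoeff_succ_ne_zero n)
    obtain ⟨u, w, hw, huw⟩ := ih hgn
    obtain ⟨y, hy, hy2⟩ := exists_raiseOp_eq_of_lowerOp hθ hw
    have hn : (2 * ((n + 1 : ℕ) : ℂ)) ≠ 0 := by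
      have : ((n + 1 : ℕ) : ℂ) ≠ 0 := Nat.cast_ne_zero.2 n.succ_ne_zero
      exact mul_ne_zero two_ne_zero this
    set d : ℂ := coef hθ 0 f with hd
    have hlow : ((g + (2 * ((n + 1 : ℕ) : ℂ)) • u : formDomain) : L2)
        = lowerOp θ (y - (d / (2 * ((n + 1 : ℕ) : ℂ))) • herm hθ 0) := by
      rw [map_sub, map_smul, lowerOp_herm, ladderCoeff_zero, zero_smul, smul_zero, sub_zero, hy2,
        Submodule.coe_add, Submodule.coe_smul, ← huw]
      push_cast
      module
    refine ⟨_, _, hlow, ?_⟩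
    rw [map_add, map_smul, Submodule.coe_sub, Submodule.coe_smul, hy, hg, smul_sub, smul_smul,
      mul_div_cancel₀ _ hn]
    abel

/-- Solvability for the companion operator: `(a b - 2n) u = f` is solvable in the domain once the
coefficient of `f` of index `n - 1` vanishes. -/
theorem exists_lower_raise_sub_eq (n : ℕ) {f : L2} (h : coefPred hθ n f = 0) :
    ∃ u w : formDomain, (w : L2) = raiseOp θ u ∧ lowerOp θ w - (2 * n : ℂ) • (u : L2) = f := by
  cases n with
  | zero =>
    obtain ⟨w, hw⟩ := exists_lowerOp_eq hθ f
    have h0 : coef hθ 0 ((w - coef hθ 0 (w : L2) • herm hθ 0 : formDomain) : L2) = 0 := by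
      rw [Submodule.coe_sub, Submodule.coe_smul, map_sub, map_smul, coef_herm_self, smul_eq_mul,
        mul_one, sub_self]
    obtain ⟨u, hu⟩ := exists_raiseOp_eq_of_coef hθ h0
    refine ⟨u, _, hu.symm, ?_⟩
    rw [map_sub, map_smul, lowerOp_herm, ladderCoeff_zero, hw]
    simp
  | succ n =>
    obtain ⟨u, w, hw, huw⟩ := exists_raise_lower_sub_eq hθ n (f := f) h
    obtain ⟨y, hy, hy2⟩ := exists_raiseOp_eq_of_lowerOp hθ hw
    refine ⟨u, y, hy, ?_⟩
    rw [hy2, ← huw]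
    push_cast
    module

/-- The eigenvalues of the number operator are simple. -/
theorem eq_smul_herm_of_raise_lower (n : ℕ) {u w : formDomain} (hw : (w : L2) = lowerOp θ u)
    (h : raiseOp θ w = (2 * n : ℂ) • (u : L2)) : ∃ c : ℂ, u = c • herm hθ n := by
  induction n generalizing u w with
  | zero =>
    rw [Nat.cast_zero, mul_zero, zero_smul] at h
    have h0 := eq_zero_of_raiseOp_eq_zero hθ h
    rw [h0, Submodule.coe_zero] at hw
    exact eq_smul_herm_zero hθ hw.symm
  | succ n ih =>
    have hn : (2 * ((n + 1 : ℕ) : ℂ)) ≠ 0 :=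
      mul_ne_zero two_ne_zero (Nat.cast_ne_zero.2 n.succ_ne_zero)
    have hv : (((2 * ((n + 1 : ℕ) : ℂ)) • u : formDomain) : L2) = raiseOp θ w := by
      rw [h, Submodule.coe_smul]
    obtain ⟨y, hy, hy2⟩ := exists_lowerOp_eq_of_raiseOp hθ hv
    rw [map_smul, ← hw, ← sub_smul] at hy2
    obtain ⟨c, hc⟩ := ih hy (by rw [hy2]; congr 1; push_cast; ring)
    refine ⟨(2 * ((n + 1 : ℕ) : ℂ))⁻¹ * c * ladderCoeff (n + 1), Subtype.ext ?_⟩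
    rw [hc, map_smul, raiseOp_herm] at h
    rw [Submodule.coe_smul, mul_assoc, mul_smul, mul_smul, h, smul_smul, inv_mul_cancel₀ hn,
      one_smul]

theorem eq_coef_smul_herm (n : ℕ) {u w : formDomain} (hw : (w : L2) = lowerOp θ u)
    (h : raiseOp θ w = (2 * n : ℂ) • (u : L2)) : u = coef hθ n (u : L2) • herm hθ n := by
  obtain ⟨c, hc⟩ := eq_smul_herm_of_raise_lower hθ n hw h
  have : coef hθ n (u : L2) = c := by
    rw [hc, Submodule.coe_smul, map_smul, coef_herm_self, smul_eq_mul, mul_one]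
  rw [this, ← hc]

theorem eq_coefPred_smul_hermPred (n : ℕ) {u w : formDomain} (hw : (w : L2) = raiseOp θ u)
    (h : lowerOp θ w = (2 * n : ℂ) • (u : L2)) : u = coefPred hθ n (u : L2) • hermPred hθ n := by
  cases n with
  | zero =>
    rw [Nat.cast_zero, mul_zero, zero_smul] at h
    obtain ⟨c, hc⟩ := eq_smul_herm_zero hθ h
    have h1 := coef_raiseOp hθ 0 u
    rw [← hw, hc, Submodule.coe_smul, map_smul, coef_herm_self, coefPred_zero, smul_eq_mul,
      mul_one, zero_apply, mul_zero] at h1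
    rw [hc, h1, zero_smul, Submodule.coe_zero] at hw
    rw [hermPred_zero, smul_zero]
    exact eq_zero_of_raiseOp_eq_zero hθ hw.symm
  | succ n =>
    obtain ⟨y, hy, hy2⟩ := exists_lowerOp_eq_of_raiseOp hθ hw
    refine eq_coef_smul_herm hθ n hy ?_
    rw [hy2, h, ← sub_smul]
    congr 1
    push_cast; ring

end Ladder

/-! ### Growth of the norms of the rotated Hermite functions -/

/-- The inner product of two Schwartz functions in `L²(ℝ)`. -/
noncomputable def innerS (w v : 𝓢(ℝ, ℂ)) : ℂ := inner ℂ (w.toLp 2 : L2) (v.toLp 2 : L2)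

theorem innerS_eq (w v : 𝓢(ℝ, ℂ)) : innerS w v = ∫ x, conjS w x * v x := by
  rw [innerS, L2.inner_def]
  refine integral_congr_ae ?_
  filter_upwards [w.coeFn_toLp 2 volume, v.coeFn_toLp 2 volume] with x hw hv
  rw [hw, hv, RCLike.inner_apply, conjS_apply]
  ring

theorem toLp_add (w v : 𝓢(ℝ, ℂ)) : ((w + v).toLp 2 : L2) = (w.toLp 2 : L2) + (v.toLp 2 : L2) :=
  map_add (SchwartzMap.toLpCLM ℂ ℂ 2 volume) w v

theorem innerS_posS (w v : 𝓢(ℝ, ℂ)) : innerS (posS w) v = innerS w (posS v) := by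
  rw [innerS_eq, innerS_eq]
  refine integral_congr_ae (.of_forall fun x => ?_)
  simp only [conjS_apply, posS_apply, map_mul, Complex.conj_ofReal]
  ring

theorem innerS_deriv (w v : 𝓢(ℝ, ℂ)) :
    innerS (SchwartzMap.derivCLM ℂ ℂ w) v = -innerS w (SchwartzMap.derivCLM ℂ ℂ v) := by
  rw [innerS_eq, innerS_eq]
  have h := SchwartzMap.integral_mul_deriv_eq_neg_deriv_mul (conjS w) v
  have e : ∀ x, deriv (conjS w) x = starRingEnd ℂ (deriv w x) := fun x =>
    ((Complex.conjCLE : ℂ →L[ℝ] ℂ).hasFDerivAt.comp_hasDerivAt x (w.hasDerivAt x)).deriv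
  simp only [e] at h
  simp only [SchwartzMap.derivCLM_apply, conjS_apply] at h ⊢
  rw [h, neg_neg]

theorem lowerS_add_raiseS (θ : ℝ) (w : 𝓢(ℝ, ℂ)) :
    lowerS θ w + raiseS θ w = (2 * rot θ) • posS w := by
  rw [lowerS_apply, raiseS_apply]; module

theorem lowerS_sub_raiseS (θ : ℝ) (w : 𝓢(ℝ, ℂ)) :
    lowerS θ w - raiseS θ w = (2 * (rot θ)⁻¹) • SchwartzMap.derivCLM ℂ ℂ w := by
  rw [lowerS_apply, raiseS_apply]; module

theorem conj_rot (θ : ℝ) : starRingEnd ℂ (rot θ) = (rot θ)⁻¹ := by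
  rw [Complex.inv_def, Complex.normSq_eq_norm_sq, norm_rot]; simp

theorem innerS_add_right (w v v' : 𝓢(ℝ, ℂ)) : innerS w (v + v') = innerS w v + innerS w v' := by
  rw [innerS, toLp_add, inner_add_right]; rfl

theorem innerS_smul_right (c : ℂ) (w v : 𝓢(ℝ, ℂ)) : innerS w (c • v) = c * innerS w v := by
  rw [innerS, toLp_smul, inner_smul_right]; rfl

theorem innerS_add_left (w w' v : 𝓢(ℝ, ℂ)) : innerS (w + w') v = innerS w v + innerS w' v := by
  rw [innerS, toLp_add, inner_add_left]; rfl

theorem innerS_smul_left (c : ℂ) (w v : 𝓢(ℝ, ℂ)) :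
    innerS (c • w) v = starRingEnd ℂ c * innerS w v := by
  rw [innerS, toLp_smul, inner_smul_left]; rfl

theorem innerS_sub_left (w w' v : 𝓢(ℝ, ℂ)) : innerS (w - w') v = innerS w v - innerS w' v := by
  rw [sub_eq_add_neg, innerS_add_left, ← neg_one_smul ℂ, innerS_smul_left]; simp; ring

theorem innerS_sub_right (w v v' : 𝓢(ℝ, ℂ)) : innerS w (v - v') = innerS w v - innerS w v' := by
  rw [sub_eq_add_neg, innerS_add_right, ← neg_one_smul ℂ, innerS_smul_right]; ring

/-- Symmetry of the position operator in terms of the ladder operators. -/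
theorem innerS_lower_add_raise (θ : ℝ) (w v : 𝓢(ℝ, ℂ)) :
    rot θ ^ 2 * (innerS (lowerS θ w) v + innerS (raiseS θ w) v)
      = innerS w (lowerS θ v) + innerS w (raiseS θ v) := by
  have hz := rot_ne_zero θ
  rw [← innerS_add_left, ← innerS_add_right, lowerS_add_raiseS, lowerS_add_raiseS,
    innerS_smul_left, innerS_smul_right, innerS_posS, map_mul, conj_rot]
  simp only [map_ofNat]
  field_simp

/-- Antisymmetry of the derivative in terms of the ladder operators. -/
theorem innerS_lower_sub_raise (θ : ℝ) (w v : 𝓢(ℝ, ℂ)) :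
    innerS (lowerS θ w) v - innerS (raiseS θ w) v
      = -rot θ ^ 2 * (innerS w (lowerS θ v) - innerS w (raiseS θ v)) := by
  have hz := rot_ne_zero θ
  rw [← innerS_sub_left, ← innerS_sub_right, lowerS_sub_raiseS, lowerS_sub_raiseS,
    innerS_smul_left, innerS_smul_right, innerS_deriv, map_mul, map_inv₀, conj_rot]
  simp only [map_ofNat]
  field_simp

section Recursion

variable {θ : ℝ} (hθ : 0 < Real.cos θ)
include hθ

/-- The squared norm of the `n`-th rotated Hermite function. -/
noncomputable def hermSq (n : ℕ) : ℝ := ‖(herm hθ n : L2)‖ ^ 2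

/-- A weighted inner product of the rotated Hermite functions of index `n - 1` and `n + 1`. -/
noncomputable def hermCross (n : ℕ) : ℂ :=
  ladderCoeff n / ladderCoeff (n + 1) * innerS (rotHermitePred hθ n) (rotHermite hθ (n + 1))

theorem innerS_rotHermite_self (n : ℕ) :
    innerS (rotHermite hθ n) (rotHermite hθ n) = (hermSq hθ n : ℂ) := by
  rw [innerS, inner_self_eq_norm_sq_to_K, hermSq]
  simp [herm, toDomain]

omit hθ in
theorem conj_ladderCoeff (n : ℕ) : starRingEnd ℂ (ladderCoeff n) = ladderCoeff n :=
  Complex.conj_ofReal _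

/-- The two complex relations between neighbouring inner products that position and derivative
yield, solved for the quantities of higher index. -/
theorem hermSq_hermCross_recursion (n : ℕ) :
    (Real.cos θ : ℂ) * hermSq hθ (n + 1)
        = hermSq hθ n - Complex.I * Real.sin θ * hermCross hθ n ∧
      hermCross hθ (n + 1) = ((n + 1 : ℝ) / (n + 2 : ℝ) : ℝ) *
        (Real.cos θ * hermCross hθ n + Complex.I * Real.sin θ * hermSq hθ (n + 1)) := by
  have h1 := innerS_lower_add_raise θ (rotHermite hθ n) (rotHermite hθ (n + 1))
  have h2 := innerS_lower_sub_raise θ (rotHermite hθ n) (rotHermite hθ (n + 1))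
  have hp : rotHermitePred hθ (n + 1) = rotHermite hθ n := rfl
  simp only [lowerS_rotHermite, raiseS_rotHermite, innerS_smul_left, innerS_smul_right,
    conj_ladderCoeff, hp, innerS_rotHermite_self] at h1 h2
  have hW : rot θ ^ 2 = Real.cos θ + Real.sin θ * Complex.I := by
    rw [rot_sq, Complex.exp_mul_I, Complex.ofReal_cos, Complex.ofReal_sin]
  have hcs : (Real.cos θ : ℂ) ^ 2 + (Real.sin θ : ℂ) ^ 2 = 1 := by
    rw [← Complex.ofReal_pow, ← Complex.ofReal_pow, ← Complex.ofReal_add, Real.cos_sq_add_sin_sq,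
      Complex.ofReal_one]
  have hI := Complex.I_sq
  rw [hW] at h1 h2
  have hr := ladderCoeff_succ_ne_zero n
  have hR := ladderCoeff_succ_ne_zero (n + 1)
  have hr2 := ladderCoeff_sq (n + 1)
  have hR2 := ladderCoeff_sq (n + 1 + 1)
  have ht : hermCross hθ n * ladderCoeff (n + 1)
      = ladderCoeff n * innerS (rotHermitePred hθ n) (rotHermite hθ (n + 1)) := by
    rw [hermCross]; field_simp
  have ht' : hermCross hθ (n + 1) * ladderCoeff (n + 1 + 1)
      = ladderCoeff (n + 1) * innerS (rotHermite hθ n) (rotHermite hθ (n + 1 + 1)) := by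
    rw [hermCross]; field_simp; rfl
  rw [← ht] at h1 h2
  set r := ladderCoeff (n + 1)
  set R := ladderCoeff (n + 1 + 1)
  set p := innerS (rotHermite hθ n) (rotHermite hθ (n + 1 + 1))
  set t := hermCross hθ n
  set t' := hermCross hθ (n + 1)
  set c : ℂ := ((Real.cos θ : ℝ) : ℂ)
  set s : ℂ := ((Real.sin θ : ℝ) : ℂ)
  set q : ℂ := ((hermSq hθ n : ℝ) : ℂ)
  set q' : ℂ := ((hermSq hθ (n + 1) : ℝ) : ℂ)
  have e1 : c * q' = q - Complex.I * s * t := by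
    apply mul_left_cancel₀ hr
    linear_combination (1 / 2) * h1 - (1 / 2) * (c - s * Complex.I) * h2
      + (1 / 2 * r * q - 1 / 2 * R * p) * hcs + (1/2) * s^2 * (R * p - r * q) * hI
  have e2 : R * p = r * (c * t + Complex.I * s * q') := by
    linear_combination -(1 / 2) * h1 - (1 / 2) * (c - s * Complex.I) * h2
      + (1 / 2 * r * q - 1 / 2 * R * p) * hcs + (1/2) * s^2 * (R * p - r * q) * hI
  refine ⟨e1, ?_⟩
  have hn : ((n : ℂ) + 2) ≠ 0 := by exact_mod_cast (n + 1).succ_ne_zero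
  have hn1 : ((n : ℂ) + 1) ≠ 0 := by exact_mod_cast n.succ_ne_zero
  push_cast at hr2 hR2 ⊢
  apply mul_left_cancel₀ (mul_ne_zero hR hR)
  have e3 : R * R * t' = r * r * (c * t + Complex.I * s * q') := by
    linear_combination R * ht' + r * e2
  rw [e3, hr2, hR2]
  field_simp
  ring

theorem hermCross_zero : hermCross hθ 0 = 0 := by simp [hermCross, ladderCoeff_zero]

theorem hermSq_zero_pos : 0 < hermSq hθ 0 := by
  have h := coef_herm_self hθ 0
  have : (herm hθ 0 : L2) ≠ 0 := fun h0 => by simp [h0] at h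
  have := norm_pos_iff.2 this
  rw [hermSq]; positivity

end Recursion

/-- Exponential growth, up to a linear factor, for the recursion of `hermSq`. In the coordinates
`q ± t` the limiting recursion is diagonal with growth rate `(1 + |s|) / c`. -/
theorem growth_of_recursion {q t : ℕ → ℝ} {c s : ℝ} (hc : 0 < c) (hs : |s| < 1)
    (hcs : c ^ 2 + s ^ 2 = 1) (hq0 : 0 < q 0) (ht0 : t 0 = 0)
    (hq : ∀ n, c * q (n + 1) = q n + s * t n)
    (ht : ∀ n : ℕ, t (n + 1) = (n + 1) / (n + 2) * (c * t n + s * q (n + 1))) (n : ℕ) :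
    q 0 * ((1 + |s|) / c) ^ n / (2 * (n + 1)) ≤ q n ∧ q n ≤ q 0 * ((1 + |s|) / c) ^ n := by
  obtain ⟨e, he, hes⟩ : ∃ e : ℝ, e * e = 1 ∧ s = e * |s| := by
    rcases le_total 0 s with h | h
    · exact ⟨1, by norm_num, by rw [abs_of_nonneg h, one_mul]⟩
    · exact ⟨-1, by norm_num, by rw [abs_of_nonpos h]; ring⟩
  have ha0 := abs_nonneg s
  have ha2 := sq_abs s
  set a := |s| with ha
  set ρ := (1 + a) / c with hρ
  have hρc : ρ * c = 1 + a := by rw [hρ]; field_simp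
  have hρ0 : 0 < ρ := by rw [hρ]; positivity
  have key : 0 ≤ e * t n ∧ e * t n ≤ q n ∧ 0 < q n ∧ q n + e * t n ≤ q 0 * ρ ^ n ∧
      q 0 * ρ ^ n ≤ (n + 1) * (q n + e * t n) := by
    induction n with
    | zero => simp [ht0, hq0, hq0.le]
    | succ n ih =>
      obtain ⟨h1, h2, h3, h4, h5⟩ := ih
      set y := e * t n with hy
      have q1 : c * q (n + 1) = q n + a * y := by rw [hq, hy]; linear_combination t n * hes
      have n0 : (0 : ℝ) ≤ n := n.cast_nonneg
      set μ : ℝ := (n + 1) / (n + 2) with hμ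
      have hμ0 : 0 < μ := by rw [hμ]; positivity
      have hμ1 : μ ≤ 1 := by rw [hμ, div_le_one (by positivity)]; linarith
      have hμn : (n + 2) * μ = n + 1 := by rw [hμ]; field_simp
      have y1 : c * (e * t (n + 1)) = μ * (y + a * q n) := by
        have h6 : e * t (n + 1) = μ * (c * y + a * q (n + 1)) := by
          rw [ht, hy]; linear_combination e * μ * q (n + 1) * hes + μ * a * q (n + 1) * he
        rw [h6]
        linear_combination μ * a * q1 + μ * y * hcs + μ * y * ha2
      set y' := e * t (n + 1) with hy'
      have hq1 : 0 < q (n + 1) := by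
        have : 0 < c * q (n + 1) := by rw [q1]; positivity
        exact (pos_iff_pos_of_mul_pos this).1 hc
      have hsum : 0 ≤ y + a * q n := by positivity
      refine ⟨?_, ?_, hq1, ?_, ?_⟩
      · have : 0 ≤ c * y' := by rw [y1]; positivity
        exact nonneg_of_mul_nonneg_right this hc
      · refine le_of_mul_le_mul_left ?_ hc
        rw [y1, q1]
        nlinarith [mul_nonneg (sub_nonneg.2 hs.le) (sub_nonneg.2 h2),
          mul_nonneg (sub_nonneg.2 hμ1) hsum]
      · refine le_of_mul_le_mul_left ?_ hc
        calc c * (q (n + 1) + y') = (q n + a * y) + μ * (y + a * q n) := by rw [mul_add, q1, y1]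
          _ ≤ (q n + a * y) + 1 * (y + a * q n) := by gcongr
          _ = (1 + a) * (q n + y) := by ring
          _ ≤ (1 + a) * (q 0 * ρ ^ n) := by gcongr
          _ = c * (q 0 * ρ ^ (n + 1)) := by rw [← hρc]; ring
      · refine le_of_mul_le_mul_left ?_ hc
        have hb : 0 ≤ q n + a * y := by positivity
        calc c * (q 0 * ρ ^ (n + 1)) = (1 + a) * (q 0 * ρ ^ n) := by rw [← hρc]; ring
          _ ≤ (1 + a) * ((n + 1) * (q n + y)) := by gcongr
          _ = (n + 1) * (q n + a * y) + (n + 1) * (y + a * q n) := by ring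
          _ ≤ (n + 2) * (q n + a * y) + (n + 1) * (y + a * q n) := by
              gcongr
              norm_num
          _ = (n + 2) * (q n + a * y) + ((n + 2) * μ) * (y + a * q n) := by rw [hμn]
          _ = (n + 2) * (c * q (n + 1) + c * y') := by rw [q1, y1]; ring
          _ = c * (((n + 1 : ℕ) + 1) * (q (n + 1) + y')) := by push_cast; ring
  obtain ⟨h1, h2, h3, h4, h5⟩ := key
  refine ⟨?_, by linarith⟩
  have n0 : (0 : ℝ) ≤ n := n.cast_nonneg
  rw [div_le_iff₀ (by positivity)]
  nlinarith

/-- The growth rate `(1 + |sin θ|) / cos θ`. -/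
noncomputable def growthRate (θ : ℝ) : ℝ := (1 + |Real.sin θ|) / Real.cos θ

theorem abs_sin_lt_one {θ : ℝ} (hθ : 0 < Real.cos θ) : |Real.sin θ| < 1 := by
  rw [← sq_lt_one_iff_abs_lt_one]
  nlinarith [Real.sin_sq_add_cos_sq θ]

theorem growthRate_eq {θ : ℝ} (hθ : 0 < Real.cos θ) :
    growthRate θ = √((1 + |Real.sin θ|) / (1 - |Real.sin θ|)) := by
  have h1 := abs_sin_lt_one hθ
  have h2 := abs_nonneg (Real.sin θ)
  have h3 : (1 - |Real.sin θ|) ≠ 0 := by linarith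
  rw [eq_comm, Real.sqrt_eq_iff_mul_self_eq_of_pos (by rw [growthRate]; positivity), growthRate,
    div_mul_div_comm, div_eq_div_iff (by positivity) h3]
  linear_combination -(1 + |Real.sin θ|) * Real.sin_sq_add_cos_sq θ
    - (1 + |Real.sin θ|) * sq_abs (Real.sin θ)

theorem growthRate_pos {θ : ℝ} (hθ : 0 < Real.cos θ) : 0 < growthRate θ := by
  rw [growthRate]; positivity

theorem one_lt_growthRate {θ : ℝ} (hθ : 0 < Real.cos θ) (hs : Real.sin θ ≠ 0) :
    1 < growthRate θ := by
  rw [growthRate, one_lt_div hθ]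
  linarith [Real.cos_le_one θ, abs_pos.2 hs]

theorem hermSq_bounds {θ : ℝ} (hθ : 0 < Real.cos θ) (n : ℕ) :
    hermSq hθ 0 * growthRate θ ^ n / (2 * (n + 1)) ≤ hermSq hθ n ∧
      hermSq hθ n ≤ hermSq hθ 0 * growthRate θ ^ n := by
  refine growth_of_recursion (q := hermSq hθ) (t := fun n => (hermCross hθ n).im) hθ
    (abs_sin_lt_one hθ) (Real.cos_sq_add_sin_sq θ) (hermSq_zero_pos hθ)
    (by simp [hermCross_zero]) (fun n => ?_) (fun n => ?_) n
  · have := congrArg Complex.re (hermSq_hermCross_recursion hθ n).1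
    simpa [-Complex.ofReal_cos, -Complex.ofReal_sin] using this
  · have := congrArg Complex.im (hermSq_hermCross_recursion hθ n).2
    rw [Complex.im_ofReal_mul] at this
    rw [this]
    simp [-Complex.ofReal_cos, -Complex.ofReal_sin]

/-- A positive sequence comparable to `ρⁿ` up to a linear factor has exponential rate `log ρ`. -/
theorem tendsto_log_div {N : ℕ → ℝ} {A B ρ : ℝ} (hA : 0 < A) (hρ : 0 < ρ)
    (hl : ∀ n : ℕ, 1 ≤ n → A * ρ ^ n / (n + 1) ≤ N n) (hu : ∀ n : ℕ, 1 ≤ n → N n ≤ B * ρ ^ n) :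
    Tendsto (fun n : ℕ => Real.log (N n) / n) atTop (𝓝 (Real.log ρ)) := by
  have hB : 0 < B := by
    have := (hl 1 le_rfl).trans (hu 1 le_rfl)
    have h2 : 0 < A * ρ ^ 1 / ((1 : ℕ) + 1) := by positivity
    exact pos_of_mul_pos_left (h2.trans_le this) (by positivity)
  have t0 : Tendsto (fun n : ℕ => (n : ℝ)) atTop atTop := tendsto_natCast_atTop_atTop
  have t1 : Tendsto (fun n : ℕ => Real.log B / n + Real.log ρ) atTop (𝓝 (Real.log ρ)) := by
    simpa using (tendsto_const_nhds.div_atTop t0).add_const (Real.log ρ)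
  have t2 : Tendsto (fun n : ℕ => Real.log A / n - Real.log (n + 1) / n + Real.log ρ) atTop
      (𝓝 (Real.log ρ)) := by
    have h1 : Tendsto (fun n : ℕ => Real.log ((n : ℝ) + 1) / n) atTop (𝓝 0) := by
      have h2 : Tendsto (fun n : ℕ => Real.log ((n : ℝ) + 1) / ((n : ℝ) + 1)) atTop (𝓝 0) := by
        have := Real.isLittleO_log_id_atTop.tendsto_div_nhds_zero
        exact this.comp (tendsto_atTop_add_const_right _ 1 t0)
      have h3 : Tendsto (fun n : ℕ => 1 + 1 / (n : ℝ)) atTop (𝓝 (1 + 0)) :=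
        tendsto_const_nhds.add tendsto_one_div_atTop_nhds_zero_nat
      have h4 := h2.mul h3
      rw [zero_mul] at h4
      refine h4.congr' ?_
      filter_upwards [eventually_ge_atTop 1] with n hn
      have : (0 : ℝ) < n := by exact_mod_cast hn
      field_simp
    simpa using ((tendsto_const_nhds.div_atTop t0).sub h1).add_const (Real.log ρ)
  refine tendsto_of_tendsto_of_tendsto_of_le_of_le' t2 t1 ?_ ?_
  · filter_upwards [eventually_ge_atTop 1] with n hn
    have hn0 : (0 : ℝ) < n := by exact_mod_cast hn
    have h := Real.log_le_log (by positivity) (hl n hn)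
    rw [Real.log_div (by positivity) (by positivity), Real.log_mul hA.ne' (by positivity),
      Real.log_pow] at h
    rw [le_div_iff₀ hn0]
    refine le_of_eq_of_le ?_ h
    field_simp
    ring
  · filter_upwards [eventually_ge_atTop 1] with n hn
    have hn0 : (0 : ℝ) < n := by exact_mod_cast hn
    have hN : 0 < N n := lt_of_lt_of_le (by positivity) (hl n hn)
    have h := Real.log_le_log hN (hu n hn)
    rw [Real.log_mul hB.ne' (by positivity), Real.log_pow] at h
    rw [div_le_iff₀ hn0]
    refine h.trans_eq ?_
    field_simp

/-! ### Spectral projectors from the square of an operator -/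

section Abstract

variable {E : Type*} [NormedAddCommGroup E] [NormedSpace ℂ E]

theorem mem_eigenspace_iff {T : E →ₗ.[ℂ] E} {μ : ℂ} {x : E} :
    x ∈ eigenspace T μ ↔ ∃ y : T.domain, (y : E) = x ∧ T y = μ • (y : E) := by
  constructor
  · rintro ⟨y, hy, rfl⟩
    refine ⟨y, rfl, ?_⟩
    have hy' : T y - μ • (y : E) = 0 := hy
    exact sub_eq_zero.1 hy'
  · rintro ⟨y, rfl, hy⟩
    refine ⟨y, ?_, rfl⟩
    change T y - μ • (y : E) = 0
    rw [hy, sub_self]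

theorem mem_shiftedRange_iff {T : E →ₗ.[ℂ] E} {μ : ℂ} {x : E} :
    x ∈ shiftedRange T μ ↔ ∃ y : T.domain, T y - μ • (y : E) = x := Iff.rfl

/-- The operator `T` acts on the range of the projection `Q` as `R`, where it squares to `ν`, and
the complementary part of `T² - ν` is bijective: this is the spectral situation of `T²` at `ν`. -/
structure IsSquareReducing (T : E →ₗ.[ℂ] E) (ν : ℂ) (Q R : E →L[ℂ] E) : Prop where
  idem : ∀ x, Q (Q x) = Q x
  apply_proj : ∀ x, ∃ y : T.domain, (y : E) = Q x ∧ T y = R x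
  apply_image : ∀ x, ∃ y : T.domain, (y : E) = R x ∧ T y = ν • Q x
  proj_apply : ∀ y : T.domain, Q (T y) = R y
  image_apply : ∀ y : T.domain, R (T y) = ν • Q y
  solve : ∀ x, Q x = 0 → ∃ y z : T.domain, (z : E) = T y ∧ T z - ν • (y : E) = x
  simple : ∀ y z : T.domain, (z : E) = T y → T z = ν • (y : E) → Q y = y

/-- If `T²` has the spectral projection `Q` at `μ² ≠ 0`, then `(1 + T / μ) Q / 2` is the spectral
projector of `T` at `μ`. -/
theorem IsSquareReducing.isSpectralProjector {T : E →ₗ.[ℂ] E} {ν μ : ℂ} {Q R : E →L[ℂ] E}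
    (h : IsSquareReducing T ν Q R) (hμ : μ ≠ 0) (hν : μ * μ = ν)
    (h0 : ∃ x, ((2 : ℂ)⁻¹ • (Q + μ⁻¹ • R)) x ≠ 0) :
    IsSpectralProjector T μ ((2 : ℂ)⁻¹ • (Q + μ⁻¹ • R)) := by
  set P := (2 : ℂ)⁻¹ • (Q + μ⁻¹ • R) with hP
  have hPx : ∀ x, P x = (2 : ℂ)⁻¹ • (Q x + μ⁻¹ • R x) := fun x => rfl
  have hran : ∀ x, P x ∈ eigenspace T μ := by
    intro x
    obtain ⟨y, hy, hTy⟩ := h.apply_proj x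
    obtain ⟨z, hz, hTz⟩ := h.apply_image x
    refine mem_eigenspace_iff.2 ⟨(2 : ℂ)⁻¹ • (y + μ⁻¹ • z), ?_, ?_⟩
    · rw [hPx, ← hy, ← hz]; rfl
    · rw [T.map_smul, T.map_add, T.map_smul, hTy, hTz, Submodule.coe_smul, Submodule.coe_add,
        Submodule.coe_smul, hy, hz, ← hν, smul_smul, inv_mul_cancel_left₀ hμ, smul_comm μ,
        smul_add μ, smul_smul μ μ⁻¹, mul_inv_cancel₀ hμ, one_smul, add_comm]
  have hfix : ∀ x ∈ eigenspace T μ, P x = x := by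
    intro x hx
    obtain ⟨y, rfl, hy⟩ := mem_eigenspace_iff.1 hx
    have hQ : Q y = y := by
      refine h.simple y (μ • y) (by rw [Submodule.coe_smul, hy]) ?_
      rw [T.map_smul, hy, smul_smul, hν]
    have hR : R y = μ • (y : E) := by rw [← h.proj_apply, hy, map_smul, hQ]
    rw [hPx, hQ, hR, smul_smul, inv_mul_cancel₀ hμ, one_smul, ← two_smul ℂ, smul_smul,
      inv_mul_cancel₀ two_ne_zero, one_smul]
  refine ⟨?_, fun x => hfix _ (hran x), ?_, ?_⟩
  · obtain ⟨x, hx⟩ := h0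
    intro hbot
    have := hran x
    rw [hbot, Submodule.mem_bot] at this
    exact hx this
  · apply le_antisymm
    · rintro _ ⟨x, rfl⟩; exact hran x
    · intro x hx; exact ⟨x, hfix x hx⟩
  · apply le_antisymm
    · intro x hx
      have hx' : Q x + μ⁻¹ • R x = 0 :=
        (smul_eq_zero.1 (hx : (2 : ℂ)⁻¹ • (Q x + μ⁻¹ • R x) = 0)).resolve_left
          (inv_ne_zero two_ne_zero)
      have hR : R x = -(μ • Q x) := by
        have : μ • (Q x + μ⁻¹ • R x) = 0 := by rw [hx', smul_zero]
        rw [smul_add, smul_smul, mul_inv_cancel₀ hμ, one_smul] at this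
        exact eq_neg_of_add_eq_zero_right this
      obtain ⟨y, z, hz, hyz⟩ := h.solve (x - Q x) (by rw [map_sub, h.idem, sub_self])
      obtain ⟨w, hw, hTw⟩ := h.apply_proj x
      -- On the complement `T - μ` is inverted with the help of the factor `T + μ`; on the range
      -- of `Q` it acts on `x` as `-2μ`.
      refine mem_shiftedRange_iff.2 ⟨z + μ • y - (2 * μ)⁻¹ • w, ?_⟩
      rw [T.map_sub, T.map_add, T.map_smul, T.map_smul, Submodule.coe_sub, Submodule.coe_add,
        Submodule.coe_smul, Submodule.coe_smul, hTw, hR, hw, hz]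
      have e : (2 * μ)⁻¹ * μ = 2⁻¹ := by field_simp
      calc T z + μ • T y - (2 * μ)⁻¹ • -(μ • Q x) - μ • (T y + μ • (y : E) - (2 * μ)⁻¹ • Q x)
          = (T z - (μ * μ) • (y : E)) + (2 * ((2 * μ)⁻¹ * μ)) • Q x := by module
        _ = x := by
          rw [hν, hyz, e, mul_inv_cancel₀ two_ne_zero, one_smul, sub_add_cancel]
    · rintro _ ⟨y, rfl⟩
      change P (T y - μ • (y : E)) = 0
      rw [hPx, map_sub, map_sub, map_smul, map_smul, h.proj_apply, h.image_apply, ← hν, smul_sub,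
        smul_smul, smul_smul, inv_mul_cancel_left₀ hμ, inv_mul_cancel₀ hμ, one_smul]
      simp

/-- The same at the eigenvalue `0`, provided that `T` vanishes on the range of `Q`. -/
theorem IsSquareReducing.isSpectralProjector_zero {T : E →ₗ.[ℂ] E} {Q : E →L[ℂ] E}
    (h : IsSquareReducing T 0 Q 0) (h0 : ∃ x, Q x ≠ 0) : IsSpectralProjector T 0 Q := by
  have hran : ∀ x, Q x ∈ eigenspace T 0 := by
    intro x
    obtain ⟨y, hy, hTy⟩ := h.apply_proj x
    exact mem_eigenspace_iff.2 ⟨y, hy, by rw [hTy, zero_smul]; rfl⟩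
  refine ⟨?_, h.idem, ?_, ?_⟩
  · obtain ⟨x, hx⟩ := h0
    intro hbot
    have := hran x
    rw [hbot, Submodule.mem_bot] at this
    exact hx this
  · apply le_antisymm
    · rintro _ ⟨x, rfl⟩; exact hran x
    · intro x hx
      obtain ⟨y, rfl, hy⟩ := mem_eigenspace_iff.1 hx
      rw [zero_smul] at hy
      exact ⟨y, h.simple y 0 (by rw [hy]; rfl) (by rw [T.map_zero, zero_smul])⟩
  · apply le_antisymm
    · intro x hx
      obtain ⟨y, z, -, hyz⟩ := h.solve x hx
      rw [zero_smul, sub_zero] at hyz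
      exact mem_shiftedRange_iff.2 ⟨z, by rw [zero_smul, sub_zero, hyz]⟩
    · rintro _ ⟨y, rfl⟩
      change Q (T y - (0 : ℂ) • (y : E)) = 0
      rw [zero_smul, sub_zero, h.proj_apply]; rfl

end Abstract

/-! ### Reduction of the Dirac operator to the ladder operators -/

/-- The spinor with given components in the domain. -/
noncomputable def spin {θ m : ℝ} (u : Fin 4 → formDomain) : (diracOp θ m).domain :=
  ⟨WithLp.toLp 2 fun j => (u j : L2), fun j => (u j).2⟩

theorem exists_eq_spin {θ m : ℝ} (y : (diracOp θ m).domain) :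
    ∃ u : Fin 4 → formDomain, y = spin u :=
  ⟨fun j => ⟨(y : Spinor) j, y.2 j⟩, rfl⟩

theorem coe_spin {θ m : ℝ} (u : Fin 4 → formDomain) (j : Fin 4) :
    ((spin u : (diracOp θ m).domain) : Spinor) j = u j := rfl

theorem diracOp_spin (θ m : ℝ) (u : Fin 4 → formDomain) :
    diracOp θ m (spin u) = WithLp.toLp 2
      ![Complex.I • raiseOp θ (u 3) + (m : ℂ) • (u 2 : L2),
        -(Complex.I • lowerOp θ (u 2)) - (m : ℂ) • (u 3 : L2),
        Complex.I • raiseOp θ (u 1) + (m : ℂ) • (u 0 : L2),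
        -(Complex.I • lowerOp θ (u 0)) - (m : ℂ) • (u 1 : L2)] := by
  have h : diracOp θ m (spin u) = WithLp.toLp 2 fun i => ∑ j : Fin 4,
        ((-Complex.I * alpha1 i j * Complex.exp (-(Complex.I * θ / 2))) • dX (u j)
          - (alpha2 i j * Complex.exp (Complex.I * θ / 2)) • xX (u j)
          + ((m : ℂ) * alpha3 i j) • (u j : L2)) := rfl
  rw [h]
  congr 1
  have e1 : Complex.exp (-(Complex.I * θ / 2)) = (rot θ)⁻¹ := by rw [Complex.exp_neg]; rfl
  have e2 : Complex.exp (Complex.I * θ / 2) = rot θ := rfl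
  simp only [e1, e2, raiseOp_apply, lowerOp_apply, Fin.sum_univ_four]
  funext i
  fin_cases i <;> simp [alpha1, alpha2, alpha3] <;> module

section Blocks

variable {θ : ℝ} (hθ : 0 < Real.cos θ) (m : ℝ) (n : ℕ)

/-- The basis vectors, by component, of the space `ker (H² - 2n - m²)`. -/
noncomputable def blockVec : Fin 4 → formDomain :=
  ![herm hθ n, hermPred hθ n, herm hθ n, hermPred hθ n]

/-- The coefficient functionals belonging to `blockVec`. -/
noncomputable def blockCoef : Fin 4 → L2 →L[ℂ] ℂ :=
  ![coef hθ n, coefPred hθ n, coef hθ n, coefPred hθ n]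

/-- The coordinates of a spinor with respect to `blockVec`. -/
noncomputable def coords (Ψ : Spinor) : Fin 4 → ℂ := fun j => blockCoef hθ n j (Ψ j)

/-- The spinor in the domain with given coordinates with respect to `blockVec`. -/
noncomputable def ofCoords : (Fin 4 → ℂ) → Fin 4 → formDomain := fun c j => c j • blockVec hθ n j

/-- The matrix of the Dirac operator on `ker (H² - 2n - m²)` with respect to `blockVec`. -/
noncomputable def diracMatrix : Matrix (Fin 4) (Fin 4) ℂ :=
  !![0, 0, m, Complex.I * ladderCoeff n;
    0, 0, -(Complex.I * ladderCoeff n), -m;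
    m, Complex.I * ladderCoeff n, 0, 0;
    -(Complex.I * ladderCoeff n), -m, 0, 0]

theorem diracMatrix_mulVec (c : Fin 4 → ℂ) : (diracMatrix m n).mulVec c =
    ![m * c 2 + Complex.I * ladderCoeff n * c 3, -(Complex.I * ladderCoeff n) * c 2 - m * c 3,
      m * c 0 + Complex.I * ladderCoeff n * c 1, -(Complex.I * ladderCoeff n) * c 0 - m * c 1] := by
  funext i
  fin_cases i <;> simp [diracMatrix, Matrix.mulVec, dotProduct, Fin.sum_univ_four] <;> ring

theorem diracMatrix_mulVec_mulVec (c : Fin 4 → ℂ) :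
    (diracMatrix m n).mulVec ((diracMatrix m n).mulVec c) = (2 * n + (m : ℂ) ^ 2) • c := by
  have h := ladderCoeff_sq n
  have hI := Complex.I_mul_I
  rw [diracMatrix_mulVec, diracMatrix_mulVec]
  funext i
  fin_cases i <;> simp
  · linear_combination c 0 * h - c 0 * ladderCoeff n * ladderCoeff n * hI
  · linear_combination c 1 * h - c 1 * ladderCoeff n * ladderCoeff n * hI
  · linear_combination c 2 * h - c 2 * ladderCoeff n * ladderCoeff n * hI
  · linear_combination c 3 * h - c 3 * ladderCoeff n * ladderCoeff n * hI

theorem diracOp_ofCoords (c : Fin 4 → ℂ) :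
    diracOp θ m (spin (ofCoords hθ n c))
      = (spin (ofCoords hθ n ((diracMatrix m n).mulVec c)) : (diracOp θ m).domain) := by
  rw [diracOp_spin, diracMatrix_mulVec]
  ext1 i
  rw [coe_spin]
  fin_cases i <;>
  simp [ofCoords, blockVec, raiseOp_hermPred, lowerOp_herm, smul_smul] <;> module

theorem coords_diracOp (u : Fin 4 → formDomain) :
    coords hθ n (diracOp θ m (spin u)) = (diracMatrix m n).mulVec
      (coords hθ n (spin u : (diracOp θ m).domain)) := by
  rw [diracOp_spin, diracMatrix_mulVec]
  funext i
  fin_cases i <;>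
  simp [coords, blockCoef, coe_spin, coef_raiseOp, coefPred_lowerOp] <;> ring

theorem coords_ofCoords_coords (Ψ : Spinor) :
    coords hθ n (spin (ofCoords hθ n (coords hθ n Ψ)) : (diracOp θ m).domain)
      = coords hθ n Ψ := by
  have h1 := coef_herm_self hθ n
  have h2 : ∀ f, coefPred hθ n f * coefPred hθ n (hermPred hθ n) = coefPred hθ n f := by
    cases n with
    | zero => simp [coefPred_zero]
    | succ n =>
      intro f
      have : coefPred hθ (n + 1) (hermPred hθ (n + 1)) = 1 := coef_herm_self hθ n
      rw [this, mul_one]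
  funext i
  fin_cases i <;> simp [coords, ofCoords, blockVec, blockCoef, coe_spin, h1, h2]

/-- The bounded operator given by the matrix `B` with respect to `blockVec` after the projection
defined by the coefficient functionals. -/
noncomputable def blockOp (B : Matrix (Fin 4) (Fin 4) ℂ) : Spinor →L[ℂ] Spinor :=
  ((PiLp.continuousLinearEquiv 2 ℂ (fun _ : Fin 4 => L2)).symm : (Fin 4 → L2) →L[ℂ] Spinor) ∘L
    ContinuousLinearMap.pi fun i => ∑ j, B i j •
      ((blockCoef hθ n j) ∘L (PiLp.proj 2 (fun _ : Fin 4 => L2) j)).smulRight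
        (blockVec hθ n i : L2)

theorem blockOp_apply (B : Matrix (Fin 4) (Fin 4) ℂ) (Ψ : Spinor) :
    blockOp hθ n B Ψ
      = (spin (ofCoords hθ n (B.mulVec (coords hθ n Ψ))) : (diracOp θ m).domain) := by
  ext1 i
  rw [coe_spin]
  simp only [blockOp, ofCoords, coords, Matrix.mulVec, dotProduct, Finset.sum_smul]
  simp [smul_smul]

theorem ofCoords_smul (a : ℂ) (c : Fin 4 → ℂ) :
    ((spin (ofCoords hθ n (a • c)) : (diracOp θ m).domain) : Spinor)
      = a • ((spin (ofCoords hθ n c) : (diracOp θ m).domain) : Spinor) := by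
  ext1 i
  rw [PiLp.smul_apply, coe_spin, coe_spin]
  simp [ofCoords, smul_smul]

theorem isSquareReducing_diracOp :
    IsSquareReducing (diracOp θ m) (2 * n + (m : ℂ) ^ 2) (blockOp hθ n 1)
      (blockOp hθ n (diracMatrix m n)) where
  idem x := by
    simp only [blockOp_apply hθ m, Matrix.one_mulVec, coords_ofCoords_coords]
  apply_proj x := by
    refine ⟨_, (blockOp_apply hθ m n 1 x).symm, ?_⟩
    rw [diracOp_ofCoords, Matrix.one_mulVec, blockOp_apply hθ m]
  apply_image x := by
    refine ⟨_, (blockOp_apply hθ m n _ x).symm, ?_⟩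
    rw [diracOp_ofCoords, diracMatrix_mulVec_mulVec, ofCoords_smul, blockOp_apply hθ m,
      Matrix.one_mulVec]
  proj_apply y := by
    obtain ⟨u, rfl⟩ := exists_eq_spin y
    rw [blockOp_apply hθ m, blockOp_apply hθ m, coords_diracOp, Matrix.one_mulVec]
  image_apply y := by
    obtain ⟨u, rfl⟩ := exists_eq_spin y
    rw [blockOp_apply hθ m, blockOp_apply hθ m, coords_diracOp, diracMatrix_mulVec_mulVec,
      ofCoords_smul, Matrix.one_mulVec]
  solve x hx := by
    have hc : coords hθ n x = 0 := by
      rw [← coords_ofCoords_coords hθ m, ← Matrix.one_mulVec (coords hθ n x),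
        ← blockOp_apply hθ m n 1 x, hx]
      funext j
      simp [coords]
    obtain ⟨u0, w0, h0, e0⟩ := exists_raise_lower_sub_eq hθ n (f := x 0) (congrFun hc 0)
    obtain ⟨u1, w1, h1, e1⟩ := exists_lower_raise_sub_eq hθ n (f := x 1) (congrFun hc 1)
    obtain ⟨u2, w2, h2, e2⟩ := exists_raise_lower_sub_eq hθ n (f := x 2) (congrFun hc 2)
    obtain ⟨u3, w3, h3, e3⟩ := exists_lower_raise_sub_eq hθ n (f := x 3) (congrFun hc 3)
    have hI : ∀ v : L2, Complex.I • Complex.I • v = -v := fun v => by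
      rw [smul_smul, Complex.I_mul_I, neg_one_smul]
    refine ⟨spin ![u0, u1, u2, u3], spin ![Complex.I • w3 + (m : ℂ) • u2,
      -(Complex.I • w2) - (m : ℂ) • u3, Complex.I • w1 + (m : ℂ) • u0,
      -(Complex.I • w0) - (m : ℂ) • u1], ?_, ?_⟩
    · rw [diracOp_spin]
      ext1 i
      rw [coe_spin]
      fin_cases i <;> simp [h0, h1, h2, h3, -Complex.coe_smul]
    · rw [diracOp_spin]
      ext1 i
      rw [PiLp.sub_apply, PiLp.smul_apply, coe_spin]
      fin_cases i
      · simp [smul_sub, hI, ← h0, ← h1, ← e0, -Complex.coe_smul]; module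
      · simp [smul_sub, hI, ← h0, ← h1, ← e1, -Complex.coe_smul]; module
      · simp [smul_sub, hI, ← h2, ← h3, ← e2, -Complex.coe_smul]; module
      · simp [smul_sub, hI, ← h2, ← h3, ← e3, -Complex.coe_smul]; module
  simple y z hz h := by
    obtain ⟨u, rfl⟩ := exists_eq_spin y
    obtain ⟨v, rfl⟩ := exists_eq_spin z
    have hI : ∀ v : L2, Complex.I • Complex.I • v = -v := fun v => by
      rw [smul_smul, Complex.I_mul_I, neg_one_smul]
    rw [diracOp_spin] at hz h
    have z0 : (v 0 : L2) = Complex.I • raiseOp θ (u 3) + (m : ℂ) • (u 2 : L2) :=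
      congrArg (fun Φ : Spinor => Φ 0) hz
    have z1 : (v 1 : L2) = -(Complex.I • lowerOp θ (u 2)) - (m : ℂ) • (u 3 : L2) :=
      congrArg (fun Φ : Spinor => Φ 1) hz
    have z2 : (v 2 : L2) = Complex.I • raiseOp θ (u 1) + (m : ℂ) • (u 0 : L2) :=
      congrArg (fun Φ : Spinor => Φ 2) hz
    have z3 : (v 3 : L2) = -(Complex.I • lowerOp θ (u 0)) - (m : ℂ) • (u 1 : L2) :=
      congrArg (fun Φ : Spinor => Φ 3) hz
    have y0 : Complex.I • raiseOp θ (v 3) + (m : ℂ) • (v 2 : L2)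
        = (2 * n + (m : ℂ) ^ 2) • (u 0 : L2) := congrArg (fun Φ : Spinor => Φ 0) h
    have y1 : -(Complex.I • lowerOp θ (v 2)) - (m : ℂ) • (v 3 : L2)
        = (2 * n + (m : ℂ) ^ 2) • (u 1 : L2) := congrArg (fun Φ : Spinor => Φ 1) h
    have y2 : Complex.I • raiseOp θ (v 1) + (m : ℂ) • (v 0 : L2)
        = (2 * n + (m : ℂ) ^ 2) • (u 2 : L2) := congrArg (fun Φ : Spinor => Φ 2) h
    have y3 : -(Complex.I • lowerOp θ (v 0)) - (m : ℂ) • (v 1 : L2)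
        = (2 * n + (m : ℂ) ^ 2) • (u 3 : L2) := congrArg (fun Φ : Spinor => Φ 3) h
    have w0 : ((Complex.I • (v 3 + (m : ℂ) • u 1) : formDomain) : L2) = lowerOp θ (u 0) := by
      rw [Submodule.coe_smul, Submodule.coe_add, Submodule.coe_smul, z3, sub_add_cancel, smul_neg,
        hI, neg_neg]
    have w2 : ((Complex.I • (v 1 + (m : ℂ) • u 3) : formDomain) : L2) = lowerOp θ (u 2) := by
      rw [Submodule.coe_smul, Submodule.coe_add, Submodule.coe_smul, z1, sub_add_cancel, smul_neg,
        hI, neg_neg]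
    have w1 : ((-(Complex.I • (v 2 - (m : ℂ) • u 0)) : formDomain) : L2) = raiseOp θ (u 1) := by
      rw [Submodule.coe_neg, Submodule.coe_smul, Submodule.coe_sub, Submodule.coe_smul, z2,
        add_sub_cancel_right, hI, neg_neg]
    have w3 : ((-(Complex.I • (v 0 - (m : ℂ) • u 2)) : formDomain) : L2) = raiseOp θ (u 3) := by
      rw [Submodule.coe_neg, Submodule.coe_smul, Submodule.coe_sub, Submodule.coe_smul, z0,
        add_sub_cancel_right, hI, neg_neg]
    have f0 := eq_coef_smul_herm hθ n w0 (by
      rw [map_smul, map_add, map_smul, ← w1]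
      simp only [Submodule.coe_neg, Submodule.coe_smul, Submodule.coe_sub, smul_add, smul_neg,
        smul_sub, smul_comm Complex.I (m : ℂ), hI]
      rw [eq_sub_of_add_eq y0]
      module)
    have f2 := eq_coef_smul_herm hθ n w2 (by
      rw [map_smul, map_add, map_smul, ← w3]
      simp only [Submodule.coe_neg, Submodule.coe_smul, Submodule.coe_sub, smul_add, smul_neg,
        smul_sub, smul_comm Complex.I (m : ℂ), hI]
      rw [eq_sub_of_add_eq y2]
      module)
    have f1 := eq_coefPred_smul_hermPred hθ n w1 (by
      rw [map_neg, map_smul, map_sub, map_smul, ← w0]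
      simp only [Submodule.coe_smul, Submodule.coe_add, smul_add, smul_sub,
        smul_comm Complex.I (m : ℂ), hI]
      rw [neg_sub, sub_eq_add_neg, eq_add_of_sub_eq y1]
      module)
    have f3 := eq_coefPred_smul_hermPred hθ n w3 (by
      rw [map_neg, map_smul, map_sub, map_smul, ← w2]
      simp only [Submodule.coe_smul, Submodule.coe_add, smul_add, smul_sub,
        smul_comm Complex.I (m : ℂ), hI]
      rw [neg_sub, sub_eq_add_neg, eq_add_of_sub_eq y3]
      module)
    rw [blockOp_apply hθ m, Matrix.one_mulVec]
    ext1 i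
    rw [coe_spin, coe_spin]
    congr 1
    fin_cases i
    · exact f0.symm
    · exact f1.symm
    · exact f2.symm
    · exact f3.symm

end Blocks

/-! ### Norms of the spectral projectors -/

section Projectors

variable {θ : ℝ} (hθ : 0 < Real.cos θ) (m : ℝ) (n : ℕ)

/-- The spectral projector of the Dirac operator at an eigenvalue `μ` with `μ² = 2n + m²`. -/
noncomputable def specProj (μ : ℂ) : Spinor →L[ℂ] Spinor :=
  if μ = 0 then blockOp hθ n 1
  else (2 : ℂ)⁻¹ • (blockOp hθ n 1 + μ⁻¹ • blockOp hθ n (diracMatrix m n))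

theorem blockOp_single_zero (B : Matrix (Fin 4) (Fin 4) ℂ) (f : L2) :
    blockOp hθ n B (PiLp.single 2 0 f) 0
      = (B 0 0 * coef hθ n f) • (herm hθ n : L2) := by
  rw [blockOp_apply hθ 0, coe_spin]
  simp [ofCoords, coords, Matrix.mulVec, dotProduct, blockCoef, blockVec, Fin.sum_univ_four]

theorem specProj_single_zero {μ : ℂ} (hμ : μ ≠ 0) (f : L2) :
    specProj hθ m n μ (PiLp.single 2 0 f) 0
      = ((2 : ℂ)⁻¹ * coef hθ n f) • (herm hθ n : L2) := by
  rw [specProj, if_neg hμ]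
  simp only [smul_apply, add_apply, PiLp.smul_apply,
    PiLp.add_apply, blockOp_single_zero hθ]
  simp [diracMatrix, smul_smul]

theorem herm_ne_zero : (herm hθ n : L2) ≠ 0 := by
  intro h
  have := coef_herm_self hθ n
  rw [h, map_zero] at this
  exact zero_ne_one this

theorem isSpectralProjector_specProj {μ : ℝ} (h : μ * μ = 2 * n + m ^ 2) :
    IsSpectralProjector (diracOp θ m) (μ : ℂ) (specProj hθ m n μ) := by
  have key := isSquareReducing_diracOp hθ m n
  have h' : (μ : ℂ) * μ = 2 * n + (m : ℂ) ^ 2 := by exact_mod_cast h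
  have hne := herm_ne_zero hθ n
  have hself := coef_herm_self hθ n
  by_cases hμ : (μ : ℂ) = 0
  · -- Here `n = 0` and `m = 0`, so that the operator vanishes on the whole block.
    have hμ' : μ = 0 := by exact_mod_cast hμ
    rw [hμ', mul_zero] at h
    have hn0 : (0 : ℝ) ≤ n := Nat.cast_nonneg n
    have hn : n = 0 := by
      have : (n : ℝ) = 0 := by nlinarith [sq_nonneg m]
      exact_mod_cast this
    have hm : m = 0 := by nlinarith [sq_nonneg m]
    have hD : blockOp hθ n (diracMatrix m n) = 0 := by
      ext1 x
      rw [blockOp_apply hθ m, diracMatrix_mulVec, hn, hm]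
      ext1 i
      rw [coe_spin]
      fin_cases i <;> simp [ofCoords, ladderCoeff_zero]
    rw [hD, ← h', hμ, mul_zero] at key
    rw [specProj, if_pos hμ, hμ]
    refine key.isSpectralProjector_zero
      ⟨PiLp.single 2 0 (herm hθ n : L2), fun h0 => hne ?_⟩
    have := blockOp_single_zero hθ n 1 (herm hθ n : L2)
    rw [h0, hself] at this
    simpa using this.symm
  · have e : specProj hθ m n μ
        = (2 : ℂ)⁻¹ • (blockOp hθ n 1 + (μ : ℂ)⁻¹ • blockOp hθ n (diracMatrix m n)) := by
      rw [specProj, if_neg hμ]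
    rw [e]
    refine key.isSpectralProjector hμ h'
      ⟨PiLp.single 2 0 (herm hθ n : L2), fun h0 => hne ?_⟩
    have := specProj_single_zero hθ m n hμ (herm hθ n : L2)
    rw [e, h0, hself] at this
    simpa using this.symm

theorem norm_coef_le : ‖coef hθ n‖ ≤ ‖hermiteNorm hθ‖⁻¹ * ‖(herm hθ n : L2)‖ := by
  rw [coef, norm_smul, norm_inv, norm_pairS]; rfl

theorem norm_coefPred_le : ‖coefPred hθ n‖ ≤ ‖hermiteNorm hθ‖⁻¹ * ‖(hermPred hθ n : L2)‖ := by
  rw [coefPred, norm_smul, norm_inv, norm_pairS]; rfl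

theorem norm_spinor_le_of_forall {Ψ : Spinor} {a : ℝ} (ha : 0 ≤ a) (h : ∀ i, ‖Ψ i‖ ≤ a) :
    ‖Ψ‖ ≤ 2 * a := by
  refine le_of_sq_le_sq ?_ (by positivity)
  rw [PiLp.norm_sq_eq_of_L2]
  calc ∑ i, ‖Ψ i‖ ^ 2 ≤ ∑ _i : Fin 4, a ^ 2 :=
        Finset.sum_le_sum fun i _ => pow_le_pow_left₀ (norm_nonneg _) (h i) 2
    _ = (2 * a) ^ 2 := by simp; ring

theorem norm_blockOp_le {B : Matrix (Fin 4) (Fin 4) ℂ} {b : ℝ} (hB : ∀ i j, ‖B i j‖ ≤ b) :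
    ‖blockOp hθ n B‖
      ≤ 8 * b * ‖hermiteNorm hθ‖⁻¹ * (‖(herm hθ n : L2)‖ + ‖(hermPred hθ n : L2)‖) ^ 2 := by
  set K := ‖(herm hθ n : L2)‖ + ‖(hermPred hθ n : L2)‖ with hK
  have hb : 0 ≤ b := (norm_nonneg _).trans (hB 0 0)
  have k1 : ‖(herm hθ n : L2)‖ ≤ K := le_add_of_nonneg_right (norm_nonneg _)
  have k2 : ‖(hermPred hθ n : L2)‖ ≤ K := le_add_of_nonneg_left (norm_nonneg _)
  have hK0 : 0 ≤ K := by positivity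
  have hvec : ∀ i, ‖(blockVec hθ n i : L2)‖ ≤ K := by
    intro i; fin_cases i <;> simpa [blockVec]
  have hcoef : ∀ i, ‖blockCoef hθ n i‖ ≤ ‖hermiteNorm hθ‖⁻¹ * K := by
    have c1 := (norm_coef_le hθ n).trans (mul_le_mul_of_nonneg_left k1 (by positivity))
    have c2 := (norm_coefPred_le hθ n).trans (mul_le_mul_of_nonneg_left k2 (by positivity))
    intro i; fin_cases i <;> simpa [blockCoef]
  refine ContinuousLinearMap.opNorm_le_bound _ (by positivity) fun Ψ => ?_
  have : ∀ i, ‖blockOp hθ n B Ψ i‖ ≤ (4 * (b * (‖hermiteNorm hθ‖⁻¹ * K * ‖Ψ‖))) * K := by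
    intro i
    rw [blockOp_apply hθ 0, coe_spin, ofCoords, Submodule.coe_smul, norm_smul]
    refine mul_le_mul ?_ (hvec i) (norm_nonneg _) (by positivity)
    calc ‖∑ j, B i j * coords hθ n Ψ j‖
        ≤ ∑ _j : Fin 4, b * (‖hermiteNorm hθ‖⁻¹ * K * ‖Ψ‖) := by
          refine norm_sum_le_of_le _ fun j _ => ?_
          rw [norm_mul]
          refine mul_le_mul (hB i j) ?_ (norm_nonneg _) hb
          refine ((blockCoef hθ n j).le_opNorm _).trans ?_
          exact mul_le_mul (hcoef j) (PiLp.norm_apply_le Ψ j) (norm_nonneg _) (by positivity)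
      _ = _ := by simp
  refine (norm_spinor_le_of_forall (by positivity) this).trans (le_of_eq ?_)
  ring

theorem norm_diracMatrix_le {μ : ℝ} (h : μ * μ = 2 * n + m ^ 2) (i j : Fin 4) :
    ‖diracMatrix m n i j‖ ≤ |μ| := by
  have hm : |m| ≤ |μ| := by
    apply sq_le_sq.1
    nlinarith [(Nat.cast_nonneg n : (0 : ℝ) ≤ n)]
  have hl : ‖ladderCoeff n‖ ≤ |μ| := by
    rw [← abs_norm]
    apply sq_le_sq.1
    have : ‖ladderCoeff n‖ ^ 2 = 2 * n := by
      rw [pow_two, ← norm_mul, ladderCoeff_sq]; simp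
    rw [this]
    nlinarith [sq_nonneg m]
  fin_cases i <;> fin_cases j <;> simp [diracMatrix, hm, hl]

theorem norm_specProj_le {μ : ℝ} (h : μ * μ = 2 * n + m ^ 2) :
    ‖specProj hθ m n μ‖
      ≤ 8 * ‖hermiteNorm hθ‖⁻¹ * (‖(herm hθ n : L2)‖ + ‖(hermPred hθ n : L2)‖) ^ 2 := by
  have h1 : ‖blockOp hθ n 1‖ ≤ _ := norm_blockOp_le hθ n (b := 1) fun i j => by
    rw [Matrix.one_apply]; split_ifs <;> simp
  rw [mul_one] at h1
  rw [specProj]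
  split_ifs with hμ
  · exact h1
  · have hμ' : |μ| ≠ 0 := by simpa using hμ
    have h2 := norm_blockOp_le hθ n (norm_diracMatrix_le m n h)
    set K := (‖(herm hθ n : L2)‖ + ‖(hermPred hθ n : L2)‖) ^ 2
    have h3 : ‖(μ : ℂ)⁻¹ • blockOp hθ n (diracMatrix m n)‖ ≤ 8 * ‖hermiteNorm hθ‖⁻¹ * K := by
      rw [norm_smul, norm_inv, Complex.norm_real, Real.norm_eq_abs]
      refine (mul_le_mul_of_nonneg_left h2 (by positivity)).trans (le_of_eq ?_)
      field_simp
    have h4 := norm_add_le_of_le h1 h3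
    rw [norm_smul, norm_inv, Complex.norm_ofNat]
    linarith

theorem le_norm_specProj {μ : ℝ} (hμ : μ ≠ 0) :
    2⁻¹ * ‖hermiteNorm hθ‖⁻¹ * hermSq hθ n ≤ ‖specProj hθ m n μ‖ := by
  set f : L2 := (conjS (rotHermite hθ n)).toLp 2
  have hf : ‖f‖ = ‖(herm hθ n : L2)‖ := norm_conjS _
  have hpos : 0 < ‖f‖ := by rw [hf]; exact norm_pos_iff.2 (herm_ne_zero hθ n)
  have hc : coef hθ n f = (hermiteNorm hθ)⁻¹ * (hermSq hθ n : ℂ) :=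
    congrArg (fun z => (hermiteNorm hθ)⁻¹ * z) (pairS_conjS (rotHermite hθ n))
  have hsq : 0 ≤ hermSq hθ n := sq_nonneg _
  have h1 : ‖specProj hθ m n μ (PiLp.single 2 0 f) 0‖ ≤ ‖specProj hθ m n μ‖ * ‖f‖ := by
    refine (PiLp.norm_apply_le _ 0).trans ((ContinuousLinearMap.le_opNorm _ _).trans (le_of_eq ?_))
    congr 1
    exact PiLp.norm_single 2 (fun _ : Fin 4 => L2) 0 f
  rw [specProj_single_zero hθ m n (by exact_mod_cast hμ), norm_smul, hc, ← hf] at h1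
  refine le_trans (le_of_eq ?_) (le_of_mul_le_mul_right h1 hpos)
  simp only [norm_mul, norm_inv, Complex.norm_ofNat, Complex.norm_real, Real.norm_eq_abs,
    abs_of_nonneg hsq]
  ring

end Projectors

theorem exists_pos_le_norm_specProj {θ : ℝ} (hθ : 0 < Real.cos θ) (m : ℝ) :
    ∃ A : ℝ, 0 < A ∧ ∀ n : ℕ, 1 ≤ n → ∀ μ : ℝ, μ * μ = 2 * n + m ^ 2 →
      A * growthRate θ ^ n / (n + 1) ≤ ‖specProj hθ m n μ‖ := by
  have hγ : 0 < ‖hermiteNorm hθ‖ := norm_pos_iff.2 (hermiteNorm_ne_zero hθ)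
  have h0 := hermSq_zero_pos hθ
  refine ⟨4⁻¹ * ‖hermiteNorm hθ‖⁻¹ * hermSq hθ 0, by positivity, fun n hn μ h => ?_⟩
  have hμ : μ ≠ 0 := by
    rintro rfl
    have : (1 : ℝ) ≤ n := by exact_mod_cast hn
    nlinarith [sq_nonneg m]
  refine le_trans ?_ (le_norm_specProj hθ m n hμ)
  refine le_trans (le_of_eq ?_) (mul_le_mul_of_nonneg_left (hermSq_bounds hθ n).1 (by positivity))
  field_simp
  ring

theorem exists_norm_specProj_le {θ : ℝ} (hθ : 0 < Real.cos θ) (m : ℝ) :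
    ∃ B : ℝ, ∀ n : ℕ, 1 ≤ n → ∀ μ : ℝ, μ * μ = 2 * n + m ^ 2 →
      ‖specProj hθ m n μ‖ ≤ B * growthRate θ ^ n := by
  have hρ := growthRate_pos hθ
  refine ⟨16 * ‖hermiteNorm hθ‖⁻¹ * (hermSq hθ 0 * (1 + (growthRate θ)⁻¹)), fun n hn μ h => ?_⟩
  obtain ⟨k, rfl⟩ : ∃ k, n = k + 1 := ⟨n - 1, by omega⟩
  refine (norm_specProj_le hθ m (k + 1) h).trans ?_
  have h1 : ‖(herm hθ (k + 1) : L2)‖ ^ 2 ≤ _ := (hermSq_bounds hθ (k + 1)).2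
  have h2 : ‖(hermPred hθ (k + 1) : L2)‖ ^ 2 ≤ _ := (hermSq_bounds hθ k).2
  have h3 := add_sq_le (a := ‖(herm hθ (k + 1) : L2)‖) (b := ‖(hermPred hθ (k + 1) : L2)‖)
  calc 8 * ‖hermiteNorm hθ‖⁻¹ * (‖(herm hθ (k + 1) : L2)‖ + ‖(hermPred hθ (k + 1) : L2)‖) ^ 2
      ≤ 8 * ‖hermiteNorm hθ‖⁻¹ * (2 * (hermSq hθ 0 * growthRate θ ^ (k + 1)
          + hermSq hθ 0 * growthRate θ ^ k)) := by
        refine mul_le_mul_of_nonneg_left (h3.trans ?_) (by positivity)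
        linarith
    _ = _ := by field_simp; ring

theorem tendsto_log_norm_specProj {θ : ℝ} (hθ : 0 < Real.cos θ) (m : ℝ) {μ : ℕ → ℝ}
    (h : ∀ n, μ n * μ n = 2 * n + m ^ 2) :
    Tendsto (fun n : ℕ => Real.log ‖specProj hθ m n (μ n)‖ / n) atTop
      (𝓝 (Real.log √((1 + |Real.sin θ|) / (1 - |Real.sin θ|)))) := by
  obtain ⟨A, hA, hl⟩ := exists_pos_le_norm_specProj hθ m
  obtain ⟨B, hu⟩ := exists_norm_specProj_le hθ m
  rw [← growthRate_eq hθ]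
  exact tendsto_log_div hA (growthRate_pos hθ) (fun n hn => hl n hn _ (h n))
    fun n hn => hu n hn _ (h n)

/-! ### Bases of eigenvectors -/

section Bases

variable {E : Type*} [NormedAddCommGroup E]

/-- Eigenvectors at other eigenvalues are annihilated by a spectral projector. -/
theorem IsSpectralProjector.apply_eq_zero [NormedSpace ℂ E] {T : E →ₗ.[ℂ] E} {μ ν : ℂ}
    {P : E →L[ℂ] E} (h : IsSpectralProjector T μ P) {x : E} (hx : x ∈ eigenspace T ν)
    (hν : ν ≠ μ) : P x = 0 := by
  obtain ⟨y, rfl, hy⟩ := mem_eigenspace_iff.1 hx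
  have : (y : E) ∈ LinearMap.ker (P : E →ₗ[ℂ] E) := by
    rw [h.ker_eq]
    refine mem_shiftedRange_iff.2 ⟨(ν - μ)⁻¹ • y, ?_⟩
    rw [T.map_smul, hy, Submodule.coe_smul, smul_comm μ, ← smul_sub, ← sub_smul, smul_smul,
      inv_mul_cancel₀ (sub_ne_zero.2 hν), one_smul]
  exact this

theorem IsSpectralProjector.apply_eq_self [NormedSpace ℂ E] {T : E →ₗ.[ℂ] E} {μ : ℂ}
    {P : E →L[ℂ] E} (h : IsSpectralProjector T μ P) {x : E} (hx : x ∈ eigenspace T μ) :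
    P x = x := by
  rw [← h.range_eq] at hx
  obtain ⟨y, rfl⟩ := hx
  exact h.idem y

/-- If the eigenvectors of `T` contain a Schauder basis, then the spectral projectors onto
eigenspaces of bounded dimension are uniformly bounded: such a projector is a sum of at most `d`
of the rank-one projections of the basis. -/
theorem exists_forall_norm_spectralProjector_le [NormedSpace ℂ E] [CompleteSpace E]
    {T : E →ₗ.[ℂ] E} (b : SchauderBasis ℂ E) (hb : ∀ k, IsEigenvector T (b k)) (d : ℕ) :
    ∃ C : ℝ, ∀ (μ : ℂ) (P : E →L[ℂ] E), IsSpectralProjector T μ P →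
      FiniteDimensional ℂ (eigenspace T μ) → Module.finrank ℂ (eigenspace T μ) ≤ d → ‖P‖ ≤ C := by
  classical
  obtain ⟨C, hC⟩ := b.exists_norm_proj_le
  have hC0 : 0 ≤ C := (norm_nonneg _).trans (hC 0)
  refine ⟨d * (2 * C), fun μ P hP hfin hd => ?_⟩
  have hterm : ∀ k x, ‖b.coord k x • b k‖ ≤ 2 * C * ‖x‖ := by
    intro k x
    have e : b.coord k x • b k = b.proj (k + 1) x - b.proj k x := by
      rw [b.proj_apply, b.proj_apply, Finset.sum_range_succ, add_sub_cancel_left]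
    rw [e]
    refine (norm_sub_le _ _).trans ?_
    have h1 := (b.proj (k + 1)).le_of_opNorm_le (hC _) x
    have h2 := (b.proj k).le_of_opNorm_le (hC _) x
    linarith
  have hcard : ∀ N, ((Finset.range N).filter fun k => b k ∈ eigenspace T μ).card ≤ d := by
    intro N
    set S := (Finset.range N).filter fun k => b k ∈ eigenspace T μ with hS
    have hmem : ∀ k : S, b k ∈ eigenspace T μ := fun k => (Finset.mem_filter.1 k.2).2
    have hli : LinearIndependent ℂ fun k : S => (⟨b k, hmem k⟩ : eigenspace T μ) := by
      apply LinearIndependent.of_comp (eigenspace T μ).subtype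
      exact b.linearIndependent.comp (fun k : S => (k : ℕ)) Subtype.val_injective
    have := hli.fintype_card_le_finrank
    rw [Fintype.card_coe] at this
    exact this.trans hd
  have happ : ∀ k, P (b k) = if b k ∈ eigenspace T μ then b k else 0 := by
    intro k
    split_ifs with hk
    · exact hP.apply_eq_self hk
    · obtain ⟨-, ν, hν⟩ := hb k
      refine hP.apply_eq_zero hν ?_
      rintro rfl
      exact hk hν
  refine P.opNorm_le_bound (by positivity) fun x => ?_
  refine le_of_tendsto ((P.continuous.tendsto x).comp (b.tendsto_proj x)).norm
    (Eventually.of_forall fun N => ?_)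
  have e : P (b.proj N x)
      = ∑ k ∈ (Finset.range N).filter fun k => b k ∈ eigenspace T μ, b.coord k x • b k := by
    rw [b.proj_apply, map_sum, Finset.sum_filter]
    refine Finset.sum_congr rfl fun k _ => ?_
    rw [map_smul, happ]
    split_ifs <;> simp
  rw [Function.comp_apply, e]
  refine (norm_sum_le_of_le _ fun k _ => hterm k x).trans ?_
  rw [Finset.sum_const, nsmul_eq_mul, mul_assoc (d : ℝ)]
  exact mul_le_mul_of_nonneg_right (by exact_mod_cast hcard N) (by positivity)

theorem IsRieszBasis.isSchauderBasis [InnerProductSpace ℂ E] {e : ℕ → E} (h : IsRieszBasis e) :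
    IsSchauderBasis e := by
  obtain ⟨b, A, he⟩ := h
  refine ⟨⟨fun k => A (b k), fun k => (b.toSchauderBasis.coord k) ∘L (A.symm : E →L[ℂ] E),
    fun i j => ?_, fun x => ?_⟩, fun k => (he k).symm⟩
  · rw [ContinuousLinearMap.comp_apply, ContinuousLinearEquiv.coe_coe,
      ContinuousLinearEquiv.symm_apply_apply]
    exact b.toSchauderBasis.ortho i j
  · have := (b.toSchauderBasis.expansion (A.symm x)).map A A.continuous
    rw [ContinuousLinearEquiv.apply_symm_apply] at this
    refine this.congr_fun fun k => ?_
    simp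

end Bases

theorem finrank_eigenspace_le {θ : ℝ} (hθ : 0 < Real.cos θ) (m : ℝ) (n : ℕ) {μ : ℝ}
    (h : μ * μ = 2 * n + m ^ 2) : FiniteDimensional ℂ (eigenspace (diracOp θ m) μ) ∧
      Module.finrank ℂ (eigenspace (diracOp θ m) μ) ≤ 4 := by
  set v : Fin 4 → Spinor := fun i => PiLp.single 2 i (blockVec hθ n i : L2) with hv
  have hblock : ∀ B Ψ, blockOp hθ n B Ψ ∈ Submodule.span ℂ (Set.range v) := by
    intro B Ψ
    have e : blockOp hθ n B Ψ = ∑ i, B.mulVec (coords hθ n Ψ) i • v i := by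
      rw [blockOp_apply hθ 0]
      ext1 j
      rw [coe_spin, ofCoords, Submodule.coe_smul]
      fin_cases j <;> simp [hv, Fin.sum_univ_four]
    rw [e]
    exact Submodule.sum_mem _ fun i _ => Submodule.smul_mem _ _ (Submodule.subset_span ⟨i, rfl⟩)
  have hle : eigenspace (diracOp θ m) μ ≤ Submodule.span ℂ (Set.range v) := by
    rw [← (isSpectralProjector_specProj hθ m n h).range_eq]
    rintro _ ⟨Ψ, rfl⟩
    change specProj hθ m n μ Ψ ∈ _
    rw [specProj]
    split_ifs
    · exact hblock _ _
    · exact Submodule.smul_mem _ _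
        (Submodule.add_mem _ (hblock _ _) (Submodule.smul_mem _ _ (hblock _ _)))
  have : FiniteDimensional ℂ (Submodule.span ℂ (Set.range v)) :=
    FiniteDimensional.span_of_finite ℂ (Set.finite_range v)
  exact ⟨Submodule.finiteDimensional_of_le hle,
    (Submodule.finrank_mono hle).trans ((finrank_range_le_card v).trans (by simp))⟩

theorem not_isSchauderBasis {θ : ℝ} (hθ : 0 < Real.cos θ) (m : ℝ) (hs : Real.sin θ ≠ 0)
    {e : ℕ → Spinor} (he : ∀ k, IsEigenvector (diracOp θ m) (e k)) : ¬ IsSchauderBasis e := by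
  rintro ⟨b, hb⟩
  have hb' : ∀ k, IsEigenvector (diracOp θ m) (b k) := fun k => (hb k).symm ▸ he k
  obtain ⟨C, hC⟩ := exists_forall_norm_spectralProjector_le b hb' 4
  have hμ : ∀ n : ℕ, √(2 * n + m ^ 2) * √(2 * n + m ^ 2) = 2 * n + m ^ 2 := fun n =>
    Real.mul_self_sqrt (by positivity)
  have hbd : ∀ n : ℕ, ‖specProj hθ m n (√(2 * n + m ^ 2) : ℝ)‖ ≤ C := fun n =>
    hC _ _ (isSpectralProjector_specProj hθ m n (hμ n))
      (finrank_eigenspace_le hθ m n (hμ n)).1 (finrank_eigenspace_le hθ m n (hμ n)).2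
  obtain ⟨A, hA, hl⟩ := exists_pos_le_norm_specProj hθ m
  -- The bound `C` contradicts the exponential lower bound, since `C (n + 1) / growthRate θ ^ n`
  -- tends to zero.
  have hρ := one_lt_growthRate hθ hs
  have h1 : Tendsto (fun n : ℕ => C * ((n : ℝ) ^ 1 / growthRate θ ^ n
      + (n : ℝ) ^ 0 / growthRate θ ^ n)) atTop (𝓝 (C * (0 + 0))) :=
    ((tendsto_pow_const_div_const_pow_of_one_lt 1 hρ).add
      (tendsto_pow_const_div_const_pow_of_one_lt 0 hρ)).const_mul C
  rw [add_zero, mul_zero] at h1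
  obtain ⟨n, hn, hn1⟩ := ((h1.eventually_lt_const hA).and (eventually_ge_atTop 1)).exists
  have h2 := (hl n hn1 _ (hμ n)).trans (hbd n)
  have hpow : 0 < growthRate θ ^ n := pow_pos (growthRate_pos hθ) n
  rw [div_le_iff₀ (by positivity)] at h2
  rw [pow_one, pow_zero, ← add_div, mul_div_assoc', div_lt_iff₀ hpow] at hn
  exact absurd h2 (not_le.2 hn)

end RotatedDirac

theorem mainTheorem1 (θ m : ℝ) (hθ : θ ∈ Set.Ioo (-(Real.pi / 2)) (Real.pi / 2)) (hm : 0 ≤ m) :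
    (∃ Pplus Pminus : ℕ → (RotatedDirac.Spinor →L[ℂ] RotatedDirac.Spinor),
      (∀ n : ℕ, RotatedDirac.IsSpectralProjector (RotatedDirac.diracOp θ m)
        ((√(2 * n + m ^ 2) : ℝ) : ℂ) (Pplus n)) ∧
      (∀ n : ℕ, RotatedDirac.IsSpectralProjector (RotatedDirac.diracOp θ m)
        ((-√(2 * n + m ^ 2) : ℝ) : ℂ) (Pminus n)) ∧
      Tendsto (fun n : ℕ => Real.log ‖Pplus n‖ / n) atTop
        (𝓝 (Real.log √((1 + |Real.sin θ|) / (1 - |Real.sin θ|)))) ∧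
      Tendsto (fun n : ℕ => Real.log ‖Pminus n‖ / n) atTop
        (𝓝 (Real.log √((1 + |Real.sin θ|) / (1 - |Real.sin θ|))))) ∧
    (θ ≠ 0 → ∀ e : ℕ → RotatedDirac.Spinor,
      (∀ k, RotatedDirac.IsEigenvector (RotatedDirac.diracOp θ m) (e k)) →
        ¬ RotatedDirac.IsRieszBasis e ∧ ¬ RotatedDirac.IsSchauderBasis e) := by
  have hc : 0 < Real.cos θ := Real.cos_pos_of_mem_Ioo hθ
  have hμ : ∀ n : ℕ, √(2 * n + m ^ 2) * √(2 * n + m ^ 2) = 2 * n + m ^ 2 := fun n =>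
    Real.mul_self_sqrt (by positivity)
  have hμ' : ∀ n : ℕ, -√(2 * n + m ^ 2) * -√(2 * n + m ^ 2) = 2 * n + m ^ 2 := fun n => by
    rw [neg_mul_neg, hμ]
  refine ⟨⟨fun n => RotatedDirac.specProj hc m n (√(2 * n + m ^ 2) : ℝ),
    fun n => RotatedDirac.specProj hc m n (-√(2 * n + m ^ 2) : ℝ),
    fun n => RotatedDirac.isSpectralProjector_specProj hc m n (hμ n),
    fun n => RotatedDirac.isSpectralProjector_specProj hc m n (hμ' n),
    RotatedDirac.tendsto_log_norm_specProj hc m hμ,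
    RotatedDirac.tendsto_log_norm_specProj hc m hμ'⟩, fun h0 e he => ?_⟩
  have hs : Real.sin θ ≠ 0 := by
    have hpi := Real.pi_pos
    rw [Ne, Real.sin_eq_zero_iff_of_lt_of_lt (by linarith [hθ.1]) (by linarith [hθ.2])]
    exact h0
  have h := RotatedDirac.not_isSchauderBasis hc m hs he
  exact ⟨fun hr => h hr.isSchauderBasis, h⟩
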